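/- Let $g\ge 1$, let $p(x)=\sum_{k=0}^n a_kx^{n-k}$ be a complex polynomial without multiple zeros, of degree $n=2g+1$ or $n=2g+2$, and let $X_g$ be the compact hyperelliptic Riemann surface $y^2=p(x)$. Consider a state of a conformal field theory of central charge $c\in\mathbb{C}$ on $X_g$ with $\langle 1\rangle\neq 0$. Only the $N$-point functions of its Virasoro field $T$ matter: in local coordinates they are symmetric and holomorphic at pairwise distinct positions; under a change of coordinate $z\mapsto \hat z(z)$ at one position they transform by $T(z)=\hat T(\hat z)\,[\hat z']^2+\frac{c}{12}S(\hat z)\,1$, where $S(f)=\frac{f'''}{f'}-\frac32\left[\frac{f''}{f'}\right]^2$; and in every coordinate patch they are compatible with the operator product expansion $T(z)T(w)\mapsto\frac{c/2}{(z-w)^4}1+\frac{T(z)+T(w)}{(z-w)^2}+(\text{regular at } z=w)$. Let $T(x)$ be the Virasoro field in the coordinate $x$, at finite points $(x,y)$ of $X_g$ with $y\ne0$, and $$\langle T(x_1)T(x_2)\rangle_c=\langle 1\rangle^{-1}\langle T(x_1)T(x_2)\rangle-\langle 1\rangle^{-2}\langle T(x_1)\rangle\langle T(x_2)\rangle .$$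 There are polynomials $P^{e}(x)$, $P^{o}(x)$ such that $P(x,y)=P^{e}(x)+yP^{o}(x)$ satisfies $$p\,\langle T(x)\rangle=\frac{c}{32}\frac{[p']^2}{p}\langle 1\rangle+\frac14P(x,y).$$ Write $p_j=p(x_j)$, $p_j'=p'(x_j)$, $P_j=P(x_j,y_j)$, $P_j^{o}=P^{o}(x_j)$. For a polynomial $q$ let $q^{(\mathrm{even})}$, $q^{(\mathrm{odd})}$ be the even polynomials with $q(x)=q^{(\mathrm{even})}(x)+x\,q^{(\mathrm{odd})}(x)$. Put $s=\sqrt{x_1x_2}$; the polynomials evaluated at $s$ below (including $\frac1x p^{(\mathrm{even})\prime}(x)$ and $\frac1xp^{(\mathrm{odd})\prime}(x)$) are even, so the choice of the root does not matter. Put $$\begin{aligned}R(x_1,x_2)=\;&\frac c4\langle1\rangle\frac{p_1p_2}{(x_1-x_2)^4}+\frac c4y_1y_2\langle1\rangle\,\frac{p^{(\mathrm{even})}(s)+\frac12(x_1+x_2)p^{(\mathrm{odd})}(s)}{(x_1-x_2)^4}+\frac c{32}\langle1\rangle\frac{p_1'p_2'}{(x_1-x_2)^2}\\&+\frac c{32}y_1y_2\langle1\rangle\,\frac{\frac1sp^{(\mathrm{even})\prime}(s)+\frac32(x_1+x_2)\frac1sp^{(\mathrm{odd})\prime}(s)}{(x_1-x_2)^2}+\frac18\,\frac{p_1P_2+p_2P_1}{(x_1-x_2)^2}\\&+\frac18\left(y_1P_2^{o}+y_2P_1^{o}\right)\frac{p^{(\mathrm{even})}(s)+\frac12(x_1+x_2)p^{(\mathrm{odd})}(s)}{(x_1-x_2)^2}\\&+\frac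 c{32}y_1y_2\langle1\rangle\,\frac{p^{(\mathrm{even})\prime\prime}(s)+\frac12(x_1+x_2)p^{(\mathrm{odd})\prime\prime}(s)}{(x_1-x_2)^2}+\frac14y_1y_2\,\frac{P^{e(\mathrm{even})}(s)+\frac12(x_1+x_2)P^{e(\mathrm{odd})}(s)}{(x_1-x_2)^2}.\end{aligned}$$ Then the following holds at all finite points $(x_1,y_1)$, $(x_2,y_2)$ of $X_g$ with $y_1y_2\neq0$ and $x_1\neq x_2$. 1. If $n$ is odd, then for fixed $(x_2,y_2)$, $\langle T(x_1)T(x_2)\rangle_c\,p_1p_2=O(x_1^{n-3})$ as $x_1\to\infty$ on $X_g$. 2. $\langle T(x_1)T(x_2)\rangle p_1p_2-\langle1\rangle^{-1}\langle T(x_1)\rangle\langle T(x_2)\rangle p_1p_2=R(x_1,x_2)+Q(x_1,x_2,y_1,y_2)$ with a polynomial $Q$; in particular the difference from $R$ is regular at $x_1=x_2$ in the finite region. 3. If $n$ is odd, then $$\begin{aligned}&\langle T(x_1)T(x_2)\rangle p_1p_2-\langle1\rangle^{-1}\langle T(x_1)\rangle\langle T(x_2)\rangle p_1p_2=R(x_1,x_2)\\&-\frac18a_0\left(x_1^{n-2}P_2+x_2^{n-2}P_1\right)-\frac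 c{64}\langle1\rangle(n^2-1)a_0^2x_1^{n-2}x_2^{n-2}\\&-\frac18y_1a_1x_1^{\frac n2-\frac52}x_2^{\frac n2-\frac12}P_2^{o}-\frac18y_2a_1x_1^{\frac n2-\frac12}x_2^{\frac n2-\frac52}P_1^{o}\\&-\frac1{16}y_1a_0x_1^{\frac n2-\frac32}x_2^{\frac n2-\frac12}P_2^{o}-\frac1{16}y_2a_0x_1^{\frac n2-\frac12}x_2^{\frac n2-\frac32}P_1^{o}\\&-\frac3{16}y_1a_0x_1^{\frac n2-\frac52}x_2^{\frac n2+\frac12}P_2^{o}-\frac3{16}y_2a_0x_1^{\frac n2+\frac12}x_2^{\frac n2-\frac52}P_1^{o}\\&-\frac1{16}y_1a_2x_1^{\frac n2-\frac52}x_2^{\frac n2-\frac32}P_2^{o}-\frac1{16}y_2a_2x_1^{\frac n2-\frac32}x_2^{\frac n2-\frac52}P_1^{o}\\&+P^{(0)}(x_1,x_2)+y_1P^{(1)}(x_1,x_2)+y_2P^{(2)}(x_1,x_2)+y_1y_2P^{(1,2)}(x_1,x_2),\end{aligned}$$ where $P^{(0)},P^{(1)},P^{(2)},P^{(1,2)}$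 are polynomials depending on the state, such that: $P^{(0)}$ has degree at most $n-3$ in each of $x_1,x_2$; $P^{(1)}$ has degree at most $\frac{n-1}2-3$ in $x_1$ and at most $n-3$ in $x_2$; $P^{(2)}$ has degree at most $n-3$ in $x_1$ and at most $\frac{n-1}2-3$ in $x_2$; $P^{(1,2)}$ has degree at most $\frac{n-1}2-3$ in each of $x_1,x_2$ (a polynomial whose degree is bounded by a negative number is $0$). Moreover $P^{(0)}$, $P^{(1,2)}$ and $y_1P^{(1)}+y_2P^{(2)}$ are symmetric under exchange of the indices $1\leftrightarrow2$. -/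

import Mathlib

open Polynomial Filter Topology

noncomputable section

namespace HyperellipticCFT

/-! ### The compact Riemann surface of `y ^ 2 = p x` -/

/-- Names for the points: the finite points `(x, y)`, and the points over `x = ∞`, labelled by the
value of `v = y / x ^ (g + 1)`. -/
inductive Pt : Type
  | fin (x y : ℂ) : Pt
  | inf (v : ℂ) : Pt

/-- The set of points of the compact hyperelliptic surface `X_g : y ^ 2 = p x`, where `p` has degree
`2 * g + 1` or `2 * g + 2`. In the coordinates `u = 1 / x`, `v = y / x ^ (g + 1)` its equation is
`v ^ 2 = u ^ (2 * g + 2) * p (1 / u)`, whose right hand side at `u = 0` is the coefficient of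
`x ^ (2 * g + 2)` in `p`: there is one point over `∞` if `deg p = 2 * g + 1`, and there are two if
`deg p = 2 * g + 2`. -/
def surface (p : ℂ[X]) (g : ℕ) : Set Pt := fun P =>
  match P with
  | .fin x y => y ^ 2 = p.eval x
  | .inf v => v ^ 2 = p.coeff (2 * g + 2)

/-- The point with coordinates `u = 1 / x` and `v = y / x ^ (g + 1)`. -/
def nearInf (g : ℕ) (u v : ℂ) : Pt :=
  if u = 0 then .inf v else .fin u⁻¹ (v / u ^ (g + 1))

/-- The map `γ` into the surface is holomorphic near `t₀`, with nonvanishing derivative at `t₀`, in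
one of the two smooth affine models (`(x, y)` or `(u, v)`) of the surface. -/
def IsRegularAt (g : ℕ) (γ : ℂ → Pt) (t₀ : ℂ) : Prop :=
  (∃ ξ η : ℂ → ℂ, AnalyticAt ℂ ξ t₀ ∧ AnalyticAt ℂ η t₀ ∧ (deriv ξ t₀ ≠ 0 ∨ deriv η t₀ ≠ 0) ∧
      ∀ᶠ t in 𝓝 t₀, γ t = .fin (ξ t) (η t)) ∨
  (∃ u v : ℂ → ℂ, AnalyticAt ℂ u t₀ ∧ AnalyticAt ℂ v t₀ ∧ (deriv u t₀ ≠ 0 ∨ deriv v t₀ ≠ 0) ∧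
      ∀ᶠ t in 𝓝 t₀, γ t = nearInf g (u t) (v t))

/-- A coordinate patch of the surface together with a complex coordinate on it, given by the inverse
of the coordinate: `pt t` is the point of the patch whose coordinate is `t`. The values of `pt`
outside of `dom` are irrelevant. -/
structure CoordPatch (p : ℂ[X]) (g : ℕ) : Type where
  dom : Set ℂ
  isOpen_dom : IsOpen dom
  pt : ℂ → Pt
  pt_mem : ∀ t ∈ dom, pt t ∈ surface p g
  injOn_pt : Set.InjOn pt dom
  regular : ∀ t ∈ dom, IsRegularAt g pt t

/-- The coordinate `x` near a finite point `(x₀, y₀)` with `y₀ ≠ 0`; it depends on `y₀` only. It is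
defined where `p x / y₀ ^ 2` is off the closed negative real axis, and there
`y = y₀ * √(p x / y₀ ^ 2)` (principal branch). So the point with `x = x₀` is `(x₀, y₀)`. -/
def xPatch (p : ℂ[X]) (g : ℕ) (y₀ : ℂ) : CoordPatch p g where
  dom := {x | p.eval x / y₀ ^ 2 ∈ Complex.slitPlane}
  isOpen_dom := Complex.isOpen_slitPlane.preimage (p.continuous.div_const _)
  pt := fun x => .fin x (y₀ * (p.eval x / y₀ ^ 2) ^ (1 / 2 : ℂ))
  pt_mem := by
    intro x hx
    change (y₀ * (p.eval x / y₀ ^ 2) ^ (1 / 2 : ℂ)) ^ 2 = p.eval x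
    have h0 : y₀ ≠ 0 := by
      rintro rfl
      simp [Complex.slitPlane] at hx
    have h2 : ((p.eval x / y₀ ^ 2) ^ (1 / 2 : ℂ)) ^ 2 = p.eval x / y₀ ^ 2 := by
      rw [one_div]
      exact Complex.cpow_nat_inv_pow _ two_ne_zero
    rw [mul_pow, h2]
    field_simp
  injOn_pt := by
    intro a _ b _ hab
    exact (Pt.fin.inj hab).1
  regular := by
    intro x hx
    refine Or.inl ⟨fun t => t, fun t => y₀ * (p.eval t / y₀ ^ 2) ^ (1 / 2 : ℂ), analyticAt_id, ?_,
      Or.inl (by simp), Eventually.of_forall fun _ => rfl⟩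
    refine analyticAt_const.mul (AnalyticAt.cpow ?_ analyticAt_const hx)
    have hp : AnalyticAt ℂ (fun t => p.eval t) x :=
      p.differentiable.analyticAt x
    exact hp.div_const

/-- The point with coordinate `x₀` in `xPatch p g y₀` is `(x₀, y₀)`. -/
theorem xPatch_spec (p : ℂ[X]) (g : ℕ) {x₀ y₀ : ℂ} (h0 : y₀ ≠ 0) (h : y₀ ^ 2 = p.eval x₀) :
    x₀ ∈ (xPatch p g y₀).dom ∧ (xPatch p g y₀).pt x₀ = .fin x₀ y₀ := by
  have h1 : p.eval x₀ / y₀ ^ 2 = 1 := by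
    rw [← h]
    exact div_self (pow_ne_zero 2 h0)
  constructor
  · change p.eval x₀ / y₀ ^ 2 ∈ Complex.slitPlane
    rw [h1]
    exact Complex.one_mem_slitPlane
  · change Pt.fin x₀ (y₀ * (p.eval x₀ / y₀ ^ 2) ^ (1 / 2 : ℂ)) = _
    rw [h1]
    simp

/-! ### States, seen through the `N`-point functions of the Virasoro field -/

/-- The Schwarzian derivative. -/
def schwarzian (f : ℂ → ℂ) (t : ℂ) : ℂ :=
  iteratedDeriv 3 f t / deriv f t - 3 / 2 * (iteratedDeriv 2 f t / deriv f t) ^ 2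

/-- A finite family of positions, each given in a coordinate patch, is admissible if the positions
lie in their patches and are pairwise distinct points of the surface. -/
def Admissible {p : ℂ[X]} {g : ℕ} (s : Multiset (CoordPatch p g × ℂ)) : Prop :=
  (∀ i ∈ s, i.2 ∈ i.1.dom) ∧ (s.map fun i => i.1.pt i.2).Nodup

/-- The `N`-point functions (for all `N`) of the Virasoro field `T` in a state, at central charge
`c`, on the surface `y ^ 2 = p x`. The number `corr {(φ₁, t₁), …, (φ_N, t_N)}` is
`⟨T(t₁) ⋯ T(t_N)⟩`, where the `i`-th copy of `T` is written in the coordinate of the patch `φᵢ`;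
only its values at admissible families matter. -/
structure VirasoroState (p : ℂ[X]) (g : ℕ) (c : ℂ) : Type where
  corr : Multiset (CoordPatch p g × ℂ) → ℂ
  /-- The `N`-point functions are holomorphic in each position, as long as the positions are
  distinct. -/
  holomorphic : ∀ (φ : CoordPatch p g) (t₀ : ℂ) (s : Multiset (CoordPatch p g × ℂ)),
    Admissible ((φ, t₀) ::ₘ s) → AnalyticAt ℂ (fun t => corr ((φ, t) ::ₘ s)) t₀
  /-- Change of coordinates `t ↦ h t` in one position:
  `T(t) = T̂(h t) * h'(t) ^ 2 + (c / 12) * S(h)(t) * 1`. -/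
  transform : ∀ (φ ψ : CoordPatch p g) (h : ℂ → ℂ) (t₀ : ℂ)
    (s : Multiset (CoordPatch p g × ℂ)),
    Admissible ((φ, t₀) ::ₘ s) → AnalyticAt ℂ h t₀ →
    (∀ᶠ t in 𝓝 t₀, h t ∈ ψ.dom ∧ φ.pt t = ψ.pt (h t)) →
    corr ((φ, t₀) ::ₘ s) =
      corr ((ψ, h t₀) ::ₘ s) * deriv h t₀ ^ 2 + c / 12 * schwarzian h t₀ * corr s
  /-- Compatibility with the Virasoro OPE, in every coordinate patch: `T(t) T(t₀)` equals
  `(c / 2) / (t - t₀) ^ 4 * 1 + (T(t) + T(t₀)) / (t - t₀) ^ 2` up to a term that is regular at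
  `t = t₀`. -/
  ope : ∀ (φ : CoordPatch p g) (t₀ : ℂ) (s : Multiset (CoordPatch p g × ℂ)),
    Admissible ((φ, t₀) ::ₘ s) →
    ∃ F : ℂ → ℂ, AnalyticAt ℂ F t₀ ∧ ∀ᶠ t in 𝓝[≠] t₀,
      corr ((φ, t) ::ₘ (φ, t₀) ::ₘ s) =
        c / 2 / (t - t₀) ^ 4 * corr s
          + 1 / (t - t₀) ^ 2 * (corr ((φ, t) ::ₘ s) + corr ((φ, t₀) ::ₘ s)) + F t

namespace VirasoroState

variable {p : ℂ[X]} {g : ℕ} {c : ℂ} (S : VirasoroState p g c)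

/-- `⟨1⟩`. -/
def one : ℂ := S.corr 0

/-- `⟨T(x)⟩` at the point `(x, y)`, `y ≠ 0`, in the coordinate `x`. -/
def T₁ (x y : ℂ) : ℂ := S.corr {(xPatch p g y, x)}

/-- `⟨T(x₁) T(x₂)⟩` at the points `(x₁, y₁)` and `(x₂, y₂)`, `y₁, y₂ ≠ 0`, in the coordinate `x`. -/
def T₂ (x₁ y₁ x₂ y₂ : ℂ) : ℂ := S.corr {(xPatch p g y₁, x₁), (xPatch p g y₂, x₂)}

/-- The connected two-point function `⟨T(x₁) T(x₂)⟩_c`. -/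
def T₂c (x₁ y₁ x₂ y₂ : ℂ) : ℂ :=
  S.one⁻¹ * S.T₂ x₁ y₁ x₂ y₂ - (S.one ^ 2)⁻¹ * S.T₁ x₁ y₁ * S.T₁ x₂ y₂

end VirasoroState

/-! ### The rational function `R` -/

/-- The even polynomial `q^(even)` in `q x = q^(even) x + x * q^(odd) x`. -/
def evenPart (q : ℂ[X]) : ℂ[X] := expand ℂ 2 (contract 2 q)

/-- The even polynomial `q^(odd)` in `q x = q^(even) x + x * q^(odd) x`. -/
def oddPart (q : ℂ[X]) : ℂ[X] := expand ℂ 2 (contract 2 q.divX)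

/-- For an even polynomial `q`, the value `q(√w)`, as a polynomial in `w`. -/
def evalSqrt (q : ℂ[X]) (w : ℂ) : ℂ := (contract 2 q).eval w

theorem evenPart_add_oddPart (q : ℂ[X]) : evenPart q + X * oddPart q = q := by
  ext k
  rcases Nat.even_or_odd' k with ⟨m, rfl | rfl⟩
  · rcases m with _ | m
    · simp [evenPart, coeff_expand, coeff_contract]
    · have h : ¬ 2 ∣ 2 * m + 1 := by omega
      rw [show 2 * (m + 1) = (2 * m + 1) + 1 by ring, coeff_add, coeff_X_mul]
      simp only [evenPart, oddPart, coeff_expand two_pos, h, if_false, add_zero]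
      rw [if_pos (by omega), coeff_contract two_ne_zero]
      congr 1
      omega
  · have h : ¬ 2 ∣ 2 * m + 1 := by omega
    rw [coeff_add, coeff_X_mul]
    simp only [evenPart, oddPart, coeff_expand two_pos, h, if_false, zero_add]
    rw [if_pos (by omega), coeff_contract two_ne_zero, coeff_divX]
    congr 1
    omega

theorem evalSqrt_sq (q : ℂ[X]) (hq : ∀ k, Odd k → q.coeff k = 0) (s : ℂ) :
    evalSqrt q (s ^ 2) = q.eval s := by
  have h : expand ℂ 2 (contract 2 q) = q := by
    ext k
    rw [coeff_expand two_pos]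
    split_ifs with hk
    · rw [coeff_contract two_ne_zero, Nat.div_mul_cancel hk]
    · refine (hq k ?_).symm
      rw [← Nat.not_even_iff_odd, even_iff_two_dvd]
      exact hk
  conv_rhs => rw [← h, expand_eval]
  rfl

/-- The even polynomial `q'(x) / x`, for an even polynomial `q`. -/
def derivDivX (q : ℂ[X]) : ℂ[X] := (derivative q).divX

/-- The rational function `R(x₁, x₂)` of `x₁`, `x₂`, `y₁`, `y₂`. Here `one` is `⟨1⟩`, the polynomials
`Pe` and `Po` are the Galois-even and Galois-odd part of `P(x, y) = Pe x + y * Po x`. In the last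
term, `(1 / 4) * Pe` stands for `-(c / 32) * Π`, where `Pe = -(c / 8) * Π`. -/
def R (c one : ℂ) (p Pe Po : ℂ[X]) (x₁ y₁ x₂ y₂ : ℂ) : ℂ :=
  c / 4 * one * (p.eval x₁ * p.eval x₂ / (x₁ - x₂) ^ 4)
  + c / 4 * y₁ * y₂ * one *
      (evalSqrt (evenPart p) (x₁ * x₂) / (x₁ - x₂) ^ 4
        + 1 / 2 * (x₁ + x₂) * (evalSqrt (oddPart p) (x₁ * x₂) / (x₁ - x₂) ^ 4))
  + c / 32 * one * ((derivative p).eval x₁ * (derivative p).eval x₂ / (x₁ - x₂) ^ 2)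
  + c / 32 * y₁ * y₂ * one *
      (evalSqrt (derivDivX (evenPart p)) (x₁ * x₂) / (x₁ - x₂) ^ 2
        + 3 / 2 * (x₁ + x₂) * (evalSqrt (derivDivX (oddPart p)) (x₁ * x₂) / (x₁ - x₂) ^ 2))
  + 1 / 8 * ((p.eval x₁ * (Pe.eval x₂ + y₂ * Po.eval x₂)
      + p.eval x₂ * (Pe.eval x₁ + y₁ * Po.eval x₁)) / (x₁ - x₂) ^ 2)
  + 1 / 8 * (y₁ * Po.eval x₂ + y₂ * Po.eval x₁) *
      (evalSqrt (evenPart p) (x₁ * x₂) / (x₁ - x₂) ^ 2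
        + 1 / 2 * (x₁ + x₂) * (evalSqrt (oddPart p) (x₁ * x₂) / (x₁ - x₂) ^ 2))
  + c / 32 * y₁ * y₂ * one *
      (evalSqrt (derivative (derivative (evenPart p))) (x₁ * x₂) / (x₁ - x₂) ^ 2
        + 1 / 2 * (x₁ + x₂) *
          (evalSqrt (derivative (derivative (oddPart p))) (x₁ * x₂) / (x₁ - x₂) ^ 2))
  + 1 / 4 * y₁ * y₂ *
      (evalSqrt (evenPart Pe) (x₁ * x₂) / (x₁ - x₂) ^ 2
        + 1 / 2 * (x₁ + x₂) * (evalSqrt (oddPart Pe) (x₁ * x₂) / (x₁ - x₂) ^ 2))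

/-- The coefficient `a k` of `x ^ (n - k)` in `p`, where `n = deg p` and `k ≤ n`. -/
def descCoeff (p : ℂ[X]) (k : ℕ) : ℂ := p.coeff (p.natDegree - k)

/-- The terms that are added to `R` when `n = deg p = 2 * g + 1` is odd. The exponents are integers:
`n / 2 - 5 / 2 = g - 2`, `n / 2 - 3 / 2 = g - 1`, `n / 2 - 1 / 2 = g`, `n / 2 + 1 / 2 = g + 1`. -/
def correction (g : ℕ) (c one : ℂ) (p Pe Po : ℂ[X]) (x₁ y₁ x₂ y₂ : ℂ) : ℂ :=
  -(1 / 8) * descCoeff p 0 * (x₁ ^ (p.natDegree - 2) * (Pe.eval x₂ + y₂ * Po.eval x₂)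
      + x₂ ^ (p.natDegree - 2) * (Pe.eval x₁ + y₁ * Po.eval x₁))
  - c / 64 * one * ((p.natDegree : ℂ) ^ 2 - 1) * descCoeff p 0 ^ 2
      * x₁ ^ (p.natDegree - 2) * x₂ ^ (p.natDegree - 2)
  - 1 / 8 * y₁ * descCoeff p 1 * x₁ ^ ((g : ℤ) - 2) * x₂ ^ (g : ℤ) * Po.eval x₂
  - 1 / 8 * y₂ * descCoeff p 1 * x₁ ^ (g : ℤ) * x₂ ^ ((g : ℤ) - 2) * Po.eval x₁
  - 1 / 16 * y₁ * descCoeff p 0 * x₁ ^ ((g : ℤ) - 1) * x₂ ^ (g : ℤ) * Po.eval x₂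
  - 1 / 16 * y₂ * descCoeff p 0 * x₁ ^ (g : ℤ) * x₂ ^ ((g : ℤ) - 1) * Po.eval x₁
  - 3 / 16 * y₁ * descCoeff p 0 * x₁ ^ ((g : ℤ) - 2) * x₂ ^ ((g : ℤ) + 1) * Po.eval x₂
  - 3 / 16 * y₂ * descCoeff p 0 * x₁ ^ ((g : ℤ) + 1) * x₂ ^ ((g : ℤ) - 2) * Po.eval x₁
  - 1 / 16 * y₁ * descCoeff p 2 * x₁ ^ ((g : ℤ) - 2) * x₂ ^ ((g : ℤ) - 1) * Po.eval x₂
  - 1 / 16 * y₂ * descCoeff p 2 * x₁ ^ ((g : ℤ) - 1) * x₂ ^ ((g : ℤ) - 2) * Po.eval x₁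

/-- The value `Q(x₁, x₂)` of a polynomial in two variables. -/
def eval₂v (Q : MvPolynomial (Fin 2) ℂ) (x₁ x₂ : ℂ) : ℂ := MvPolynomial.eval ![x₁, x₂] Q

/-- `Q` has degree at most `k` in the `i`-th variable (so `Q = 0` if `k < 0`). -/
def DegLE (Q : MvPolynomial (Fin 2) ℂ) (i : Fin 2) (k : ℤ) : Prop :=
  ∀ d ∈ Q.support, (d i : ℤ) ≤ k

end HyperellipticCFT

end

namespace HyperellipticCFT

/-! Write `n` for the degree of `p`, `a₀` for its leading coefficient, and fix the second point. In
the connected two-point function the Schwarzian terms of the transformation law cancel, so in the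
first point it is a quadratic differential (`transform_conn`), holomorphic away from the second
point. At a branch point `y` is a coordinate and `p (dy/dx)² = p'²/4`, so multiplication by `p`
makes it bounded there. For odd `n` the coordinate at infinity is `v = y / x^(g+1)`, and `p
(dv/dx)²` is `x^(n-3)` times a bounded function; this gives the growth claim. For the one-point
function the Schwarzian `S(√p) = 3/8 (p'/p)² + S(p)` remains. Its first summand is the source of
`(c/32) p'²/p`, and the expansion at infinity gives `P` the leading term `-(c/8)⟨1⟩(n²-1) a₀
x^(n-2)` for odd `n`.

After multiplication by `p₁p₂` the only finite pole is at `x₁ = x₂`. On the sheet `y₁ = y₂` it is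
dictated by the OPE, on the sheet `y₁ = -y₂` there is none. `R` is rational in `x₁, x₂` and linear
in each `yᵢ`, and has both properties. The reason is `polar_expansion`: with `h = x₁ - x₂`, the
function of `x₁ + x₂` and `x₁x₂` that multiplies `y₁y₂` agrees with `(p₁ + p₂)/2` up to `O(h⁴)`.
With `pᵢ = yᵢ²` the strongest pole becomes `(c/8)⟨1⟩ y₁y₂(y₁ + y₂)²/h⁴`. One sheet reproduces the
OPE (`singular_part_same_sheet`), while on the other `y₁ + y₂` vanishes to first order and the rest
cancels (`singular_part_opposite_sheet`).

The difference from `R` is therefore regular at finite points and of polynomial growth, hence of the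
form `E(x₁) + y₁ O(x₁)` by Liouville's theorem on the curve (`exists_polynomials_of_growth`,
`exists_polynomials_reg`). Being symmetric, it is polynomial in both points, by Lagrange
interpolation (`exists_bival_of_symmetric`).

For odd `n`, `R` itself grows faster than `x₁^(n-3)`. The correction terms are minus the excess
terms of its expansion as `x₁ → ∞`, completed so as to be symmetric in the two points. `R` plus the
correction is `O(x₁^(n-3))` in its `y₁`-even part and `O(x₁^(g-3))` in the coefficient of `y₁`
(`growthLE_R₀_add_correction₀`, `growthLE_R₁_add_correction₁`). Since the two-point function is
`O(x₁^(n-3))` as well, so is the polynomial remainder, and its growth bounds the degrees. -/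

/-! ### Liouville's theorem with growth, and removable singularities -/

theorem exists_polynomial_of_growth (k : ℕ) : ∀ (f : ℂ → ℂ), Differentiable ℂ f → ∀ C : ℝ,
    (∀ᶠ z in Bornology.cobounded ℂ, ‖f z‖ ≤ C * ‖z‖ ^ k) →
    ∃ q : ℂ[X], q.natDegree ≤ k ∧ ∀ z, f z = q.eval z := by
  induction k with
  | zero =>
    intro f hf C hC
    have hb : Bornology.IsBounded (Set.range f) := by
      obtain ⟨R, -, hR⟩ := (Metric.hasBasis_cobounded_compl_closedBall (0 : ℂ)).eventually_iff.1 hC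
      obtain ⟨B, hB⟩ := (isCompact_closedBall (0 : ℂ) R).exists_bound_of_continuousOn
        hf.continuous.continuousOn
      rw [isBounded_iff_forall_norm_le]
      refine ⟨max B C, ?_⟩
      rintro _ ⟨z, rfl⟩
      by_cases hz : z ∈ Metric.closedBall (0 : ℂ) R
      · exact (hB z hz).trans (le_max_left _ _)
      · have := hR (x := z) hz
        simp only [pow_zero, mul_one] at this
        exact this.trans (le_max_right _ _)
    obtain ⟨a, ha⟩ := hf.exists_const_forall_eq_of_bounded hb
    exact ⟨Polynomial.C a, by simp, fun z => by simp [ha z]⟩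
  | succ k ih =>
    intro f hf C hC
    have hd : Differentiable ℂ (dslope f 0) := by
      rw [← differentiableOn_univ]
      exact (Complex.differentiableOn_dslope univ_mem).2 hf.differentiableOn
    -- The quotient `(f z - f 0) / z` is entire and grows one order slower; `‖f 0‖` is absorbed
    -- because `‖z‖ ≥ 1`.
    obtain ⟨q, hq, hqf⟩ := ih (dslope f 0) hd (C + ‖f 0‖) (by
      filter_upwards [hC, eventually_cobounded_le_norm (1 : ℝ)] with z hz hz1
      have hz0 : z ≠ 0 := by
        rintro rfl
        norm_num at hz1
      rw [dslope_of_ne _ hz0, slope_def_field, norm_div, sub_zero,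
        div_le_iff₀ (norm_pos_iff.2 hz0)]
      have h1 : (1 : ℝ) ≤ ‖z‖ ^ (k + 1) := one_le_pow₀ hz1
      calc ‖f z - f 0‖ ≤ ‖f z‖ + ‖f 0‖ := norm_sub_le _ _
        _ ≤ C * ‖z‖ ^ (k + 1) + ‖f 0‖ * ‖z‖ ^ (k + 1) :=
            add_le_add hz (le_mul_of_one_le_right (norm_nonneg _) h1)
        _ = _ := by ring)
    refine ⟨Polynomial.C (f 0) + X * q, ?_, fun z => ?_⟩
    · refine (natDegree_add_le _ _).trans ?_
      simp only [natDegree_C, zero_le, sup_of_le_right]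
      exact natDegree_mul_le.trans (by rw [natDegree_X]; omega)
    · have := sub_smul_dslope f 0 z
      simp only [sub_zero, smul_eq_mul] at this
      simp [← hqf, this]

theorem natDegree_le_of_growth {q : ℂ[X]} {k : ℕ} {C : ℝ}
    (h : ∀ᶠ z in Bornology.cobounded ℂ, ‖q.eval z‖ ≤ C * ‖z‖ ^ k) : q.natDegree ≤ k := by
  obtain ⟨r, hr, hqr⟩ := exists_polynomial_of_growth k (fun z => q.eval z) q.differentiable C h
  rwa [Polynomial.funext hqr]

/-- Riemann's theorem, one point at a time: replacing the value at `a` by the limit changes `f`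
nowhere else, so the hypotheses persist at the remaining points. -/
theorem exists_differentiable_extension (S : Finset ℂ) : ∀ f : ℂ → ℂ,
    (∀ z ∉ S, DifferentiableAt ℂ f z) →
    (∀ s ∈ S, f =o[𝓝[≠] s] fun z => (z - s)⁻¹) →
    ∃ F : ℂ → ℂ, Differentiable ℂ F ∧ ∀ z ∉ S, F z = f z := by
  classical
  induction S using Finset.induction_on with
  | empty => exact fun f hf _ => ⟨f, fun z => hf z (by simp), fun _ _ => rfl⟩
  | insert a S ha ih =>
    intro f hf ho
    set f₁ := Function.update f a (limUnder (𝓝[≠] a) f) with hf₁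
    have hne : ∀ z, z ≠ a → f₁ =ᶠ[𝓝 z] f := fun z hz => by
      filter_upwards [isOpen_ne.mem_nhds hz] with w hw
      exact Function.update_of_ne hw _ _
    suffices h : (∀ z ∉ S, DifferentiableAt ℂ f₁ z) ∧
        ∀ s ∈ S, f₁ =o[𝓝[≠] s] fun z => (z - s)⁻¹ by
      obtain ⟨F, hF, hFf⟩ := ih f₁ h.1 h.2
      refine ⟨F, hF, fun z hz => ?_⟩
      rw [Finset.mem_insert, not_or] at hz
      rw [hFf z hz.2]
      exact (hne z hz.1).self_of_nhds
    refine ⟨fun z hz => ?_, fun s hs => ?_⟩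
    · by_cases hza : z = a
      · subst hza
        have hU : ((S : Set ℂ))ᶜ ∈ 𝓝 z := S.finite_toSet.isClosed.isOpen_compl.mem_nhds (by simpa)
        have hinv : Tendsto (fun w : ℂ => ‖(w - z)⁻¹‖) (𝓝[≠] z) atTop := by
          have := (tendsto_inv₀_nhdsNE_zero (α := ℂ))
          refine tendsto_norm_cobounded_atTop.comp (this.comp ?_)
          refine tendsto_nhdsWithin_iff.2 ⟨?_, ?_⟩
          · have : Tendsto (fun w : ℂ => w - z) (𝓝 z) (𝓝 (z - z)) :=
              (continuous_sub_right z).tendsto z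
            rw [sub_self] at this
            exact this.mono_left nhdsWithin_le_nhds
          · filter_upwards [self_mem_nhdsWithin] with w hw
            exact sub_ne_zero.2 hw
        have := Complex.differentiableOn_update_limUnder_of_isLittleO (f := f) hU
          (fun w hw => (hf w (by
            rw [Finset.mem_insert, not_or]; exact ⟨hw.2, by simpa using hw.1⟩)).differentiableWithinAt)
          ((ho z (Finset.mem_insert_self _ _)).sub
            ((Asymptotics.isLittleO_const_left.2 (Or.inr hinv))))
        exact this.differentiableAt hU
      · exact (hf z (by simp [hza, hz])).congr_of_eventuallyEq (hne z hza)
    · have hsa : s ≠ a := fun h => ha (h ▸ hs)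
      exact (ho s (Finset.mem_insert_of_mem hs)).congr'
        ((hne s hsa).filter_mono nhdsWithin_le_nhds).symm EventuallyEq.rfl

/-! ### Branches of `y`, and Liouville's theorem on the curve -/

theorem eval_derivative_ne_zero {p : ℂ[X]} (hp : Squarefree p) {r : ℂ} (hr : p.eval r = 0) :
    (derivative p).eval r ≠ 0 := by
  have := (PerfectField.separable_iff_squarefree.2 hp).eval₂_derivative_ne_zero (RingHom.id ℂ)
    (x := r) hr
  exact this

/-- The branch of `√(p x)` near a point `x₀` with value `y₀` at `x₀`, where `y₀ ^ 2 = p x₀`. -/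
noncomputable def sqrtBranch (p : ℂ[X]) (y₀ x : ℂ) : ℂ := y₀ * (p.eval x / y₀ ^ 2) ^ (1 / 2 : ℂ)

theorem sqrtBranch_sq (p : ℂ[X]) {y₀ : ℂ} (h0 : y₀ ≠ 0) (x : ℂ) :
    sqrtBranch p y₀ x ^ 2 = p.eval x := by
  have h2 : ((p.eval x / y₀ ^ 2) ^ (1 / 2 : ℂ)) ^ 2 = p.eval x / y₀ ^ 2 := by
    rw [one_div]
    exact Complex.cpow_nat_inv_pow _ two_ne_zero
  rw [sqrtBranch, mul_pow, h2]
  field_simp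

theorem sqrtBranch_self {p : ℂ[X]} {x₀ y₀ : ℂ} (h0 : y₀ ≠ 0) (h : y₀ ^ 2 = p.eval x₀) :
    sqrtBranch p y₀ x₀ = y₀ := by
  rw [sqrtBranch, ← h, div_self (pow_ne_zero 2 h0), Complex.one_cpow, mul_one]

theorem sqrtBranch_neg (p : ℂ[X]) (y₀ x : ℂ) : sqrtBranch p (-y₀) x = -sqrtBranch p y₀ x := by
  simp [sqrtBranch]

theorem analyticAt_eval (p : ℂ[X]) (x : ℂ) : AnalyticAt ℂ (fun t => p.eval t) x :=
  p.differentiable.analyticAt x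

theorem analyticAt_sqrtBranch {p : ℂ[X]} {x₀ y₀ : ℂ} (h0 : y₀ ≠ 0) (h : y₀ ^ 2 = p.eval x₀) :
    AnalyticAt ℂ (sqrtBranch p y₀) x₀ := by
  refine analyticAt_const.mul (AnalyticAt.cpow (analyticAt_eval p x₀).div_const analyticAt_const ?_)
  rw [← h, div_self (pow_ne_zero 2 h0)]
  exact Complex.one_mem_slitPlane

theorem sqrtBranch_ne_zero {p : ℂ[X]} {y₀ : ℂ} (h0 : y₀ ≠ 0) {x : ℂ} (hx : p.eval x ≠ 0) :
    sqrtBranch p y₀ x ≠ 0 := by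
  intro h
  have := sqrtBranch_sq p h0 x
  rw [h] at this
  exact hx (by rw [← this]; simp)

theorem eq_or_eq_neg_sqrtBranch {p : ℂ[X]} {y₀ x y : ℂ} (h0 : y₀ ≠ 0) (h : y ^ 2 = p.eval x) :
    y = sqrtBranch p y₀ x ∨ y = -sqrtBranch p y₀ x :=
  sq_eq_sq_iff_eq_or_eq_neg.1 (h.trans (sqrtBranch_sq p h0 x).symm)

theorem exists_sq_eq_eval (p : ℂ[X]) (x : ℂ) : ∃ y, y ^ 2 = p.eval x :=
  ⟨p.eval x ^ ((2 : ℕ) : ℂ)⁻¹, Complex.cpow_nat_inv_pow _ two_ne_zero⟩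

/-- The zeros of `p` are simple, so `(x - s)² / p` tends to `0`; then take square roots of norms. No
continuity of `r` is needed. This makes the odd part of a bounded function, which is divided by `y`,
removable at branch points. -/
theorem isLittleO_inv_sqrt {p : ℂ[X]} (hp : Squarefree p) (s : ℂ) (r : ℂ → ℂ)
    (hr : ∀ x, r x ^ 2 = p.eval x) : (fun x => (r x)⁻¹) =o[𝓝[≠] s] fun x => (x - s)⁻¹ := by
  have key : Tendsto (fun x => (x - s) ^ 2 / p.eval x) (𝓝[≠] s) (𝓝 0) := by
    by_cases h : p.eval s = 0
    · have hdiv : X - C s ∣ p := dvd_iff_isRoot.2 h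
      obtain ⟨q, rfl⟩ := hdiv
      have hq : q.eval s ≠ 0 := by
        have := eval_derivative_ne_zero hp h
        simpa using this
      have h1 : Tendsto (fun x => (x - s) / q.eval x) (𝓝[≠] s) (𝓝 0) := by
        have : ContinuousAt (fun x => (x - s) / q.eval x) s :=
          (continuousAt_id.sub continuousAt_const).div q.continuous.continuousAt hq
        have := this.tendsto
        simp only [sub_self, zero_div] at this
        exact this.mono_left nhdsWithin_le_nhds
      refine h1.congr' ?_
      filter_upwards [self_mem_nhdsWithin] with x hx
      have : x - s ≠ 0 := sub_ne_zero.2 hx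
      simp only [eval_mul, eval_sub, eval_X, eval_C]
      rw [sq, mul_div_mul_left _ _ this]
    · have : ContinuousAt (fun x => (x - s) ^ 2 / p.eval x) s :=
          ((continuousAt_id.sub continuousAt_const).pow 2).div p.continuous.continuousAt h
      have := this.tendsto
      simp only [sub_self, zero_div, ne_eq, OfNat.ofNat_ne_zero, not_false_eq_true,
        zero_pow] at this
      exact this.mono_left nhdsWithin_le_nhds
  rw [Asymptotics.isLittleO_iff]
  intro c hc
  have := (tendsto_zero_iff_norm_tendsto_zero.1 key).eventually_lt_const (pow_pos hc 2)
  filter_upwards [this, self_mem_nhdsWithin] with x hx hxs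
  have hxs' : 0 < ‖x - s‖ := norm_pos_iff.2 (sub_ne_zero.2 hxs)
  rw [← hr, norm_div, norm_pow, norm_pow, ← div_pow] at hx
  have := lt_of_pow_lt_pow_left₀ 2 hc.le hx
  rw [norm_inv, norm_inv, ← div_eq_mul_inv, le_div_iff₀ hxs', inv_mul_eq_div]
  exact this.le

/-- Liouville's theorem for a function `F x y` on the curve `y ^ 2 = p x`. -/
theorem exists_polynomials_of_growth {p : ℂ[X]} (hp : Squarefree p) (hdeg : 0 < p.natDegree)
    (S : Finset ℂ) (hS : ∀ x, p.eval x = 0 → x ∈ S) (F : ℂ → ℂ → ℂ)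
    (hF : ∀ x₀ y₀, x₀ ∉ S → y₀ ^ 2 = p.eval x₀ →
      AnalyticAt ℂ (fun x => F x (sqrtBranch p y₀ x)) x₀)
    (hb : ∀ s ∈ S, ∃ C : ℝ, ∀ᶠ x in 𝓝[≠] s, ∀ y, y ^ 2 = p.eval x → ‖F x y‖ ≤ C)
    {k : ℕ} {C : ℝ}
    (hg : ∀ᶠ x in Bornology.cobounded ℂ, ∀ y, y ^ 2 = p.eval x → ‖F x y‖ ≤ C * ‖x‖ ^ k) :
    ∃ E O : ℂ[X], E.natDegree ≤ k ∧ (O ≠ 0 → 2 * O.natDegree + p.natDegree ≤ 2 * k) ∧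
      ∀ x y, x ∉ S → y ^ 2 = p.eval x → F x y = E.eval x + y * O.eval x := by
  choose r hr using exists_sq_eq_eval p
  have hrn : ∀ x, (-r x) ^ 2 = p.eval x := fun x => by rw [neg_sq, hr]
  -- The even part, and the odd part divided by `y`. Both are unchanged when `r x` is replaced by
  -- `-r x`, so near each point the arbitrary choice `r` may be traded for an analytic branch.
  set e : ℂ → ℂ := fun x => (F x (r x) + F x (-r x)) / 2 with he
  set o : ℂ → ℂ := fun x => (F x (r x) - F x (-r x)) / 2 * (r x)⁻¹ with ho
  have hdiff : ∀ x₀ ∉ S, DifferentiableAt ℂ e x₀ ∧ DifferentiableAt ℂ o x₀ := by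
    intro x₀ hx₀
    have hp0 : p.eval x₀ ≠ 0 := fun h => hx₀ (hS _ h)
    have hr0 : r x₀ ≠ 0 := fun h => hp0 (by rw [← hr, h]; simp)
    have h1 := hF x₀ (r x₀) hx₀ (hr x₀)
    have h2 := hF x₀ (-r x₀) hx₀ (hrn x₀)
    simp only [sqrtBranch_neg] at h2
    have h3 := (analyticAt_sqrtBranch hr0 (hr x₀)).inv (sqrtBranch_ne_zero hr0 hp0)
    constructor
    · refine ((h1.add h2).div_const (c := 2)).differentiableAt.congr_of_eventuallyEq
        (Eventually.of_forall fun x => ?_)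
      rcases eq_or_eq_neg_sqrtBranch hr0 (hr x) with h | h <;>
        simp only [he, h, neg_neg, Pi.add_apply]
      rw [add_comm]
    · refine (((h1.sub h2).div_const (c := 2)).mul h3).differentiableAt.congr_of_eventuallyEq
        (Eventually.of_forall fun x => ?_)
      rcases eq_or_eq_neg_sqrtBranch hr0 (hr x) with h | h <;>
        simp only [ho, h, neg_neg, Pi.sub_apply, Pi.mul_apply, Pi.inv_apply, inv_neg]
      ring
  have hbe : ∀ {x : ℂ} {B : ℝ}, (∀ y, y ^ 2 = p.eval x → ‖F x y‖ ≤ B) → ‖e x‖ ≤ B := by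
    intro x B h
    rw [he]
    have := norm_add_le (F x (r x)) (F x (-r x))
    have h1 := h _ (hr x)
    have h2 := h _ (hrn x)
    rw [norm_div, RCLike.norm_ofNat]
    linarith
  have hbo : ∀ {x : ℂ} {B : ℝ}, (∀ y, y ^ 2 = p.eval x → ‖F x y‖ ≤ B) →
      ‖o x‖ ≤ B * ‖(r x)⁻¹‖ := by
    intro x B h
    rw [ho]
    have := norm_sub_le (F x (r x)) (F x (-r x))
    have h1 := h _ (hr x)
    have h2 := h _ (hrn x)
    rw [norm_mul, norm_div, RCLike.norm_ofNat]
    exact mul_le_mul_of_nonneg_right (by linarith) (norm_nonneg _)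
  obtain ⟨e', he', hee'⟩ := exists_differentiable_extension S e (fun z hz => (hdiff z hz).1)
    (fun s hs => by
      obtain ⟨B, hB⟩ := hb s hs
      have h1 : e =O[𝓝[≠] s] fun _ => (1 : ℂ) :=
        Asymptotics.IsBigO.of_bound B (by
          filter_upwards [hB] with x hx
          simpa using hbe hx)
      refine h1.trans_isLittleO ?_
      refine Asymptotics.isLittleO_const_left.2 (Or.inr ?_)
      refine tendsto_norm_cobounded_atTop.comp (tendsto_inv₀_nhdsNE_zero.comp ?_)
      refine tendsto_nhdsWithin_iff.2 ⟨?_, ?_⟩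
      · have : Tendsto (fun w : ℂ => w - s) (𝓝 s) (𝓝 (s - s)) := (continuous_sub_right s).tendsto s
        rw [sub_self] at this
        exact this.mono_left nhdsWithin_le_nhds
      · filter_upwards [self_mem_nhdsWithin] with w hw
        exact sub_ne_zero.2 hw)
  obtain ⟨o', ho', hoo'⟩ := exists_differentiable_extension S o (fun z hz => (hdiff z hz).2)
    (fun s hs => by
      obtain ⟨B, hB⟩ := hb s hs
      have h1 : o =O[𝓝[≠] s] fun x => (r x)⁻¹ :=
        Asymptotics.IsBigO.of_bound B (by
          filter_upwards [hB] with x hx using hbo hx)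
      exact h1.trans_isLittleO (isLittleO_inv_sqrt hp s r hr))
  have hfin : ∀ᶠ x in Bornology.cobounded ℂ, x ∉ S :=
    Bornology.isBounded_def.1 S.finite_toSet.isBounded
  have hlarge : ∀ᶠ x in Bornology.cobounded ℂ, 1 ≤ ‖p.eval x‖ :=
    (p.tendsto_norm_atTop (natDegree_pos_iff_degree_pos.1 hdeg)
      tendsto_norm_cobounded_atTop).eventually_ge_atTop 1
  obtain ⟨E, hE, hEe⟩ := exists_polynomial_of_growth k e' he' C (by
    filter_upwards [hfin, hg] with x hx hgx
    rw [hee' x hx]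
    exact hbe hgx)
  obtain ⟨O, hO, hOo⟩ := exists_polynomial_of_growth k o' ho' C (by
    filter_upwards [hfin, hg, hlarge] with x hx hgx hl
    rw [hoo' x hx]
    have h0 : 0 ≤ C * ‖x‖ ^ k := (norm_nonneg _).trans (hgx _ (hr x))
    refine (hbo hgx).trans (mul_le_of_le_one_right h0 ?_)
    rw [norm_inv]
    refine inv_le_one_of_one_le₀ ?_
    rw [← hr, norm_pow] at hl
    exact (one_le_sq_iff₀ (norm_nonneg _)).1 hl)
  refine ⟨E, O, hE, fun hO0 => ?_, fun x y hx hy => ?_⟩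
  · have hp0 : p ≠ 0 := by
      rintro rfl
      simp at hdeg
    -- The growth of `y O` is that of a square root: `(y O)² = O² p` is a polynomial in `x`.
    have : (O ^ 2 * p).natDegree ≤ 2 * k := by
      refine natDegree_le_of_growth (C := C ^ 2) ?_
      filter_upwards [hfin, hg, hlarge] with x hx hgx hl
      have hr0 : ‖r x‖ ≠ 0 := by
        rw [← hr, norm_pow] at hl
        intro h
        rw [h] at hl
        norm_num at hl
      have h1 := hbo hgx
      rw [← hoo' x hx, hOo, norm_inv, ← div_eq_mul_inv, le_div_iff₀ (by positivity)] at h1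
      calc ‖(O ^ 2 * p).eval x‖ = (‖O.eval x‖ * ‖r x‖) ^ 2 := by
            rw [eval_mul, eval_pow, ← hr, norm_mul, norm_pow, norm_pow, mul_pow]
        _ ≤ (C * ‖x‖ ^ k) ^ 2 := by gcongr
        _ = _ := by ring
    rwa [natDegree_mul (pow_ne_zero _ hO0) hp0, natDegree_pow] at this
  · rw [← hEe, ← hOo, hee' x hx, hoo' x hx]
    have hr0 : r x ≠ 0 := fun h => hx (hS _ (by rw [← hr, h]; simp))
    rcases sq_eq_sq_iff_eq_or_eq_neg.1 (hy.trans (hr x).symm) with h | h <;>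
    · simp only [he, ho, h]
      field_simp
      ring

/-! ### Polynomials in two points of the curve -/

/-- The value of the polynomial `∑ c i j * x₁ ^ i * x₂ ^ j`, with `i < K` and `j < L`. -/
def bival (K L : ℕ) (c : ℕ → ℕ → ℂ) (x₁ x₂ : ℂ) : ℂ :=
  ∑ i ∈ Finset.range K, ∑ j ∈ Finset.range L, c i j * (x₁ ^ i * x₂ ^ j)

theorem eval_eq_sum_of_degree_lt {q : ℂ[X]} {K : ℕ} (h : q.degree < K) (x : ℂ) :
    q.eval x = ∑ i ∈ Finset.range K, q.coeff i * x ^ i := by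
  rcases eq_or_ne q 0 with rfl | hq
  · simp
  · exact eval_eq_sum_range' ((natDegree_lt_iff_degree_lt hq).2 h) x

theorem exists_bival {ι : Type*} (s : Finset ι) {K L : ℕ} (a b : ι → ℂ[X])
    (ha : ∀ t ∈ s, (a t).degree < K) (hb : ∀ t ∈ s, (b t).degree < L) :
    ∃ c, ∀ x₁ x₂, bival K L c x₁ x₂ = ∑ t ∈ s, (b t).eval x₂ * (a t).eval x₁ := by
  refine ⟨fun i j => ∑ t ∈ s, (b t).coeff j * (a t).coeff i, fun x₁ x₂ => ?_⟩
  have : ∀ t ∈ s, (b t).eval x₂ * (a t).eval x₁ = ∑ i ∈ Finset.range K, ∑ j ∈ Finset.range L,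
      (b t).coeff j * (a t).coeff i * (x₁ ^ i * x₂ ^ j) := by
    intro t ht
    rw [eval_eq_sum_of_degree_lt (ha t ht), eval_eq_sum_of_degree_lt (hb t ht), mul_comm,
      Finset.sum_mul_sum]
    refine Finset.sum_congr rfl fun i _ => Finset.sum_congr rfl fun j _ => by ring
  rw [Finset.sum_congr rfl this, Finset.sum_comm, bival]
  refine Finset.sum_congr rfl fun i _ => ?_
  rw [Finset.sum_comm]
  exact Finset.sum_congr rfl fun j _ => Finset.sum_mul _ _ _

theorem continuous_bival (K L : ℕ) (c : ℕ → ℕ → ℂ) (x₁ : ℂ) :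
    Continuous fun x₂ => bival K L c x₁ x₂ := by
  unfold bival
  fun_prop

theorem bival_swap (K L : ℕ) (c : ℕ → ℕ → ℂ) (x₁ x₂ : ℂ) :
    bival K L c x₁ x₂ = bival L K (fun i j => c j i) x₂ x₁ := by
  rw [bival, Finset.sum_comm, bival]
  refine Finset.sum_congr rfl fun i _ => Finset.sum_congr rfl fun j _ => by ring

theorem bival_avg (K L : ℕ) (c d : ℕ → ℕ → ℂ) (x₁ x₂ : ℂ) :
    bival K L (fun i j => (c i j + d i j) / 2) x₁ x₂ =
      (bival K L c x₁ x₂ + bival K L d x₁ x₂) / 2 := by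
  simp only [bival, ← Finset.sum_add_distrib, Finset.sum_div]
  refine Finset.sum_congr rfl fun i _ => Finset.sum_congr rfl fun j _ => by ring

theorem degree_basis_lt {T : Finset ℂ} {t : ℂ} (ht : t ∈ T) :
    (Lagrange.basis T id t).degree < (T.card : WithBot ℕ) := by
  rw [Lagrange.degree_basis (Set.injOn_id _) ht]
  exact_mod_cast Nat.sub_lt (Finset.card_pos.2 ⟨t, ht⟩) one_pos

theorem eval_eq_sum_basis {T : Finset ℂ} {q : ℂ[X]} (hq : q.degree < T.card) (x : ℂ) :
    q.eval x = ∑ t ∈ T, q.eval t * (Lagrange.basis T id t).eval x := by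
  conv_lhs => rw [Lagrange.eq_interpolate (s := T) (v := id) (Set.injOn_id _) hq]
  simp [Lagrange.interpolate_apply, eval_finsetSum]

theorem exists_nodes {p : ℂ[X]} (hp : p ≠ 0) (K : ℕ) :
    ∃ T : Finset ℂ, T.card = K ∧ ∀ t ∈ T, p.eval t ≠ 0 := by
  have : {t | p.eval t ≠ 0}.Infinite := by
    have h := (p.roots.toFinset.finite_toSet).infinite_compl
    refine h.mono fun t ht => ?_
    simpa [hp] using ht
  obtain ⟨T, hT, hc⟩ := this.exists_subset_card_eq K
  exact ⟨T, hc, fun t ht => hT ht⟩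

/-- A symmetric function on pairs of points of `y ^ 2 = p x` that is a polynomial of bounded degree
in the first point is a polynomial in both points. -/
theorem exists_bival_of_symmetric {p : ℂ[X]} (hp : p ≠ 0) (F : ℂ → ℂ → ℂ → ℂ → ℂ) (K L : ℕ)
    (hsymm : ∀ x₁ y₁ x₂ y₂, F x₁ y₁ x₂ y₂ = F x₂ y₂ x₁ y₁)
    (h : ∀ x₂ y₂, y₂ ≠ 0 → y₂ ^ 2 = p.eval x₂ → ∃ E O : ℂ[X], E.degree < K ∧ O.degree < L ∧
      ∀ x₁ y₁, y₁ ≠ 0 → y₁ ^ 2 = p.eval x₁ → x₁ ≠ x₂ →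
        F x₁ y₁ x₂ y₂ = E.eval x₁ + y₁ * O.eval x₁) :
    ∃ c₀ c₁ c₂ c₁₂ : ℕ → ℕ → ℂ, ∀ x₁ y₁ x₂ y₂, y₁ ≠ 0 → y₂ ≠ 0 → y₁ ^ 2 = p.eval x₁ →
      y₂ ^ 2 = p.eval x₂ → x₁ ≠ x₂ →
      F x₁ y₁ x₂ y₂ = bival K K c₀ x₁ x₂ + y₁ * bival L K c₁ x₁ x₂ + y₂ * bival K L c₂ x₁ x₂
        + y₁ * y₂ * bival L L c₁₂ x₁ x₂ := by
  classical
  choose w hw using exists_sq_eq_eval p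
  have hw' : ∀ x, (-w x) ^ 2 = p.eval x := fun x => by rw [neg_sq, hw]
  have hw0 : ∀ x, p.eval x ≠ 0 → w x ≠ 0 := fun x hx h0 => hx (by rw [← hw, h0]; simp)
  choose! E O hE hO hF using h
  -- `E x₂ y₂` is determined by its values at `K` nodes, `O x₂ y₂` by its values at `L` nodes. By
  -- symmetry these values, computed from the two points `(t, ±w t)` over a node, are polynomials in
  -- `x₂` plus `y₂` times polynomials in `x₂`. Nodes avoid the zeros of `p`, so that `w t ≠ 0`.
  obtain ⟨T, hTK, hT⟩ := exists_nodes hp K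
  obtain ⟨U, hUL, hU⟩ := exists_nodes hp L
  have hdeg : ∀ {a b : ℂ[X]} {N : ℕ} (u v : ℂ), a.degree < N → b.degree < N →
      (C u * a + C v * b).degree < N := fun {a b N} u v ha hb =>
    mem_degreeLT.1 (by
      simp only [← smul_eq_C_mul]
      exact (degreeLT ℂ N).add_mem ((degreeLT ℂ N).smul_mem u (mem_degreeLT.2 ha))
        ((degreeLT ℂ N).smul_mem v (mem_degreeLT.2 hb)))
  have hET : ∀ t, p.eval t ≠ 0 → (E t (w t)).degree < K := fun t ht => hE _ _ (hw0 t ht) (hw t)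
  have hET' : ∀ t, p.eval t ≠ 0 → (E t (-w t)).degree < K := fun t ht =>
    hE _ _ (neg_ne_zero.2 (hw0 t ht)) (hw' t)
  have hOT : ∀ t, p.eval t ≠ 0 → (O t (w t)).degree < L := fun t ht => hO _ _ (hw0 t ht) (hw t)
  have hOT' : ∀ t, p.eval t ≠ 0 → (O t (-w t)).degree < L := fun t ht =>
    hO _ _ (neg_ne_zero.2 (hw0 t ht)) (hw' t)
  obtain ⟨c₀, hc₀⟩ := exists_bival T (K := K) (L := K) (Lagrange.basis T id)
    (fun t => C (1 / 2) * E t (w t) + C (1 / 2) * E t (-w t)) (fun t ht => hTK ▸ degree_basis_lt ht)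
    (fun t ht => hdeg _ _ (hET t (hT t ht)) (hET' t (hT t ht)))
  obtain ⟨c₂, hc₂⟩ := exists_bival T (K := K) (L := L) (Lagrange.basis T id)
    (fun t => C (1 / 2) * O t (w t) + C (1 / 2) * O t (-w t)) (fun t ht => hTK ▸ degree_basis_lt ht)
    (fun t ht => hdeg _ _ (hOT t (hT t ht)) (hOT' t (hT t ht)))
  obtain ⟨c₁, hc₁⟩ := exists_bival U (K := L) (L := K) (Lagrange.basis U id)
    (fun t => C (1 / (2 * w t)) * E t (w t) + C (-1 / (2 * w t)) * E t (-w t))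
    (fun t ht => hUL ▸ degree_basis_lt ht)
    (fun t ht => hdeg _ _ (hET t (hU t ht)) (hET' t (hU t ht)))
  obtain ⟨c₁₂, hc₁₂⟩ := exists_bival U (K := L) (L := L) (Lagrange.basis U id)
    (fun t => C (1 / (2 * w t)) * O t (w t) + C (-1 / (2 * w t)) * O t (-w t))
    (fun t ht => hUL ▸ degree_basis_lt ht)
    (fun t ht => hdeg _ _ (hOT t (hU t ht)) (hOT' t (hU t ht)))
  -- Second points over a node are left out for now, since nothing is known about `F` at `x₁ = x₂`.
  have hgen : ∀ x₁ y₁ x₂ y₂, y₁ ≠ 0 → y₂ ≠ 0 → y₁ ^ 2 = p.eval x₁ →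
      y₂ ^ 2 = p.eval x₂ → x₁ ≠ x₂ → x₂ ∉ T ∪ U →
      F x₁ y₁ x₂ y₂ = bival K K c₀ x₁ x₂ + y₁ * bival L K c₁ x₁ x₂ + y₂ * bival K L c₂ x₁ x₂
        + y₁ * y₂ * bival L L c₁₂ x₁ x₂ := by
    intro x₁ y₁ x₂ y₂ h1 h2 hy1 hy2 hx hxT
    rw [Finset.mem_union, not_or] at hxT
    have hval : ∀ t v, v ≠ 0 → v ^ 2 = p.eval t → t ≠ x₂ →
        (E x₂ y₂).eval t + v * (O x₂ y₂).eval t = (E t v).eval x₂ + y₂ * (O t v).eval x₂ := by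
      intro t v hv hvt ht
      rw [← hF x₂ y₂ h2 hy2 t v hv hvt ht, hsymm, hF t v hv hvt x₂ y₂ h2 hy2 ht.symm]
    have he : ∀ t ∈ T, (E x₂ y₂).eval t =
        (C (1 / 2) * E t (w t) + C (1 / 2) * E t (-w t)).eval x₂
          + y₂ * (C (1 / 2) * O t (w t) + C (1 / 2) * O t (-w t)).eval x₂ := by
      intro t ht
      have htx : t ≠ x₂ := fun h => hxT.1 (h ▸ ht)
      have a1 := hval t (w t) (hw0 t (hT t ht)) (hw t) htx
      have a2 := hval t (-w t) (neg_ne_zero.2 (hw0 t (hT t ht))) (hw' t) htx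
      simp only [eval_add, eval_mul, eval_C]
      linear_combination (1 / 2) * a1 + (1 / 2) * a2
    have ho : ∀ t ∈ U, (O x₂ y₂).eval t =
        (C (1 / (2 * w t)) * E t (w t) + C (-1 / (2 * w t)) * E t (-w t)).eval x₂
          + y₂ * (C (1 / (2 * w t)) * O t (w t) + C (-1 / (2 * w t)) * O t (-w t)).eval x₂ := by
      intro t ht
      have htx : t ≠ x₂ := fun h => hxT.2 (h ▸ ht)
      have hwt := hw0 t (hU t ht)
      have a1 := hval t (w t) hwt (hw t) htx
      have a2 := hval t (-w t) (neg_ne_zero.2 hwt) (hw' t) htx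
      simp only [eval_add, eval_mul, eval_C]
      field_simp
      linear_combination a1 - a2
    rw [hF x₂ y₂ h2 hy2 x₁ y₁ h1 hy1 hx, eval_eq_sum_basis (hTK ▸ hE x₂ y₂ h2 hy2),
      eval_eq_sum_basis (hUL ▸ hO x₂ y₂ h2 hy2), hc₀, hc₁, hc₂, hc₁₂,
      Finset.sum_congr rfl fun t ht => by rw [he t ht, add_mul, mul_assoc],
      Finset.sum_congr (s₁ := U) rfl fun t ht => by rw [ho t ht, add_mul, mul_assoc],
      Finset.sum_add_distrib, Finset.sum_add_distrib, ← Finset.mul_sum, ← Finset.mul_sum]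
    ring
  refine ⟨c₀, c₁, c₂, c₁₂, fun x₁ y₁ x₂ y₂ h1 h2 hy1 hy2 hx => ?_⟩
  have hp2 : p.eval x₂ ≠ 0 := hy2 ▸ pow_ne_zero 2 h2
  have hcont := (analyticAt_sqrtBranch h2 hy2).continuousAt
  -- With the first point fixed, symmetry makes `F` continuous along the branch of `y` through `(x₂,
  -- y₂)`; agreement off a finite set then extends to the nodes.
  have heq : (fun x => (E x₁ y₁).eval x + sqrtBranch p y₂ x * (O x₁ y₁).eval x) =ᶠ[𝓝[≠] x₂]
      fun x => bival K K c₀ x₁ x + y₁ * bival L K c₁ x₁ x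
        + sqrtBranch p y₂ x * bival K L c₂ x₁ x
        + y₁ * sqrtBranch p y₂ x * bival L L c₁₂ x₁ x := by
    have hTU : ∀ᶠ x in 𝓝[≠] x₂, x ∉ T ∪ U := by
      have : ((T ∪ U : Finset ℂ) : Set ℂ) \ {x₂} ⊆ ((T ∪ U : Finset ℂ) : Set ℂ) := Set.sdiff_subset
      have hcl := ((T ∪ U).finite_toSet.subset this).isClosed.isOpen_compl.mem_nhds
        (x := x₂) (by simp)
      filter_upwards [nhdsWithin_le_nhds hcl, self_mem_nhdsWithin] with x hx hx2 hxT
      exact hx ⟨hxT, hx2⟩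
    have hp' : ∀ᶠ x in 𝓝[≠] x₂, p.eval x ≠ 0 :=
      nhdsWithin_le_nhds (p.continuous.continuousAt.eventually_ne hp2)
    have hx' : ∀ᶠ x in 𝓝[≠] x₂, x₁ ≠ x := 
      nhdsWithin_le_nhds (isOpen_ne.mem_nhds hx.symm |> fun h => by
        filter_upwards [h] with x hx using hx.symm)
    filter_upwards [hTU, hp', hx'] with x hxT hpx hxx
    rw [← hgen x₁ y₁ x (sqrtBranch p y₂ x) h1 (sqrtBranch_ne_zero h2 hpx) hy1
      (sqrtBranch_sq p h2 x) hxx hxT, hsymm,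
      hF x₁ y₁ h1 hy1 x _ (sqrtBranch_ne_zero h2 hpx) (sqrtBranch_sq p h2 x) hxx.symm]
  have hl : ContinuousAt (fun x => (E x₁ y₁).eval x + sqrtBranch p y₂ x * (O x₁ y₁).eval x) x₂ :=
    (E x₁ y₁).continuous.continuousAt.add (hcont.mul (O x₁ y₁).continuous.continuousAt)
  have hr : ContinuousAt (fun x => bival K K c₀ x₁ x + y₁ * bival L K c₁ x₁ x
        + sqrtBranch p y₂ x * bival K L c₂ x₁ x
        + y₁ * sqrtBranch p y₂ x * bival L L c₁₂ x₁ x) x₂ := by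
    have k1 := (continuous_bival K K c₀ x₁).continuousAt (x := x₂)
    have k2 := (continuous_bival L K c₁ x₁).continuousAt (x := x₂)
    have k3 := (continuous_bival K L c₂ x₁).continuousAt (x := x₂)
    have k4 := (continuous_bival L L c₁₂ x₁).continuousAt (x := x₂)
    fun_prop
  have := tendsto_nhds_unique ((hl.tendsto.mono_left nhdsWithin_le_nhds).congr' heq)
    (hr.tendsto.mono_left nhdsWithin_le_nhds)
  simp only [sqrtBranch_self h2 hy2] at this
  rw [hsymm, hF x₁ y₁ h1 hy1 x₂ y₂ h2 hy2 hx.symm, this]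

/-- The polynomial whose values are `bival K L c`. -/
noncomputable def bipoly (K L : ℕ) (c : ℕ → ℕ → ℂ) : MvPolynomial (Fin 2) ℂ :=
  ∑ i ∈ Finset.range K, ∑ j ∈ Finset.range L,
    MvPolynomial.monomial (Finsupp.single 0 i + Finsupp.single 1 j) (c i j)

theorem eval₂v_bipoly (K L : ℕ) (c : ℕ → ℕ → ℂ) (x₁ x₂ : ℂ) :
    eval₂v (bipoly K L c) x₁ x₂ = bival K L c x₁ x₂ := by
  simp only [eval₂v, bipoly, bival, map_sum, MvPolynomial.eval_monomial]
  refine Finset.sum_congr rfl fun i _ => Finset.sum_congr rfl fun j _ => ?_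
  rw [Finsupp.prod_add_index' (by simp) (by simp [pow_add])]
  simp

theorem mem_support_bipoly {K L : ℕ} {c : ℕ → ℕ → ℂ} {d : Fin 2 →₀ ℕ}
    (hd : d ∈ (bipoly K L c).support) : d 0 < K ∧ d 1 < L := by
  classical
  obtain ⟨i, hi, hd⟩ := Finset.mem_biUnion.1 (MvPolynomial.support_sum hd)
  obtain ⟨j, hj, hd⟩ := Finset.mem_biUnion.1 (MvPolynomial.support_sum hd)
  have := Finset.mem_singleton.1 (MvPolynomial.support_monomial_subset hd)
  subst this
  simpa using ⟨Finset.mem_range.1 hi, Finset.mem_range.1 hj⟩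

/-- For `K = 0` the polynomial is `0`, so every bound holds, including a negative one. -/
theorem degLE_bipoly_zero {K L : ℕ} {c : ℕ → ℕ → ℂ} {k : ℤ} (h : (K : ℤ) ≤ k + 1 ∨ K = 0) :
    DegLE (bipoly K L c) 0 k := fun d hd => by
  have := (mem_support_bipoly hd).1
  omega

theorem degLE_bipoly_one {K L : ℕ} {c : ℕ → ℕ → ℂ} {k : ℤ} (h : (L : ℤ) ≤ k + 1 ∨ L = 0) :
    DegLE (bipoly K L c) 1 k := fun d hd => by
  have := (mem_support_bipoly hd).2
  omega

/-- The representation need not have symmetric coefficients. As `F` is symmetric, it may be averaged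
with the one obtained by exchanging the points. -/
theorem exists_symmetric_bival_of_symmetric {p : ℂ[X]} (hp : p ≠ 0) (F : ℂ → ℂ → ℂ → ℂ → ℂ)
    (K L : ℕ) (hsymm : ∀ x₁ y₁ x₂ y₂, F x₁ y₁ x₂ y₂ = F x₂ y₂ x₁ y₁)
    (h : ∀ x₂ y₂, y₂ ≠ 0 → y₂ ^ 2 = p.eval x₂ → ∃ E O : ℂ[X], E.degree < K ∧ O.degree < L ∧
      ∀ x₁ y₁, y₁ ≠ 0 → y₁ ^ 2 = p.eval x₁ → x₁ ≠ x₂ →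
        F x₁ y₁ x₂ y₂ = E.eval x₁ + y₁ * O.eval x₁) :
    ∃ c₀ c₁ c₂ c₁₂ : ℕ → ℕ → ℂ, (∀ x₁ y₁ x₂ y₂, y₁ ≠ 0 → y₂ ≠ 0 → y₁ ^ 2 = p.eval x₁ →
      y₂ ^ 2 = p.eval x₂ → x₁ ≠ x₂ →
      F x₁ y₁ x₂ y₂ = bival K K c₀ x₁ x₂ + y₁ * bival L K c₁ x₁ x₂ + y₂ * bival K L c₂ x₁ x₂
        + y₁ * y₂ * bival L L c₁₂ x₁ x₂) ∧
      (∀ x₁ x₂, bival K K c₀ x₁ x₂ = bival K K c₀ x₂ x₁) ∧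
      (∀ x₁ x₂, bival L L c₁₂ x₁ x₂ = bival L L c₁₂ x₂ x₁) ∧
      ∀ x₁ x₂, bival L K c₁ x₁ x₂ = bival K L c₂ x₂ x₁ := by
  obtain ⟨c₀, c₁, c₂, c₁₂, hc⟩ := exists_bival_of_symmetric hp F K L hsymm h
  refine ⟨fun i j => (c₀ i j + c₀ j i) / 2, fun i j => (c₁ i j + c₂ j i) / 2,
    fun i j => (c₂ i j + c₁ j i) / 2, fun i j => (c₁₂ i j + c₁₂ j i) / 2,
    fun x₁ y₁ x₂ y₂ h1 h2 hy1 hy2 hx => ?_, fun x₁ x₂ => ?_, fun x₁ x₂ => ?_, fun x₁ x₂ => ?_⟩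
  · have a1 := hc x₁ y₁ x₂ y₂ h1 h2 hy1 hy2 hx
    have a2 := hc x₂ y₂ x₁ y₁ h2 h1 hy2 hy1 hx.symm
    rw [hsymm, bival_swap, bival_swap _ _ c₁, bival_swap _ _ c₂, bival_swap _ _ c₁₂] at a2
    rw [bival_avg _ _ c₀, bival_avg _ _ c₁, bival_avg _ _ c₂, bival_avg _ _ c₁₂]
    linear_combination (1 / 2) * a1 + (1 / 2) * a2
  · rw [bival_swap]
    simp only [add_comm]
  · rw [bival_swap]
    simp only [add_comm]
  · rw [bival_swap]
    simp only [add_comm]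

/-! ### Local coordinates -/

/-- If `l` inverts `q` near the simple zero, then `ξ t = l (t²)` parametrizes `y² = q x` by `t = y`.
The last clause covers both signs of `y`. It serves branch points, and infinity in odd degree. -/
theorem exists_local_uniformizer (q : ℂ[X]) {r : ℂ} (hr : q.eval r = 0)
    (hd : (derivative q).eval r ≠ 0) :
    ∃ ξ : ℂ → ℂ, AnalyticAt ℂ ξ 0 ∧ ξ 0 = r ∧ (∀ᶠ t in 𝓝 0, q.eval (ξ t) = t ^ 2) ∧
      ∀ᶠ x in 𝓝 r, ∀ y, y ^ 2 = q.eval x → ξ y = x := by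
  have hf := analyticAt_eval q r
  have hf' : deriv (fun t => q.eval t) r ≠ 0 := by rwa [Polynomial.deriv]
  set l := hf.hasStrictDerivAt.localInverse _ _ _ hf' with hl
  have hla : AnalyticAt ℂ l (q.eval r) := hf.analyticAt_localInverse hf'
  rw [hr] at hla
  have hleft : ∀ᶠ x in 𝓝 r, l (q.eval x) = x :=
    hf.hasStrictDerivAt.eventually_left_inverse hf'
  have hright : ∀ᶠ x in 𝓝 (q.eval r), q.eval (l x) = x :=
    hf.hasStrictDerivAt.eventually_right_inverse hf'
  rw [hr] at hright
  have hsq : Tendsto (fun t : ℂ => t ^ 2) (𝓝 0) (𝓝 0) := by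
    have := (continuous_pow 2 : Continuous fun t : ℂ => t ^ 2).tendsto 0
    simpa using this
  refine ⟨fun t => l (t ^ 2), ?_, ?_, hsq.eventually hright, ?_⟩
  · exact AnalyticAt.fun_comp (g := l) (by simpa using hla) (analyticAt_id.pow 2)
  · have := hleft.self_of_nhds
    rw [hr] at this
    simpa using this
  · filter_upwards [hleft] with x hx y hy
    simp only [hy, hx]

theorem eventually_sqrt_mem (q : ℂ[X]) {r : ℂ} (hr : q.eval r = 0) {U : Set ℂ} (hU : U ∈ 𝓝 0) :
    ∀ᶠ x in 𝓝 r, ∀ y, y ^ 2 = q.eval x → y ∈ U := by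
  obtain ⟨ε, hε, hεU⟩ := Metric.mem_nhds_iff.1 hU
  have h : Tendsto (fun x => ‖q.eval x‖) (𝓝 r) (𝓝 0) := by
    have := q.continuous.norm.tendsto r
    rwa [hr, norm_zero] at this
  filter_upwards [h.eventually_lt_const (pow_pos hε 2)] with x hx y hy
  rw [← hy, norm_pow] at hx
  exact hεU (by simpa using lt_of_pow_lt_pow_left₀ 2 hε.le hx)

theorem exists_branchPatch {p : ℂ[X]} (g : ℕ) (hp : Squarefree p) {r : ℂ} (hr : p.eval r = 0) :
    ∃ ψ : CoordPatch p g, 0 ∈ ψ.dom ∧ ψ.pt 0 = .fin r 0 ∧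
      ∀ᶠ x in 𝓝 r, ∀ y, y ^ 2 = p.eval x → y ∈ ψ.dom ∧ ψ.pt y = .fin x y := by
  obtain ⟨ξ, hξ, hξ0, hsq, hinv⟩ := exists_local_uniformizer p hr (eval_derivative_ne_zero hp hr)
  obtain ⟨U, hU, hUo, hU0⟩ := mem_nhds_iff.1 (hξ.eventually_analyticAt.and hsq)
  refine ⟨⟨U, hUo, fun t => .fin (ξ t) t, fun t ht => (hU ht).2.symm,
    fun a _ b _ hab => (Pt.fin.inj hab).2, fun t ht => Or.inl ⟨ξ, fun t => t, (hU ht).1,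
      analyticAt_id, Or.inr (by simp), Eventually.of_forall fun _ => rfl⟩⟩, hU0, ?_, ?_⟩
  · simp [hξ0]
  · filter_upwards [hinv, eventually_sqrt_mem p hr (hUo.mem_nhds hU0)] with x hx hxU y hy
    exact ⟨hxU y hy, by simp [hx y hy]⟩

theorem eval_reflect_inv {p : ℂ[X]} {N : ℕ} (hN : p.natDegree ≤ N) {x : ℂ} (hx : x ≠ 0) :
    (reflect N p).eval x⁻¹ * x ^ N = p.eval x := by
  have := invertibleOfNonzero hx
  have h := eval₂_reflect_mul_pow (RingHom.id ℂ) x N p hN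
  rwa [invOf_eq_inv] at h

theorem nearInf_mem_surface {p : ℂ[X]} {g : ℕ} (hN : p.natDegree ≤ 2 * g + 2) {u v : ℂ}
    (h : v ^ 2 = (reflect (2 * g + 2) p).eval u) : nearInf g u v ∈ surface p g := by
  by_cases hu : u = 0
  · subst hu
    rw [nearInf, if_pos rfl]
    change v ^ 2 = p.coeff (2 * g + 2)
    rw [h, ← coeff_zero_eq_eval_zero, coeff_reflect, revAt_le (by omega)]
    simp
  · rw [nearInf, if_neg hu]
    change (v / u ^ (g + 1)) ^ 2 = p.eval u⁻¹
    rw [← eval_reflect_inv hN (inv_ne_zero hu), inv_inv, ← h, div_pow, ← pow_mul, inv_pow,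
      div_eq_mul_inv, add_mul, one_mul, mul_comm g]

theorem nearInf_injective {g : ℕ} {u v u' v' : ℂ} (h : nearInf g u v = nearInf g u' v') :
    u = u' ∧ v = v' := by
  by_cases hu : u = 0 <;> by_cases hu' : u' = 0
  · rw [nearInf, nearInf, if_pos hu, if_pos hu'] at h
    exact ⟨hu.trans hu'.symm, Pt.inf.inj h⟩
  · rw [nearInf, nearInf, if_pos hu, if_neg hu'] at h
    cases h
  · rw [nearInf, nearInf, if_neg hu, if_pos hu'] at h
    cases h
  · rw [nearInf, nearInf, if_neg hu, if_neg hu'] at h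
    obtain ⟨h1, h2⟩ := Pt.fin.inj h
    have := inv_injective h1
    subst this
    refine ⟨rfl, ?_⟩
    field_simp at h2
    exact h2

theorem nearInf_inv {g : ℕ} {x y : ℂ} (hx : x ≠ 0) : nearInf g x⁻¹ (y / x ^ (g + 1)) = .fin x y := by
  rw [nearInf, if_neg (inv_ne_zero hx), inv_inv, inv_pow, div_inv_eq_mul,
    div_mul_cancel₀ _ (pow_ne_zero _ hx)]

theorem sq_div_pow {p : ℂ[X]} {g : ℕ} (hN : p.natDegree ≤ 2 * g + 2) {x y : ℂ} (hx : x ≠ 0)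
    (h : y ^ 2 = p.eval x) : (y / x ^ (g + 1)) ^ 2 = (reflect (2 * g + 2) p).eval x⁻¹ := by
  rw [div_pow, h, ← eval_reflect_inv hN hx, ← pow_mul, add_mul, one_mul, mul_comm g,
    mul_div_cancel_right₀ _ (pow_ne_zero _ hx)]

theorem tendsto_inv_cobounded : Tendsto (fun x : ℂ => x⁻¹) (Bornology.cobounded ℂ) (𝓝 0) :=
  tendsto_inv₀_cobounded

theorem eventually_ne_zero_cobounded : ∀ᶠ x : ℂ in Bornology.cobounded ℂ, x ≠ 0 := by
  filter_upwards [eventually_cobounded_le_norm (E := ℂ) 1] with x hx h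
  rw [h, norm_zero] at hx
  norm_num at hx

/-- In odd degree `q u = u^(2g+2) p(1/u)` has a simple zero at `0`, its derivative there being the
leading coefficient of `p`. So `v` is a coordinate at infinity just as `y` is at a branch point. -/
theorem exists_infPatch_odd {p : ℂ[X]} {g : ℕ} (hdeg : p.natDegree = 2 * g + 1) :
    ∃ ψ : CoordPatch p g, 0 ∈ ψ.dom ∧ ψ.pt 0 = .inf 0 ∧
      ∀ᶠ x in Bornology.cobounded ℂ, ∀ y, y ^ 2 = p.eval x →
        y / x ^ (g + 1) ∈ ψ.dom ∧ ψ.pt (y / x ^ (g + 1)) = .fin x y := by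
  have hN : p.natDegree ≤ 2 * g + 2 := by omega
  set q := reflect (2 * g + 2) p with hq
  have hq0 : q.eval 0 = 0 := by
    rw [← coeff_zero_eq_eval_zero, hq, coeff_reflect, revAt_le (by omega)]
    exact coeff_eq_zero_of_natDegree_lt (by omega)
  have hq1 : (derivative q).eval 0 ≠ 0 := by
    rw [← coeff_zero_eq_eval_zero, coeff_derivative, hq, coeff_reflect, revAt_le (by omega)]
    have : p.coeff (2 * g + 2 - (0 + 1)) ≠ 0 := by
      rw [show 2 * g + 2 - (0 + 1) = p.natDegree by omega, coeff_natDegree, Ne,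
        leadingCoeff_eq_zero]
      rintro rfl
      simp at hdeg
    simpa using this
  obtain ⟨ξ, hξ, hξ0, hsq, hinv⟩ := exists_local_uniformizer q hq0 hq1
  obtain ⟨U, hU, hUo, hU0⟩ := mem_nhds_iff.1 (hξ.eventually_analyticAt.and hsq)
  refine ⟨⟨U, hUo, fun t => nearInf g (ξ t) t, fun t ht => nearInf_mem_surface hN (hU ht).2.symm,
    fun a _ b _ hab => (nearInf_injective hab).2, fun t ht => Or.inr ⟨ξ, fun t => t, (hU ht).1,
      analyticAt_id, Or.inr (by simp), Eventually.of_forall fun _ => rfl⟩⟩, hU0, ?_, ?_⟩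
  · simp [hξ0, nearInf]
  · filter_upwards [eventually_ne_zero_cobounded, tendsto_inv_cobounded.eventually hinv,
      tendsto_inv_cobounded.eventually (eventually_sqrt_mem q hq0 (hUo.mem_nhds hU0))]
      with x hx0 hx hxU y hy
    have h := sq_div_pow hN hx0 hy
    refine ⟨hxU _ h, ?_⟩
    rw [hx _ h, nearInf_inv hx0]

/-- The coordinate `1 / x` near the point `v = v₀` over `∞`, for even degree. -/
noncomputable def infPatch {p : ℂ[X]} {g : ℕ} (hN : p.natDegree ≤ 2 * g + 2) (v₀ : ℂ)
    (hv₀ : v₀ ≠ 0) : CoordPatch p g where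
  dom := {u | (reflect (2 * g + 2) p).eval u / v₀ ^ 2 ∈ Complex.slitPlane}
  isOpen_dom := Complex.isOpen_slitPlane.preimage ((reflect (2 * g + 2) p).continuous.div_const _)
  pt := fun u => nearInf g u (sqrtBranch (reflect (2 * g + 2) p) v₀ u)
  pt_mem := fun u _ => nearInf_mem_surface hN (sqrtBranch_sq _ hv₀ u)
  injOn_pt := fun _ _ _ _ hab => (nearInf_injective hab).1
  regular := fun _ hx => Or.inr ⟨fun t => t, _, analyticAt_id,
    analyticAt_const.mul (AnalyticAt.cpow (analyticAt_eval _ _).div_const analyticAt_const hx),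
    Or.inl (by simp), Eventually.of_forall fun _ => rfl⟩

theorem zero_mem_infPatch {p : ℂ[X]} {g : ℕ} (hN : p.natDegree ≤ 2 * g + 2) {v₀ : ℂ}
    (hv₀ : v₀ ≠ 0) (hv : v₀ ^ 2 = (reflect (2 * g + 2) p).eval 0) :
    0 ∈ (infPatch hN v₀ hv₀).dom ∧ (infPatch hN v₀ hv₀).pt 0 = .inf v₀ := by
  constructor
  · change (reflect (2 * g + 2) p).eval 0 / v₀ ^ 2 ∈ Complex.slitPlane
    rw [← hv, div_self (pow_ne_zero 2 hv₀)]
    exact Complex.one_mem_slitPlane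
  · change nearInf g 0 (sqrtBranch (reflect (2 * g + 2) p) v₀ 0) = _
    rw [sqrtBranch_self hv₀ hv, nearInf, if_pos rfl]

/-! ### Positions of the Virasoro field -/

theorem admissible_cons {p : ℂ[X]} {g : ℕ} {a : CoordPatch p g × ℂ}
    {s : Multiset (CoordPatch p g × ℂ)} :
    Admissible (a ::ₘ s) ↔ a.2 ∈ a.1.dom ∧ (a.1.pt a.2 ∉ s.map fun i => i.1.pt i.2) ∧
      Admissible s := by
  simp only [Admissible, Multiset.mem_cons, forall_eq_or_imp, Multiset.map_cons,
    Multiset.nodup_cons]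
  tauto

theorem admissible_zero {p : ℂ[X]} {g : ℕ} : Admissible (0 : Multiset (CoordPatch p g × ℂ)) := by
  simp [Admissible]

/-- A patch is injective on its domain, so it meets the finitely many other positions at finitely
many parameters only. -/
theorem eventually_admissible {p : ℂ[X]} {g : ℕ} {φ : CoordPatch p g} {t₀ : ℂ}
    {s : Multiset (CoordPatch p g × ℂ)} (h : Admissible ((φ, t₀) ::ₘ s)) :
    ∀ᶠ t in 𝓝 t₀, Admissible ((φ, t) ::ₘ s) := by
  classical
  rw [admissible_cons] at h
  have hfin : (φ.dom ∩ φ.pt ⁻¹' ((s.map fun i => i.1.pt i.2).toFinset : Set Pt)).Finite := by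
    rw [Set.inter_comm]
    refine Set.Finite.of_finite_image (f := φ.pt) ?_ (φ.injOn_pt.mono Set.inter_subset_right)
    exact (Finset.finite_toSet _).subset (by rintro _ ⟨t, ht, rfl⟩; exact ht.1)
  have ho := hfin.isClosed.isOpen_compl.mem_nhds (x := t₀) (by
    rintro ⟨_, h'⟩
    exact h.2.1 (by simpa using h'))
  filter_upwards [φ.isOpen_dom.mem_nhds h.1, ho] with t ht ht'
  rw [admissible_cons]
  refine ⟨ht, fun hm => ht' ⟨ht, ?_⟩, h.2.2⟩
  simpa using hm

theorem xPatch_pt (p : ℂ[X]) (g : ℕ) (y₀ x : ℂ) :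
    (xPatch p g y₀).pt x = .fin x (sqrtBranch p y₀ x) := rfl

theorem schwarzian_id (t : ℂ) : schwarzian (fun z => z) t = 0 := by
  have h1 : deriv (fun z : ℂ => z) = fun _ => 1 := by
    ext z
    simp
  simp [schwarzian, iteratedDeriv_succ, iteratedDeriv_zero, h1]

theorem eventuallyEq_of_sq_eq {f h : ℂ → ℂ} {x : ℂ} (hf : ContinuousAt f x)
    (hh : ContinuousAt h x) (hsq : ∀ᶠ t in 𝓝 x, f t ^ 2 = h t ^ 2) (hx : f x = h x)
    (h0 : f x ≠ 0) : f =ᶠ[𝓝 x] h := by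
  have hne : ∀ᶠ t in 𝓝 x, f t + h t ≠ 0 := by
    refine (hf.add hh).eventually_ne ?_
    rw [Pi.add_apply, ← hx, ← two_mul]
    exact mul_ne_zero two_ne_zero h0
  filter_upwards [hsq, hne] with t h1 h2
  rcases sq_eq_sq_iff_eq_or_eq_neg.1 h1 with h | h
  · exact h
  · exact absurd (by rw [h, neg_add_cancel]) h2

theorem xPatch_mem {p : ℂ[X]} (g : ℕ) {x y : ℂ} (h0 : y ≠ 0) (h : y ^ 2 = p.eval x) :
    x ∈ (xPatch p g y).dom := (xPatch_spec p g h0 h).1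

theorem admissible_xPatch {p : ℂ[X]} {g : ℕ} {ψ : CoordPatch p g} {x y t : ℂ}
    {s : Multiset (CoordPatch p g × ℂ)} (h0 : y ≠ 0) (h : y ^ 2 = p.eval x)
    (hpt : ψ.pt t = .fin x y) (hs : Admissible ((ψ, t) ::ₘ s)) :
    Admissible ((xPatch p g y, x) ::ₘ s) := by
  rw [admissible_cons] at hs ⊢
  refine ⟨xPatch_mem g h0 h, ?_, hs.2.2⟩
  rw [(xPatch_spec p g h0 h).2]
  exact hpt ▸ hs.2.1

/-! ### Moving a position along a branch, and the connected two-point function -/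

namespace VirasoroState

variable {p : ℂ[X]} {g : ℕ} {c : ℂ} (S : VirasoroState p g c)

/-- The patches of `y₀` and of `sqrtBranch p y₀ x` carry the same coordinate and the same branch
near `x`, so the transition map is the identity. Hence `T₁` and `T₂`, whose patch varies with the
point, are holomorphic along a branch. -/
theorem corr_xPatch_sqrtBranch {x y₀ : ℂ} {s : Multiset (CoordPatch p g × ℂ)}
    (hs : Admissible ((xPatch p g y₀, x) ::ₘ s)) (h0 : y₀ ≠ 0) (hx : p.eval x ≠ 0) :
    S.corr ((xPatch p g (sqrtBranch p y₀ x), x) ::ₘ s) = S.corr ((xPatch p g y₀, x) ::ₘ s) := by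
  set y := sqrtBranch p y₀ x with hy
  have hy0 : y ≠ 0 := sqrtBranch_ne_zero h0 hx
  have hyx : y ^ 2 = p.eval x := sqrtBranch_sq p h0 x
  have hdom := (admissible_cons.1 hs).1
  have hcont : ContinuousAt (sqrtBranch p y₀) x :=
    (analyticAt_const.mul (AnalyticAt.cpow (analyticAt_eval _ _).div_const
      analyticAt_const hdom)).continuousAt
  have heq := eventuallyEq_of_sq_eq (analyticAt_sqrtBranch hy0 hyx).continuousAt hcont
    (Eventually.of_forall fun t => by rw [sqrtBranch_sq p hy0, sqrtBranch_sq p h0])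
    (sqrtBranch_self hy0 hyx) (by rwa [sqrtBranch_self hy0 hyx])
  have := S.transform (xPatch p g y) (xPatch p g y₀) (fun z => z) x s
    (admissible_xPatch hy0 hyx (xPatch_pt p g y₀ x) hs) analyticAt_id (by
      filter_upwards [heq, (xPatch p g y₀).isOpen_dom.mem_nhds hdom] with t ht htd
      exact ⟨htd, by rw [xPatch_pt, xPatch_pt, ht]⟩)
  rw [this, schwarzian_id]
  simp

theorem analyticAt_corr_xPatch {x₀ y₀ : ℂ} {s : Multiset (CoordPatch p g × ℂ)} (h0 : y₀ ≠ 0)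
    (h : y₀ ^ 2 = p.eval x₀) (hs : Admissible ((xPatch p g y₀, x₀) ::ₘ s)) :
    AnalyticAt ℂ (fun x => S.corr ((xPatch p g (sqrtBranch p y₀ x), x) ::ₘ s)) x₀ := by
  refine (S.holomorphic _ _ s hs).congr ?_
  have hp0 : p.eval x₀ ≠ 0 := h ▸ pow_ne_zero 2 h0
  filter_upwards [eventually_admissible hs, p.continuous.continuousAt.eventually_ne hp0]
    with x hx hpx
  exact (S.corr_xPatch_sqrtBranch hx h0 hpx).symm

theorem exists_bound_corr {ψ : CoordPatch p g} {t₀ : ℂ} {s : Multiset (CoordPatch p g × ℂ)}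
    (hs : Admissible ((ψ, t₀) ::ₘ s)) :
    ∃ B : ℝ, ∀ᶠ t in 𝓝 t₀, ‖S.corr ((ψ, t) ::ₘ s)‖ ≤ B := by
  have := (S.holomorphic _ _ s hs).continuousAt.norm
  refine ⟨_, (this.eventually_lt_const (lt_add_one _)).mono fun t ht => ht.le⟩

/-- The connected two-point function, with each position in a coordinate patch, times `⟨1⟩`. -/
noncomputable def conn (a b : CoordPatch p g × ℂ) : ℂ :=
  S.corr {a, b} - S.one⁻¹ * S.corr {a} * S.corr {b}

/-- The Schwarzian adds `(c/12) S(h) ⟨T(b)⟩` to the two-point function and the same amount to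
`⟨1⟩⁻¹⟨T⟩⟨T(b)⟩`. What remains is the law of a quadratic differential. -/
theorem transform_conn (hS : S.one ≠ 0) (φ ψ : CoordPatch p g) (h : ℂ → ℂ) (t₀ : ℂ)
    (b : CoordPatch p g × ℂ) (hb : Admissible {(φ, t₀), b}) (hh : AnalyticAt ℂ h t₀)
    (he : ∀ᶠ t in 𝓝 t₀, h t ∈ ψ.dom ∧ φ.pt t = ψ.pt (h t)) :
    S.conn (φ, t₀) b = S.conn (ψ, h t₀) b * deriv h t₀ ^ 2 := by
  have h1 := S.transform φ ψ h t₀ {b} hb hh he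
  have h2 := S.transform φ ψ h t₀ 0 (admissible_cons.2 ⟨(admissible_cons.1 hb).1, by simp,
    admissible_zero⟩) hh he
  have e : ∀ a : CoordPatch p g × ℂ, S.corr (a ::ₘ {b}) = S.corr {a, b} := fun _ => rfl
  have e0 : ∀ a : CoordPatch p g × ℂ, S.corr (a ::ₘ 0) = S.corr {a} := fun _ => rfl
  rw [e, e] at h1
  rw [e0, e0] at h2
  have e1 : S.corr 0 = S.one := rfl
  rw [e1] at h2
  rw [conn, conn, h1, h2]
  field_simp
  ring

theorem exists_bound_conn {ψ : CoordPatch p g} {t₀ : ℂ} {b : CoordPatch p g × ℂ}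
    (hb : Admissible {(ψ, t₀), b}) : ∃ B : ℝ, ∀ᶠ t in 𝓝 t₀, ‖S.conn (ψ, t) b‖ ≤ B := by
  obtain ⟨B₁, hB₁⟩ := S.exists_bound_corr hb
  obtain ⟨B₂, hB₂⟩ := S.exists_bound_corr (s := 0) (ψ := ψ) (t₀ := t₀) (admissible_cons.2
    ⟨(admissible_cons.1 hb).1, by simp, admissible_zero⟩)
  refine ⟨B₁ + ‖S.one⁻¹‖ * B₂ * ‖S.corr {b}‖, ?_⟩
  filter_upwards [hB₁, hB₂] with t h1 h2
  refine (norm_sub_le _ _).trans (add_le_add h1 ?_)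
  rw [norm_mul, norm_mul]
  gcongr
  exact h2

end VirasoroState

/-! ### Schwarzian derivatives of square roots -/

theorem iteratedDeriv_two_eq (f : ℂ → ℂ) : iteratedDeriv 2 f = deriv (deriv f) := by
  rw [iteratedDeriv_succ, iteratedDeriv_one]

theorem iteratedDeriv_three_eq (f : ℂ → ℂ) : iteratedDeriv 3 f = deriv (deriv (deriv f)) := by
  rw [iteratedDeriv_succ, iteratedDeriv_two_eq]

theorem deriv_sqrt {h Q : ℂ → ℂ} {x : ℂ} (hh : AnalyticAt ℂ h x)
    (hQ : (fun t => h t ^ 2) =ᶠ[𝓝 x] Q) : deriv Q x = 2 * h x * deriv h x := by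
  rw [← hQ.deriv_eq, deriv_fun_pow hh.differentiableAt]
  simp

/-- This is the chain rule `S(Q) = S(h) + S(z²)(h) h'²`, with `S(z²) = -3/(2z²)` and `h'/h =
Q'/(2Q)`, checked by differentiating `Q = h²` three times. -/
theorem schwarzian_sqrt {h Q : ℂ → ℂ} {x : ℂ} (hh : AnalyticAt ℂ h x)
    (hQ : (fun t => h t ^ 2) =ᶠ[𝓝 x] Q) (h0 : h x ≠ 0) (hd : deriv Q x ≠ 0) :
    schwarzian h x = 3 / 8 * (deriv Q x / Q x) ^ 2 + schwarzian Q x := by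
  have e1 : deriv Q =ᶠ[𝓝 x] fun t => 2 * h t * deriv h t := by
    filter_upwards [hh.eventually_analyticAt, eventually_eventually_nhds.2 hQ] with t ht htQ
    exact deriv_sqrt ht htQ
  have e2 : deriv (deriv Q) =ᶠ[𝓝 x]
      fun t => 2 * deriv h t * deriv h t + 2 * h t * deriv (deriv h) t := by
    filter_upwards [hh.eventually_analyticAt, eventually_eventually_nhds.2 e1] with t ht htQ
    rw [EventuallyEq.deriv_eq htQ]
    have a1 := ht.differentiableAt.hasDerivAt
    have a2 := ht.deriv.differentiableAt.hasDerivAt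
    exact ((a1.const_mul 2).mul a2).deriv
  have e3 : deriv (deriv (deriv Q)) x =
      6 * deriv h x * deriv (deriv h) x + 2 * h x * deriv (deriv (deriv h)) x := by
    rw [e2.deriv_eq]
    have a1 := hh.differentiableAt.hasDerivAt
    have a2 := hh.deriv.differentiableAt.hasDerivAt
    have a3 := hh.deriv.deriv.differentiableAt.hasDerivAt
    have := (((a2.const_mul 2).mul a2).add ((a1.const_mul 2).mul a3)).deriv
    refine this.trans ?_
    ring
  have hQx : Q x = h x ^ 2 := hQ.self_of_nhds.symm
  rw [e1.self_of_nhds] at hd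
  have hd0 : deriv h x ≠ 0 := right_ne_zero_of_mul hd
  rw [schwarzian, schwarzian, iteratedDeriv_two_eq, iteratedDeriv_three_eq, iteratedDeriv_two_eq,
    iteratedDeriv_three_eq, e3, e2.self_of_nhds, e1.self_of_nhds, hQx]
  field_simp
  ring

/-- The Schwarzian derivative of a polynomial. -/
noncomputable def polySchwarzian (q : ℂ[X]) (x : ℂ) : ℂ :=
  (derivative (derivative (derivative q))).eval x / (derivative q).eval x
    - 3 / 2 * ((derivative (derivative q)).eval x / (derivative q).eval x) ^ 2

theorem deriv_eval (q : ℂ[X]) : deriv (fun t => q.eval t) = fun t => (derivative q).eval t := by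
  ext t
  exact q.deriv

theorem schwarzian_eval (q : ℂ[X]) (x : ℂ) :
    schwarzian (fun t => q.eval t) x = polySchwarzian q x := by
  rw [schwarzian, iteratedDeriv_two_eq, iteratedDeriv_three_eq, deriv_eval, deriv_eval, deriv_eval,
    polySchwarzian]

theorem continuousAt_polySchwarzian {q : ℂ[X]} {x : ℂ} (h : (derivative q).eval x ≠ 0) :
    ContinuousAt (polySchwarzian q) x := by
  unfold polySchwarzian
  have h1 := (derivative q).continuous.continuousAt (x := x)
  have h2 := (derivative (derivative q)).continuous.continuousAt (x := x)
  have h3 := (derivative (derivative (derivative q))).continuous.continuousAt (x := x)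
  exact (h3.div h1 h).sub (continuousAt_const.mul ((h2.div h1 h).pow 2))

theorem hasDerivAt_eval_inv (q : ℂ[X]) {x : ℂ} (hx : x ≠ 0) :
    HasDerivAt (fun t => q.eval t⁻¹) (-(x⁻¹ ^ 2) * (derivative q).eval x⁻¹) x := by
  have := (q.hasDerivAt x⁻¹).comp x (hasDerivAt_inv hx)
  refine this.congr_deriv ?_
  rw [inv_pow]
  ring

theorem deriv_eval_inv (q : ℂ[X]) {x : ℂ} (hx : x ≠ 0) :
    deriv (fun t => q.eval t⁻¹) x = -(x⁻¹ ^ 2) * (derivative q).eval x⁻¹ :=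
  (hasDerivAt_eval_inv q hx).deriv

/-- Inversion is a Möbius map with vanishing Schwarzian, so only the square of its derivative `-x⁻²`
appears. -/
theorem schwarzian_eval_inv (q : ℂ[X]) {x : ℂ} (hx : x ≠ 0)
    (h : (derivative q).eval x⁻¹ ≠ 0) :
    schwarzian (fun t => q.eval t⁻¹) x = x⁻¹ ^ 4 * polySchwarzian q x⁻¹ := by
  set q₁ := derivative q
  -- Differentiating `q(1/t)` replaces `q` by `-X² q'`, so all three derivatives are again
  -- polynomials in `1/t`.
  have step : ∀ q : ℂ[X], ∀ᶠ t in 𝓝 x, deriv (fun t => q.eval t⁻¹) t =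
      (-(X ^ 2) * derivative q).eval t⁻¹ := by
    intro q
    filter_upwards [isOpen_ne.mem_nhds hx] with t ht
    rw [deriv_eval_inv q ht]
    simp
  have e1 : deriv (fun t => q.eval t⁻¹) =ᶠ[𝓝 x] fun t => (-(X ^ 2) * derivative q).eval t⁻¹ :=
    step q
  have e2 : deriv (deriv (fun t => q.eval t⁻¹)) =ᶠ[𝓝 x]
      fun t => (-(X ^ 2) * derivative (-(X ^ 2) * derivative q)).eval t⁻¹ :=
    e1.deriv.trans (step _)
  have e3 := (e2.deriv.trans (step _)).self_of_nhds
  rw [schwarzian, iteratedDeriv_two_eq, iteratedDeriv_three_eq, e3, e2.self_of_nhds,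
    e1.self_of_nhds, polySchwarzian]
  simp only [derivative_mul, derivative_neg, derivative_add, derivative_X_pow, eval_mul, eval_neg,
    eval_add, eval_pow, eval_X, map_natCast, eval_natCast]
  have hx' : x⁻¹ ≠ 0 := inv_ne_zero hx
  generalize x⁻¹ = u at *
  simp only [← show q₁ = derivative q from rfl]
  push_cast
  simp
  field_simp
  ring

/-! ### Growth of rational expressions -/

theorem exists_bound_of_continuousAt {f : ℂ → ℂ} {x : ℂ} (hf : ContinuousAt f x) :
    ∃ B : ℝ, ∀ᶠ t in 𝓝 x, ‖f t‖ ≤ B :=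
  ⟨_, (hf.norm.eventually_lt_const (lt_add_one _)).mono fun _ ht => ht.le⟩

theorem exists_bound_eval_cobounded (q : ℂ[X]) {k : ℕ} (hk : q.natDegree ≤ k) :
    ∃ B : ℝ, ∀ᶠ x in Bornology.cobounded ℂ, ‖q.eval x‖ ≤ B * ‖x‖ ^ k := by
  obtain ⟨B, hB⟩ := exists_bound_of_continuousAt (reflect k q).continuous.continuousAt (x := 0)
  refine ⟨B, ?_⟩
  filter_upwards [eventually_ne_zero_cobounded, tendsto_inv_cobounded.eventually hB] with x hx h
  rw [← eval_reflect_inv hk hx, norm_mul, norm_pow]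
  gcongr

theorem eventually_eval_ne_zero {p : ℂ[X]} (hp : p ≠ 0) (r : ℂ) :
    ∀ᶠ x in 𝓝[≠] r, p.eval x ≠ 0 := by
  have h : {x | p.eval x = 0}.Finite :=
    p.roots.toFinset.finite_toSet.subset fun x hx => by simpa [hp] using hx
  exact nhdsNE_le_cofinite r h.compl_mem_cofinite

theorem eventually_cobounded_eventually_nhds {P : ℂ → Prop}
    (h : ∀ᶠ x in Bornology.cobounded ℂ, P x) :
    ∀ᶠ x in Bornology.cobounded ℂ, ∀ᶠ t in 𝓝 x, P t := by
  obtain ⟨R, -, hR⟩ := (Metric.hasBasis_cobounded_compl_closedBall (0 : ℂ)).eventually_iff.1 h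
  refine (Metric.hasBasis_cobounded_compl_closedBall (0 : ℂ)).eventually_iff.2 ⟨R, trivial, ?_⟩
  intro x hx
  filter_upwards [Metric.isClosed_closedBall.isOpen_compl.mem_nhds hx] with t ht using hR ht

theorem eventually_eval_ne_zero_cobounded {p : ℂ[X]} (hp : p ≠ 0) :
    ∀ᶠ x in Bornology.cobounded ℂ, p.eval x ≠ 0 := by
  have h : {x | p.eval x = 0}.Finite :=
    p.roots.toFinset.finite_toSet.subset fun x hx => by simpa [hp] using hx
  exact Bornology.isBounded_def.1 h.isBounded

/-- The coordinate `v = y / x ^ (g + 1)` as a function of `x` near a finite point `(x₀, y₀)`. -/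
noncomputable def vBranch (p : ℂ[X]) (g : ℕ) (y₀ x : ℂ) : ℂ := sqrtBranch p y₀ x / x ^ (g + 1)

theorem analyticAt_vBranch {p : ℂ[X]} (g : ℕ) {x₀ y₀ : ℂ} (h0 : y₀ ≠ 0) (h : y₀ ^ 2 = p.eval x₀)
    (hx : x₀ ≠ 0) : AnalyticAt ℂ (vBranch p g y₀) x₀ :=
  (analyticAt_sqrtBranch h0 h).div (analyticAt_id.pow _) (pow_ne_zero _ hx)

theorem vBranch_sq {p : ℂ[X]} {g : ℕ} (hN : p.natDegree ≤ 2 * g + 2) {x₀ y₀ : ℂ} (h0 : y₀ ≠ 0)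
    (hx : x₀ ≠ 0) :
    (fun t => vBranch p g y₀ t ^ 2) =ᶠ[𝓝 x₀] fun t => (reflect (2 * g + 2) p).eval t⁻¹ := by
  filter_upwards [isOpen_ne.mem_nhds hx] with t ht
  exact sq_div_pow hN ht (sqrtBranch_sq p h0 t)

theorem vBranch_self {p : ℂ[X]} {g : ℕ} {x₀ y₀ : ℂ} (h0 : y₀ ≠ 0) (h : y₀ ^ 2 = p.eval x₀) :
    vBranch p g y₀ x₀ = y₀ / x₀ ^ (g + 1) := by
  rw [vBranch, sqrtBranch_self h0 h]

theorem reflect_eval_zero {p : ℂ[X]} {g : ℕ} :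
    (reflect (2 * g + 2) p).eval 0 = p.coeff (2 * g + 2) := by
  rw [← coeff_zero_eq_eval_zero, coeff_reflect, revAt_le (by omega), Nat.sub_zero]

theorem derivative_reflect_eval_zero {p : ℂ[X]} {g : ℕ} :
    (derivative (reflect (2 * g + 2) p)).eval 0 = p.coeff (2 * g + 1) := by
  rw [← coeff_zero_eq_eval_zero, coeff_derivative, coeff_reflect, revAt_le (by omega)]
  simp

theorem ne_zero_of_natDegree_pos {p : ℂ[X]} (h : 0 < p.natDegree) : p ≠ 0 := by
  rintro rfl
  simp at h

/-! ### The Virasoro field at branch points and at infinity -/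

namespace VirasoroState

variable {p : ℂ[X]} {g : ℕ} {c : ℂ} (S : VirasoroState p g c)

theorem admissible_single {ψ : CoordPatch p g} {t : ℂ} (h : t ∈ ψ.dom) :
    Admissible ((ψ, t) ::ₘ 0) :=
  admissible_cons.2 ⟨h, by simp, admissible_zero⟩

theorem admissible_pair {ψ φ : CoordPatch p g} {t u : ℂ} (h : t ∈ ψ.dom) (h' : u ∈ φ.dom)
    (hne : ψ.pt t ≠ φ.pt u) : Admissible {(ψ, t), (φ, u)} :=
  admissible_cons.2 ⟨h, by simpa using hne, admissible_single h'⟩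

/-- The field `T(x)` near a branch point, in terms of the coordinate `y`. -/
theorem exists_branch_transform (hp : Squarefree p) (hp0 : p ≠ 0) (hS : S.one ≠ 0) {r : ℂ}
    (hr : p.eval r = 0) :
    ∃ ψ : CoordPatch p g, 0 ∈ ψ.dom ∧ ψ.pt 0 = .fin r 0 ∧
      ∀ᶠ x in 𝓝[≠] r, ∀ y, y ^ 2 = p.eval x → ψ.pt y = .fin x y ∧
        (p.eval x * S.T₁ x y = S.corr ((ψ, y) ::ₘ 0) * ((derivative p).eval x ^ 2 / 4)
          + c / 12 * S.one * (3 / 8 * ((derivative p).eval x ^ 2 / p.eval x)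
            + p.eval x * polySchwarzian p x)) ∧
        ∀ b, Admissible {(ψ, y), b} →
          S.conn (xPatch p g y, x) b * p.eval x =
            S.conn (ψ, y) b * ((derivative p).eval x ^ 2 / 4) := by
  obtain ⟨ψ, hψ0, hψr, hψ⟩ := exists_branchPatch g hp hr
  refine ⟨ψ, hψ0, hψr, ?_⟩
  have hd := (derivative p).continuous.continuousAt.eventually_ne (eval_derivative_ne_zero hp hr)
  filter_upwards [eventually_eval_ne_zero hp0 r, nhdsWithin_le_nhds hψ,
    nhdsWithin_le_nhds (eventually_eventually_nhds.2 hψ), nhdsWithin_le_nhds hd]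
    with x hx hψx hψxt hdx y hy
  have hy0 : y ≠ 0 := by
    rintro rfl
    exact hx (by rw [← hy]; simp)
  have hψy := hψx y hy
  have hh := analyticAt_sqrtBranch hy0 hy
  have he : ∀ᶠ t in 𝓝 x, sqrtBranch p y t ∈ ψ.dom ∧
      (xPatch p g y).pt t = ψ.pt (sqrtBranch p y t) := by
    filter_upwards [hψxt] with t ht
    have := ht _ (sqrtBranch_sq p hy0 t)
    exact ⟨this.1, this.2.symm⟩
  have hQ : (fun t => sqrtBranch p y t ^ 2) =ᶠ[𝓝 x] fun t => p.eval t :=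
    Eventually.of_forall fun t => sqrtBranch_sq p hy0 t
  have hself := sqrtBranch_self hy0 hy
  have hderiv := deriv_sqrt hh hQ
  rw [Polynomial.deriv, hself] at hderiv
  -- From `dy/dx = p'/(2y)` it follows that `p (dy/dx)² = p'²/4`, which has no pole at the branch
  -- point.
  replace hderiv : deriv (sqrtBranch p y) x = (derivative p).eval x / (2 * y) := by
    rw [hderiv]
    field_simp
  have hsch := schwarzian_sqrt hh hQ (by rwa [hself]) (by rwa [Polynomial.deriv])
  rw [schwarzian_eval, Polynomial.deriv] at hsch
  refine ⟨hψy.2, ?_, fun b hb => ?_⟩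
  · have := S.transform (xPatch p g y) ψ _ x 0 (admissible_single (xPatch_mem g hy0 hy)) hh he
    rw [hself, hderiv, hsch] at this
    change S.T₁ x y = _ + _ * S.one at this
    rw [this, div_pow, mul_pow, hy]
    field_simp
    ring
  · rw [S.transform_conn hS (xPatch p g y) ψ _ x b (admissible_xPatch hy0 hy hψy.2 hb) hh he,
      hself, hderiv, div_pow, mul_pow, hy]
    field_simp
    norm_num

/-- The field `T(x)` near the point over infinity, for odd degree, in terms of the coordinate `v`.
Here `q u = u ^ (2 * g + 2) * p (1 / u)`. -/
theorem exists_inf_transform_odd (hdeg : p.natDegree = 2 * g + 1) (hS : S.one ≠ 0) {q : ℂ[X]}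
    (hq : q = reflect (2 * g + 2) p) :
    ∃ ψ : CoordPatch p g, 0 ∈ ψ.dom ∧ ψ.pt 0 = .inf 0 ∧
      ∀ᶠ x in Bornology.cobounded ℂ, ∀ y, y ^ 2 = p.eval x →
        ψ.pt (y / x ^ (g + 1)) = .fin x y ∧
        (p.eval x * S.T₁ x y = x ^ (2 * g + 2) * x⁻¹ ^ 4 *
          (S.corr ((ψ, y / x ^ (g + 1)) ::ₘ 0) * ((derivative q).eval x⁻¹ ^ 2 / 4)
          + c / 12 * S.one * (3 / 8 * ((derivative q).eval x⁻¹ ^ 2 / q.eval x⁻¹)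
            + q.eval x⁻¹ * polySchwarzian q x⁻¹))) ∧
        ∀ b, Admissible {(ψ, y / x ^ (g + 1)), b} →
          S.conn (xPatch p g y, x) b * p.eval x = x ^ (2 * g + 2) * x⁻¹ ^ 4 *
            (S.conn (ψ, y / x ^ (g + 1)) b * ((derivative q).eval x⁻¹ ^ 2 / 4)) := by
  obtain ⟨ψ, hψ0, hψr, hψ⟩ := exists_infPatch_odd hdeg
  have hN : p.natDegree ≤ 2 * g + 2 := by omega
  have hp0 : p ≠ 0 := ne_zero_of_natDegree_pos (by omega)
  have hq1 : (derivative q).eval 0 ≠ 0 := by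
    rw [hq, derivative_reflect_eval_zero, ← hdeg, coeff_natDegree]
    exact leadingCoeff_ne_zero.2 hp0
  refine ⟨ψ, hψ0, hψr, ?_⟩
  have hd := tendsto_inv_cobounded.eventually
    ((derivative q).continuous.continuousAt.eventually_ne hq1)
  filter_upwards [eventually_eval_ne_zero_cobounded hp0, hψ,
    eventually_cobounded_eventually_nhds hψ, hd, eventually_ne_zero_cobounded,
    eventually_cobounded_eventually_nhds eventually_ne_zero_cobounded]
    with x hx hψx hψxt hdx hx0 hxt0 y hy
  have hy0 : y ≠ 0 := by
    rintro rfl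
    exact hx (by rw [← hy]; simp)
  have hψy := hψx y hy
  have hh := analyticAt_vBranch g hy0 hy hx0
  have he : ∀ᶠ t in 𝓝 x, vBranch p g y t ∈ ψ.dom ∧
      (xPatch p g y).pt t = ψ.pt (vBranch p g y t) := by
    filter_upwards [hψxt] with t ht
    have := ht _ (sqrtBranch_sq p hy0 t)
    exact ⟨this.1, this.2.symm⟩
  have hQ := vBranch_sq hN hy0 hx0
  rw [← hq] at hQ
  have hself : vBranch p g y x = y / x ^ (g + 1) := vBranch_self hy0 hy
  have hv0 : y / x ^ (g + 1) ≠ 0 := div_ne_zero hy0 (pow_ne_zero _ hx0)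
  have hderiv := deriv_sqrt hh hQ
  rw [deriv_eval_inv q hx0, hself] at hderiv
  have hsch := schwarzian_sqrt hh hQ (by rwa [hself]) (by
    rw [deriv_eval_inv q hx0]
    exact mul_ne_zero (neg_ne_zero.2 (pow_ne_zero _ (inv_ne_zero hx0))) hdx)
  rw [schwarzian_eval_inv q hx0 hdx, deriv_eval_inv q hx0] at hsch
  have hpq := eval_reflect_inv hN hx0
  have hvq := sq_div_pow hN hx0 hy
  rw [← hq] at hpq hvq
  have hq0 : q.eval x⁻¹ ≠ 0 := hvq ▸ pow_ne_zero 2 hv0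
  -- The prefactor is `x^(2g-2) = x^(n-3)` once `g ≥ 1`; the other factor is regular at `1/x = 0`.
  have hsq : p.eval x * deriv (vBranch p g y) x ^ 2 =
      x ^ (2 * g + 2) * x⁻¹ ^ 4 * ((derivative q).eval x⁻¹ ^ 2 / 4) := by
    have : deriv (vBranch p g y) x = -(x⁻¹ ^ 2) * (derivative q).eval x⁻¹ / (2 * (y / x ^ (g + 1))) := by
      rw [hderiv]
      field_simp
    rw [this, div_pow, mul_pow 2, hvq, ← hpq]
    clear * - hq0
    generalize q.eval x⁻¹ = Q at *
    generalize (derivative q).eval x⁻¹ = Q' at *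
    generalize x⁻¹ = u at *
    field_simp
    ring
  refine ⟨hψy.2, ?_, fun b hb => ?_⟩
  · have := S.transform (xPatch p g y) ψ _ x 0 (admissible_single (xPatch_mem g hy0 hy)) hh he
    rw [hself, hsch] at this
    change S.T₁ x y = _ + _ * S.one at this
    rw [this, mul_add, mul_left_comm, hsq, ← hpq]
    clear * - hq0
    generalize q.eval x⁻¹ = Q at *
    generalize (derivative q).eval x⁻¹ = Q' at *
    generalize x⁻¹ = u at *
    generalize polySchwarzian q u = s at *
    field_simp
  · rw [S.transform_conn hS (xPatch p g y) ψ _ x b (admissible_xPatch hy0 hy hψy.2 hb) hh he,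
      hself, mul_assoc, mul_comm (deriv _ _ ^ 2), hsq]
    ring

theorem schwarzian_inv {x : ℂ} (hx : x ≠ 0) : schwarzian (fun t => t⁻¹) x = 0 := by
  have h := schwarzian_eval_inv (X : ℂ[X]) hx (by simp)
  simpa [polySchwarzian] using h

/-- The field `T(x)` near the two points over infinity, for even degree, in terms of `u = 1 / x`. -/
theorem exists_inf_transform_even (hdeg : p.natDegree = 2 * g + 2) (hS : S.one ≠ 0) :
    ∃ ψ ψ' : CoordPatch p g, (0 ∈ ψ.dom ∧ ∃ v, ψ.pt 0 = .inf v) ∧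
      (0 ∈ ψ'.dom ∧ ∃ v, ψ'.pt 0 = .inf v) ∧
      ∀ᶠ x in Bornology.cobounded ℂ, ∀ y, y ^ 2 = p.eval x → ∃ φ, (φ = ψ ∨ φ = ψ') ∧
        S.T₁ x y = S.corr ((φ, x⁻¹) ::ₘ 0) * x⁻¹ ^ 4 ∧
        ∀ b, Admissible {(φ, x⁻¹), b} →
          S.conn (xPatch p g y, x) b = S.conn (φ, x⁻¹) b * x⁻¹ ^ 4 := by
  have hN : p.natDegree ≤ 2 * g + 2 := by omega
  have hp0 : p ≠ 0 := ne_zero_of_natDegree_pos (by omega)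
  set q := reflect (2 * g + 2) p with hq
  have hq0 : q.eval 0 ≠ 0 := by
    rw [hq, reflect_eval_zero, ← hdeg, coeff_natDegree]
    exact leadingCoeff_ne_zero.2 hp0
  obtain ⟨v, hv⟩ := exists_sq_eq_eval q 0
  have hv0 : v ≠ 0 := by
    rintro rfl
    exact hq0 (by rw [← hv]; simp)
  have hv' : (-v) ^ 2 = q.eval 0 := by rw [neg_sq, hv]
  -- Each of the two points over infinity has its own patch with coordinate `1/x`; for large `x`,
  -- the sign of `v` relative to the branch selects the patch.
  have key : ∀ w (hw : w ≠ 0), w ^ 2 = q.eval 0 → ∀ᶠ x in Bornology.cobounded ℂ, ∀ y,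
      y ^ 2 = p.eval x → y / x ^ (g + 1) = sqrtBranch q w x⁻¹ →
        S.T₁ x y = S.corr ((infPatch hN w hw, x⁻¹) ::ₘ 0) * x⁻¹ ^ 4 ∧
        ∀ b, Admissible {(infPatch hN w hw, x⁻¹), b} →
          S.conn (xPatch p g y, x) b = S.conn (infPatch hN w hw, x⁻¹) b * x⁻¹ ^ 4 := by
    intro w hw hwq
    have hdom := (infPatch hN w hw).isOpen_dom.mem_nhds (zero_mem_infPatch hN hw hwq).1
    filter_upwards [eventually_eval_ne_zero_cobounded hp0, eventually_ne_zero_cobounded,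
      tendsto_inv_cobounded.eventually hdom,
      tendsto_inv_cobounded.eventually (analyticAt_sqrtBranch hw hwq).eventually_analyticAt,
      eventually_cobounded_eventually_nhds (tendsto_inv_cobounded.eventually hdom)]
      with x hx hx0 hxd hxa hxt y hy hyx
    have hy0 : y ≠ 0 := by
      rintro rfl
      exact hx (by rw [← hy]; simp)
    have hh : AnalyticAt ℂ (fun t : ℂ => t⁻¹) x := analyticAt_inv hx0
    have heq : vBranch p g y =ᶠ[𝓝 x] fun t => sqrtBranch q w t⁻¹ := by
      refine eventuallyEq_of_sq_eq (analyticAt_vBranch g hy0 hy hx0).continuousAt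
        (ContinuousAt.comp' hxa.continuousAt hh.continuousAt) ?_ ?_ ?_
      · filter_upwards [vBranch_sq hN hy0 hx0] with t ht
        rw [ht, sqrtBranch_sq q hw]
      · rw [vBranch_self hy0 hy, hyx]
      · rw [vBranch_self hy0 hy]
        exact div_ne_zero hy0 (pow_ne_zero _ hx0)
    have he : ∀ᶠ t in 𝓝 x, t⁻¹ ∈ (infPatch hN w hw).dom ∧
        (xPatch p g y).pt t = (infPatch hN w hw).pt t⁻¹ := by
      filter_upwards [heq, hxt, isOpen_ne.mem_nhds hx0] with t ht htd ht0
      refine ⟨htd, ?_⟩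
      change _ = nearInf g t⁻¹ (sqrtBranch q w t⁻¹)
      rw [← ht, vBranch, nearInf_inv ht0, xPatch_pt]
    have hd : deriv (fun t : ℂ => t⁻¹) x ^ 2 = x⁻¹ ^ 4 := by
      rw [deriv_inv]
      field_simp
    constructor
    · have := S.transform (xPatch p g y) (infPatch hN w hw) _ x 0
        (admissible_single (xPatch_mem g hy0 hy)) hh he
      rw [hd, schwarzian_inv hx0, mul_zero, zero_mul, add_zero] at this
      exact this
    · intro b hb
      have hpt : (infPatch hN w hw).pt x⁻¹ = .fin x y := by
        change nearInf g x⁻¹ (sqrtBranch q w x⁻¹) = _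
        rw [← hyx, nearInf_inv hx0]
      rw [S.transform_conn hS (xPatch p g y) (infPatch hN w hw) _ x b
        (admissible_xPatch hy0 hy hpt hb) hh he, hd]
  have z1 := zero_mem_infPatch hN hv0 hv
  have z2 := zero_mem_infPatch hN (neg_ne_zero.2 hv0) hv'
  refine ⟨infPatch hN v hv0, infPatch hN (-v) (neg_ne_zero.2 hv0), ⟨z1.1, v, z1.2⟩,
    ⟨z2.1, -v, z2.2⟩, ?_⟩
  filter_upwards [key v hv0 hv, key (-v) (neg_ne_zero.2 hv0) hv', eventually_ne_zero_cobounded]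
    with x h1 h2 hx0 y hy
  rcases eq_or_eq_neg_sqrtBranch hv0 (sq_div_pow hN hx0 hy) with h | h
  · exact ⟨_, Or.inl rfl, h1 y hy h⟩
  · exact ⟨_, Or.inr rfl, h2 y hy (by rw [h, sqrtBranch_neg])⟩

end VirasoroState

theorem eventually_vcoord_mem {p : ℂ[X]} {g : ℕ} (hdeg : p.natDegree = 2 * g + 1) {U : Set ℂ}
    (hU : U ∈ 𝓝 0) : ∀ᶠ x in Bornology.cobounded ℂ, ∀ y, y ^ 2 = p.eval x →
      y / x ^ (g + 1) ∈ U := by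
  have hq0 : (reflect (2 * g + 2) p).eval 0 = 0 := by
    rw [reflect_eval_zero]
    exact coeff_eq_zero_of_natDegree_lt (by omega)
  filter_upwards [tendsto_inv_cobounded.eventually (eventually_sqrt_mem _ hq0 hU),
    eventually_ne_zero_cobounded] with x hx hx0 y hy
  exact hx _ (sq_div_pow (by omega) hx0 hy)

theorem norm_pow_mul_inv_pow {x : ℂ} (hx : x ≠ 0) {g : ℕ} (hg : 1 ≤ g) :
    ‖x ^ (2 * g + 2) * x⁻¹ ^ 4‖ = ‖x‖ ^ (2 * g - 2) := by
  have : x ^ (2 * g + 2) * x⁻¹ ^ 4 = x ^ (2 * g - 2) := by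
    rw [show 2 * g + 2 = (2 * g - 2) + 4 by omega, pow_add, mul_assoc, ← mul_pow,
      mul_inv_cancel₀ hx, one_pow, mul_one]
  rw [this, norm_pow]

/-! ### Bounds at branch points and at infinity, and the polynomial `P` -/

namespace VirasoroState

variable {p : ℂ[X]} {g : ℕ} {c : ℂ} (S : VirasoroState p g c)

/-- In the coordinate `y` the connected function is holomorphic at the branch point, because `y₂ ≠
0` keeps the second position away from it. -/
theorem exists_bound_conn_root (hp : Squarefree p) (hp0 : p ≠ 0) (hS : S.one ≠ 0) {r : ℂ}
    (hr : p.eval r = 0) {x₂ y₂ : ℂ} (h0 : y₂ ≠ 0) (h : y₂ ^ 2 = p.eval x₂) :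
    ∃ B : ℝ, ∀ᶠ x in 𝓝[≠] r, ∀ y, y ^ 2 = p.eval x →
      ‖S.conn (xPatch p g y, x) (xPatch p g y₂, x₂) * p.eval x‖ ≤ B := by
  obtain ⟨ψ, hψ0, hψr, hψ⟩ := S.exists_branch_transform hp hp0 hS hr
  have hadm : Admissible {(ψ, 0), (xPatch p g y₂, x₂)} :=
    admissible_pair hψ0 (xPatch_mem g h0 h) (by
      rw [hψr, (xPatch_spec p g h0 h).2]
      intro he
      exact h0 (Pt.fin.inj he).2.symm)
  obtain ⟨B₁, hB₁⟩ := S.exists_bound_conn hadm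
  obtain ⟨B₂, hB₂⟩ := exists_bound_of_continuousAt
    (((derivative p).continuous.pow 2).div_const 4).continuousAt (x := r)
  refine ⟨B₁ * B₂, ?_⟩
  filter_upwards [hψ, nhdsWithin_le_nhds hB₂, nhdsWithin_le_nhds
    (eventually_sqrt_mem p hr (hB₁.and (eventually_admissible hadm)))] with x hx hx2 hxt y hy
  rw [(hx y hy).2.2 _ (hxt y hy).2, norm_mul]
  exact mul_le_mul (hxt y hy).1 hx2 (norm_nonneg _) ((norm_nonneg _).trans (hxt y hy).1)

/-- The connected function is bounded in the coordinate `v`, and the change of coordinate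
contributes `x^(2g-2) = x^(n-3)`. This is the growth claim. -/
theorem exists_bound_conn_odd (hg : 1 ≤ g) (hdeg : p.natDegree = 2 * g + 1) (hS : S.one ≠ 0)
    {x₂ y₂ : ℂ} (h0 : y₂ ≠ 0) (h : y₂ ^ 2 = p.eval x₂) :
    ∃ B : ℝ, ∀ᶠ x in Bornology.cobounded ℂ, ∀ y, y ^ 2 = p.eval x →
      ‖S.conn (xPatch p g y, x) (xPatch p g y₂, x₂) * p.eval x‖ ≤ B * ‖x‖ ^ (2 * g - 2) := by
  obtain ⟨ψ, hψ0, hψr, hψ⟩ := S.exists_inf_transform_odd hdeg hS rfl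
  have hadm : Admissible {(ψ, 0), (xPatch p g y₂, x₂)} :=
    admissible_pair hψ0 (xPatch_mem g h0 h) (by
      rw [hψr, (xPatch_spec p g h0 h).2]
      exact Pt.noConfusion)
  obtain ⟨B₁, hB₁⟩ := S.exists_bound_conn hadm
  obtain ⟨B₂, hB₂⟩ := exists_bound_of_continuousAt
    (((derivative (reflect (2 * g + 2) p)).continuous.pow 2).div_const 4).continuousAt (x := 0)
  refine ⟨B₁ * B₂, ?_⟩
  filter_upwards [hψ, tendsto_inv_cobounded.eventually hB₂, eventually_vcoord_mem hdeg
    (hB₁.and (eventually_admissible hadm)), eventually_ne_zero_cobounded] with x hx hx2 hxt hx0 y hy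
  rw [(hx y hy).2.2 _ (hxt y hy).2, norm_mul, norm_pow_mul_inv_pow hx0 hg, norm_mul, mul_comm]
  exact mul_le_mul_of_nonneg_right (mul_le_mul (hxt y hy).1 hx2 (norm_nonneg _)
    ((norm_nonneg _).trans (hxt y hy).1)) (by positivity)

/-- The bound is not sharp: the decay `x⁻⁴` is thrown away, since for even degree any polynomial
growth suffices. -/
theorem exists_bound_conn_even (hdeg : p.natDegree = 2 * g + 2) (hS : S.one ≠ 0)
    {x₂ y₂ : ℂ} (h0 : y₂ ≠ 0) (h : y₂ ^ 2 = p.eval x₂) :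
    ∃ B : ℝ, ∀ᶠ x in Bornology.cobounded ℂ, ∀ y, y ^ 2 = p.eval x →
      ‖S.conn (xPatch p g y, x) (xPatch p g y₂, x₂) * p.eval x‖ ≤ B * ‖x‖ ^ (2 * g + 2) := by
  obtain ⟨ψ, ψ', ⟨hψ0, v, hψv⟩, ⟨hψ0', v', hψv'⟩, hψ⟩ := S.exists_inf_transform_even hdeg hS
  have hadm : ∀ φ : CoordPatch p g, 0 ∈ φ.dom → ∀ v, φ.pt 0 = .inf v →
      Admissible {(φ, 0), (xPatch p g y₂, x₂)} := fun φ hφ v hv =>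
    admissible_pair hφ (xPatch_mem g h0 h) (by
      rw [hv, (xPatch_spec p g h0 h).2]
      exact Pt.noConfusion)
  have a1 := hadm ψ hψ0 v hψv
  have a2 := hadm ψ' hψ0' v' hψv'
  obtain ⟨B₁, hB₁⟩ := S.exists_bound_conn a1
  obtain ⟨B₂, hB₂⟩ := S.exists_bound_conn a2
  obtain ⟨B₃, hB₃⟩ := exists_bound_eval_cobounded p hdeg.le
  refine ⟨max B₁ B₂ * B₃, ?_⟩
  filter_upwards [hψ, tendsto_inv_cobounded.eventually hB₁, tendsto_inv_cobounded.eventually hB₂,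
    tendsto_inv_cobounded.eventually (eventually_admissible a1),
    tendsto_inv_cobounded.eventually (eventually_admissible a2), hB₃,
    eventually_cobounded_le_norm (E := ℂ) 1] with x hx h1 h2 hx1 hx2 hx3 hxn y hy
  obtain ⟨φ, hφ, -, hx⟩ := hx y hy
  have hB : ‖S.conn (φ, x⁻¹) (xPatch p g y₂, x₂)‖ ≤ max B₁ B₂ := by
    rcases hφ with rfl | rfl
    · exact h1.trans (le_max_left _ _)
    · exact h2.trans (le_max_right _ _)
  have hle : ‖x⁻¹ ^ 4‖ ≤ 1 := by
    rw [norm_pow, norm_inv]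
    exact pow_le_one₀ (inv_nonneg.2 (norm_nonneg _)) (inv_le_one_of_one_le₀ hxn)
  rw [hx _ (by rcases hφ with rfl | rfl <;> assumption), norm_mul, norm_mul, mul_assoc (max B₁ B₂)]
  refine mul_le_mul ?_ hx3 (norm_nonneg _) ((norm_nonneg _).trans hB)
  exact (mul_le_of_le_one_right (norm_nonneg _) hle).trans hB

/-- The function `P x y` determined by the one-point function. -/
noncomputable def P₁ (x y : ℂ) : ℂ :=
  4 * (p.eval x * S.T₁ x y) - c / 8 * S.one * ((derivative p).eval x ^ 2 / p.eval x)

/-- The pole of `4 p T` at a branch point comes from the Schwarzian of `y` and equals `4 · (c/12) ·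
(3/8) = c/8` times `⟨1⟩ p'²/p`, which is what `P₁` subtracts. -/
theorem exists_bound_P₁_root (hp : Squarefree p) (hp0 : p ≠ 0) (hS : S.one ≠ 0) {r : ℂ}
    (hr : p.eval r = 0) :
    ∃ B : ℝ, ∀ᶠ x in 𝓝[≠] r, ∀ y, y ^ 2 = p.eval x → ‖S.P₁ x y‖ ≤ B := by
  obtain ⟨ψ, hψ0, -, hψ⟩ := S.exists_branch_transform hp hp0 hS hr
  obtain ⟨B₁, hB₁⟩ := S.exists_bound_corr (admissible_single hψ0)
  obtain ⟨B₂, hB₂⟩ := exists_bound_of_continuousAt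
    ((derivative p).continuous.pow 2).continuousAt (x := r)
  obtain ⟨B₃, hB₃⟩ := exists_bound_of_continuousAt ((continuousAt_const (y := c / 3 * S.one)).mul
    (p.continuous.continuousAt.mul (continuousAt_polySchwarzian (eval_derivative_ne_zero hp hr))))
  refine ⟨B₁ * B₂ + B₃, ?_⟩
  filter_upwards [hψ, nhdsWithin_le_nhds hB₂, nhdsWithin_le_nhds hB₃, nhdsWithin_le_nhds
    (eventually_sqrt_mem p hr hB₁)] with x hx hx2 hx3 hxt y hy
  have : S.P₁ x y = S.corr ((ψ, y) ::ₘ 0) * (derivative p).eval x ^ 2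
      + c / 3 * S.one * (p.eval x * polySchwarzian p x) := by
    rw [P₁, (hx y hy).2.1]
    ring
  rw [this]
  refine (norm_add_le _ _).trans (add_le_add ?_ hx3)
  rw [norm_mul]
  exact mul_le_mul (hxt y hy) hx2 (norm_nonneg _) ((norm_nonneg _).trans (hxt y hy))

/-- With `u = 1/x` one has `p'²/p = x^(2g+2) u² ((2g+2)² q - 2(2g+2) u q' + u² q'²/q)`. The last
term cancels against the Schwarzian of `v`. The others begin with `((2g+2)² - 2(2g+2)) a₀ u =
2g(2g+2) a₀ u`, and `2g(2g+2) = n² - 1`. -/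
theorem exists_bound_P₁_odd (hg : 1 ≤ g) (hdeg : p.natDegree = 2 * g + 1) (hS : S.one ≠ 0) :
    ∃ B : ℝ, ∀ᶠ x in Bornology.cobounded ℂ, ∀ y, y ^ 2 = p.eval x →
      ‖S.P₁ x y + c / 8 * S.one * (2 * g * (2 * g + 2)) * p.leadingCoeff * x ^ (2 * g - 1)‖ ≤
        B * ‖x‖ ^ (2 * g - 2) := by
  set q := reflect (2 * g + 2) p with hq
  obtain ⟨ψ, hψ0, -, hψ⟩ := S.exists_inf_transform_odd hdeg hS hq
  have hN : p.natDegree ≤ 2 * g + 2 := by omega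
  have hp0 : p ≠ 0 := ne_zero_of_natDegree_pos (by omega)
  have hq0 : q.coeff 0 = 0 := by
    rw [coeff_zero_eq_eval_zero, hq, reflect_eval_zero]
    exact coeff_eq_zero_of_natDegree_lt (by omega)
  have hq1 : q.coeff 1 = p.leadingCoeff := by
    rw [hq, coeff_reflect, revAt_le (by omega), leadingCoeff, hdeg]
    rfl
  have hq1' : (derivative q).eval 0 ≠ 0 := by
    rw [hq, derivative_reflect_eval_zero, ← hdeg, coeff_natDegree]
    exact leadingCoeff_ne_zero.2 hp0
  -- Remainders beyond the leading terms: `q = a₀ u + u² q₂` and `q' = a₀ + u d₁`.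
  set q₂ := q.divX.divX with hq₂
  set d₁ := (derivative q).divX with hd₁
  have eq2 : ∀ u, q.eval u = u * p.leadingCoeff + u ^ 2 * q₂.eval u := by
    intro u
    have e1 := congrArg (fun f => f.eval u) (divX_mul_X_add q)
    have e2 := congrArg (fun f => f.eval u) (divX_mul_X_add q.divX)
    simp only [eval_add, eval_mul, eval_X, eval_C, coeff_divX, hq0, zero_add, hq1] at e1 e2
    rw [← e1, ← e2]
    ring
  have eqd : ∀ u, (derivative q).eval u = p.leadingCoeff + u * d₁.eval u := by
    intro u
    have e1 := congrArg (fun f => f.eval u) (divX_mul_X_add (derivative q))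
    simp only [eval_add, eval_mul, eval_X, eval_C, coeff_derivative, zero_add, hq1, Nat.cast_zero,
      mul_one] at e1
    rw [← e1]
    ring
  obtain ⟨B₁, hB₁⟩ := S.exists_bound_corr (admissible_single hψ0)
  obtain ⟨B₂, hB₂⟩ := exists_bound_of_continuousAt
    ((derivative q).continuous.pow 2).continuousAt (x := 0)
  have hcont : ContinuousAt (fun u => c / 3 * S.one * (q.eval u * polySchwarzian q u)
      - c / 8 * S.one * ((2 * g + 2) ^ 2 * q₂.eval u - 2 * (2 * g + 2) * d₁.eval u)) 0 := by
    have k1 := continuousAt_polySchwarzian hq1'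
    have k2 := q.continuous.continuousAt (x := (0 : ℂ))
    have k3 := q₂.continuous.continuousAt (x := (0 : ℂ))
    have k4 := d₁.continuous.continuousAt (x := (0 : ℂ))
    fun_prop
  obtain ⟨B₃, hB₃⟩ := exists_bound_of_continuousAt hcont
  refine ⟨B₁ * B₂ + B₃, ?_⟩
  filter_upwards [hψ, tendsto_inv_cobounded.eventually hB₂, tendsto_inv_cobounded.eventually hB₃,
    eventually_vcoord_mem hdeg hB₁, eventually_ne_zero_cobounded,
    eventually_eval_ne_zero_cobounded hp0] with x hx hx2 hx3 hxt hx0 hpx y hy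
  have hu0 : x⁻¹ ≠ 0 := inv_ne_zero hx0
  have hpq : q.eval x⁻¹ * x ^ (2 * g + 2) = p.eval x := eval_reflect_inv hN hx0
  have hQ0 : q.eval x⁻¹ ≠ 0 := fun h => hpx (by rw [← hpq, h, zero_mul])
  have hpd : (derivative p).eval x =
      x ^ (2 * g + 2) * x⁻¹ * ((2 * g + 2) * q.eval x⁻¹ - x⁻¹ * (derivative q).eval x⁻¹) := by
    have h1 : HasDerivAt (fun t => q.eval t⁻¹ * t ^ (2 * g + 2)) _ x :=
      (hasDerivAt_eval_inv q hx0).mul (hasDerivAt_pow (2 * g + 2) x)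
    have h2 : (fun t => q.eval t⁻¹ * t ^ (2 * g + 2)) =ᶠ[𝓝 x] fun t => p.eval t := by
      filter_upwards [isOpen_ne.mem_nhds hx0] with t ht using eval_reflect_inv hN ht
    rw [← Polynomial.deriv, ← h2.deriv_eq, h1.deriv]
    have h3 : x ^ (2 * g + 2) = x * x ^ (2 * g + 1) := by ring
    have h4 : x ^ (2 * g + 2 - 1) = x ^ (2 * g + 2) * x⁻¹ := by
      rw [h3, Nat.add_sub_assoc (by norm_num)]
      field_simp
    rw [h4]
    push_cast
    ring
  have hpow : x ^ (2 * g - 1) = x ^ (2 * g + 2) * x⁻¹ ^ 3 := by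
    rw [show 2 * g + 2 = (2 * g - 1) + 3 by omega, pow_add, mul_assoc, ← mul_pow,
      mul_inv_cancel₀ hx0, one_pow, mul_one]
  have key : S.P₁ x y + c / 8 * S.one * (2 * g * (2 * g + 2)) * p.leadingCoeff * x ^ (2 * g - 1) =
      x ^ (2 * g + 2) * x⁻¹ ^ 4 * (S.corr ((ψ, y / x ^ (g + 1)) ::ₘ 0) * (derivative q).eval x⁻¹ ^ 2
        + (c / 3 * S.one * (q.eval x⁻¹ * polySchwarzian q x⁻¹)
      - c / 8 * S.one * ((2 * g + 2) ^ 2 * q₂.eval x⁻¹ - 2 * (2 * g + 2) * d₁.eval x⁻¹))) := by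
    have k1 := eq2 x⁻¹
    have k2 := eqd x⁻¹
    have hX : x ^ (2 * g + 2) ≠ 0 := pow_ne_zero _ hx0
    rw [P₁, (hx y hy).2.1, hpow, ← hpq, hpd]
    generalize S.corr ((ψ, y / x ^ (g + 1)) ::ₘ 0) = A
    generalize polySchwarzian q x⁻¹ = s
    generalize x ^ (2 * g + 2) = Z at *
    generalize q.eval x⁻¹ = Q at *
    generalize (derivative q).eval x⁻¹ = D at *
    generalize q₂.eval x⁻¹ = E at *
    generalize d₁.eval x⁻¹ = F at *
    generalize x⁻¹ = u at *
    generalize p.leadingCoeff = a at *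
    clear * - k1 k2 hX hQ0 hu0
    have e1 : Z * u * ((2 * g + 2) * Q - u * D) * (Z * u * ((2 * g + 2) * Q - u * D)) / (Q * Z) =
        Z * u ^ 2 * ((2 * g + 2) ^ 2 * Q - 2 * (2 * g + 2) * u * D + u ^ 2 * (D ^ 2 / Q)) := by
      field_simp
      ring
    rw [sq (Z * u * _), e1]
    generalize D ^ 2 / Q = w
    rw [k1, k2]
    ring
  rw [key, norm_mul, norm_pow_mul_inv_pow hx0 hg, mul_comm]
  gcongr
  refine (norm_add_le _ _).trans (add_le_add ?_ hx3)
  rw [norm_mul]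
  exact mul_le_mul (hxt y hy) hx2 (norm_nonneg _) ((norm_nonneg _).trans (hxt y hy))

theorem exists_bound_P₁_even (hdeg : p.natDegree = 2 * g + 2) (hS : S.one ≠ 0) :
    ∃ B : ℝ, ∀ᶠ x in Bornology.cobounded ℂ, ∀ y, y ^ 2 = p.eval x →
      ‖S.P₁ x y‖ ≤ B * ‖x‖ ^ (2 * (2 * g + 2)) := by
  obtain ⟨ψ, ψ', ⟨hψ0, v, hψv⟩, ⟨hψ0', v', hψv'⟩, hψ⟩ := S.exists_inf_transform_even hdeg hS
  obtain ⟨B₁, hB₁⟩ := S.exists_bound_corr (admissible_single hψ0)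
  obtain ⟨B₂, hB₂⟩ := S.exists_bound_corr (admissible_single hψ0')
  obtain ⟨B₃, hB₃⟩ := exists_bound_eval_cobounded p (k := 2 * (2 * g + 2)) (by omega)
  obtain ⟨B₄, hB₄⟩ := exists_bound_eval_cobounded (derivative p) (k := 2 * g + 2)
    ((natDegree_derivative_le p).trans (by omega))
  have hlarge : ∀ᶠ x in Bornology.cobounded ℂ, 1 ≤ ‖p.eval x‖ :=
    (p.tendsto_norm_atTop (natDegree_pos_iff_degree_pos.1 (by omega))
      tendsto_norm_cobounded_atTop).eventually_ge_atTop 1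
  refine ⟨4 * (B₃ * max B₁ B₂) + ‖c / 8 * S.one‖ * B₄ ^ 2, ?_⟩
  filter_upwards [hψ, tendsto_inv_cobounded.eventually hB₁, tendsto_inv_cobounded.eventually hB₂,
    hB₃, hB₄, hlarge, eventually_cobounded_le_norm (E := ℂ) 1] with x hx h1 h2 hx3 hx4 hxl hxn y hy
  obtain ⟨φ, hφ, hx, -⟩ := hx y hy
  have hB : ‖S.corr ((φ, x⁻¹) ::ₘ 0)‖ ≤ max B₁ B₂ := by
    rcases hφ with rfl | rfl
    · exact h1.trans (le_max_left _ _)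
    · exact h2.trans (le_max_right _ _)
  have hle : ‖x⁻¹ ^ 4‖ ≤ 1 := by
    rw [norm_pow, norm_inv]
    exact pow_le_one₀ (inv_nonneg.2 (norm_nonneg _)) (inv_le_one_of_one_le₀ hxn)
  have hT : ‖S.T₁ x y‖ ≤ max B₁ B₂ := by
    rw [hx, norm_mul]
    exact (mul_le_of_le_one_right (norm_nonneg _) hle).trans hB
  rw [P₁, add_mul]
  refine (norm_sub_le _ _).trans (add_le_add ?_ ?_)
  · rw [norm_mul, norm_mul, RCLike.norm_ofNat, mul_assoc 4, mul_right_comm B₃]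
    gcongr
    · exact (norm_nonneg _).trans hx3
  · rw [norm_mul, norm_div, norm_pow, mul_assoc]
    gcongr
    refine (div_le_self (by positivity) hxl).trans ?_
    calc ‖(derivative p).eval x‖ ^ 2 ≤ (B₄ * ‖x‖ ^ (2 * g + 2)) ^ 2 := by gcongr
      _ = _ := by ring

theorem analyticAt_T₁ {x₀ y₀ : ℂ} (h0 : y₀ ≠ 0) (h : y₀ ^ 2 = p.eval x₀) :
    AnalyticAt ℂ (fun x => S.T₁ x (sqrtBranch p y₀ x)) x₀ :=
  S.analyticAt_corr_xPatch h0 h (admissible_single (xPatch_mem g h0 h))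

/-- The polynomial `a` compensates a known leading term of `P₁`, so that the degree bounds for `E`
and `O` can be sharp while the top coefficient stays explicit. -/
theorem exists_P_polynomials (hp : Squarefree p) (hn : 0 < p.natDegree) (hS : S.one ≠ 0)
    (a : ℂ[X]) {k : ℕ} {B : ℝ} (hB : ∀ᶠ x in Bornology.cobounded ℂ, ∀ y, y ^ 2 = p.eval x →
      ‖S.P₁ x y + a.eval x‖ ≤ B * ‖x‖ ^ k) :
    ∃ E O : ℂ[X], E.natDegree ≤ k ∧ (O ≠ 0 → 2 * O.natDegree + p.natDegree ≤ 2 * k) ∧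
      ∀ x y, y ≠ 0 → y ^ 2 = p.eval x → S.P₁ x y = (E - a).eval x + y * O.eval x := by
  have hp0 := ne_zero_of_natDegree_pos hn
  have hroot : ∀ x, x ∈ p.roots.toFinset ↔ p.eval x = 0 := fun x => by simp [hp0]
  obtain ⟨E, O, hE, hO, hEO⟩ := exists_polynomials_of_growth hp hn p.roots.toFinset
    (fun x hx => (hroot x).2 hx) (fun x y => S.P₁ x y + a.eval x)
    (fun x₀ y₀ hx₀ hy₀ => by
      have hx0 : p.eval x₀ ≠ 0 := fun h => hx₀ ((hroot _).2 h)
      have h0 : y₀ ≠ 0 := by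
        rintro rfl
        exact hx0 (by rw [← hy₀]; simp)
      have k1 := S.analyticAt_T₁ h0 hy₀
      have k2 := analyticAt_eval p x₀
      have k3 := analyticAt_eval (derivative p) x₀
      have k4 := analyticAt_eval a x₀
      exact ((analyticAt_const.mul (k2.mul k1)).sub
        (analyticAt_const.mul ((k3.pow 2).div k2 hx0))).add k4)
    (fun r hr => by
      obtain ⟨B₁, hB₁⟩ := S.exists_bound_P₁_root hp hp0 hS ((hroot r).1 hr)
      obtain ⟨B₂, hB₂⟩ := exists_bound_of_continuousAt a.continuous.continuousAt (x := r)
      refine ⟨B₁ + B₂, ?_⟩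
      filter_upwards [hB₁, nhdsWithin_le_nhds hB₂] with x h1 h2 y hy
      exact (norm_add_le _ _).trans (add_le_add (h1 y hy) h2)) hB
  refine ⟨E, O, hE, hO, fun x y h0 hy => ?_⟩
  have := hEO x y (fun h => h0 (by
    rw [hroot, ← hy] at h
    exact pow_eq_zero_iff two_ne_zero |>.1 h)) hy
  rw [eval_sub]
  linear_combination this

theorem T₁_eq_of_P₁_eq {x y w : ℂ} (h : S.P₁ x y = w) :
    p.eval x * S.T₁ x y =
      c / 32 * ((derivative p).eval x ^ 2 / p.eval x) * S.one + 1 / 4 * w := by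
  rw [← h, P₁]
  ring

end VirasoroState

/-! ### The polynomials of `x₁ + x₂` and `x₁ * x₂` in `R` -/

theorem evalSqrt_expand (a : ℂ[X]) (w : ℂ) : evalSqrt (expand ℂ 2 a) w = a.eval w := by
  rw [evalSqrt, contract_expand 2 two_ne_zero]

theorem derivative_expand_two (a : ℂ[X]) :
    derivative (expand ℂ 2 a) = X * expand ℂ 2 (2 * derivative a) := by
  rw [derivative_expand, map_mul, map_ofNat]
  simp only [Nat.cast_ofNat, Nat.add_one_sub_one, pow_one]
  ring

theorem evalSqrt_derivDivX_expand (a : ℂ[X]) (w : ℂ) :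
    evalSqrt (derivDivX (expand ℂ 2 a)) w = 2 * (derivative a).eval w := by
  have : derivDivX (expand ℂ 2 a) = expand ℂ 2 (2 * derivative a) := by
    rw [derivDivX, derivative_expand_two]
    ext k
    rw [coeff_divX, coeff_X_mul]
  rw [this, evalSqrt_expand]
  simp

theorem evalSqrt_derivative_derivative_expand (a : ℂ[X]) (w : ℂ) :
    evalSqrt (derivative (derivative (expand ℂ 2 a))) w =
      2 * (derivative a).eval w + 4 * w * (derivative (derivative a)).eval w := by
  have : derivative (derivative (expand ℂ 2 a)) =
      expand ℂ 2 (2 * derivative a + 4 * X * derivative (derivative a)) := by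
    rw [derivative_expand_two, derivative_mul, derivative_expand_two]
    simp only [derivative_X, one_mul, map_add, map_mul, map_ofNat, expand_X, derivative_mul,
      derivative_ofNat, zero_mul, zero_add]
    ring
  rw [this, evalSqrt_expand]
  simp

theorem eval_eq_contract (p : ℂ[X]) (x : ℂ) :
    p.eval x = (contract 2 p).eval (x ^ 2) + x * (contract 2 p.divX).eval (x ^ 2) := by
  conv_lhs => rw [← evenPart_add_oddPart p]
  simp [evenPart, oddPart, expand_eval]

/-- The polynomial `p^(even)(s) + (x₁ + x₂) / 2 * p^(odd)(s)`, where `s ^ 2 = x₁ * x₂`. -/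
noncomputable def polar (p : ℂ[X]) (x₁ x₂ : ℂ) : ℂ :=
  (contract 2 p).eval (x₁ * x₂) + 1 / 2 * (x₁ + x₂) * (contract 2 p.divX).eval (x₁ * x₂)

/-- The sum of the coefficients of `(c / 32) * y₁ * y₂ * ⟨1⟩ / (x₁ - x₂) ^ 2` in `R`. -/
noncomputable def polarDeriv (p : ℂ[X]) (x₁ x₂ : ℂ) : ℂ :=
  4 * (derivative (contract 2 p)).eval (x₁ * x₂)
    + 4 * (x₁ * x₂) * (derivative (derivative (contract 2 p))).eval (x₁ * x₂)
    + (x₁ + x₂) * (4 * (derivative (contract 2 p.divX)).eval (x₁ * x₂)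
      + 2 * (x₁ * x₂) * (derivative (derivative (contract 2 p.divX))).eval (x₁ * x₂))

/-- The part of `R` that is even in `y₁`. -/
noncomputable def R₀ (c one : ℂ) (p Pe Po : ℂ[X]) (x₁ x₂ y₂ : ℂ) : ℂ :=
  c / 4 * one * (p.eval x₁ * p.eval x₂) * (x₁ - x₂)⁻¹ ^ 4
  + c / 32 * one * ((derivative p).eval x₁ * (derivative p).eval x₂) * (x₁ - x₂)⁻¹ ^ 2
  + 1 / 8 * (p.eval x₁ * (Pe.eval x₂ + y₂ * Po.eval x₂) + p.eval x₂ * Pe.eval x₁)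
    * (x₁ - x₂)⁻¹ ^ 2
  + 1 / 8 * y₂ * (Po.eval x₁ * polar p x₁ x₂) * (x₁ - x₂)⁻¹ ^ 2

/-- The coefficient of `y₁` in the part of `R` that is odd in `y₁`. -/
noncomputable def R₁ (c one : ℂ) (p Pe Po : ℂ[X]) (x₁ x₂ y₂ : ℂ) : ℂ :=
  c / 4 * one * y₂ * polar p x₁ x₂ * (x₁ - x₂)⁻¹ ^ 4
  + c / 32 * one * y₂ * polarDeriv p x₁ x₂ * (x₁ - x₂)⁻¹ ^ 2
  + 1 / 8 * p.eval x₂ * Po.eval x₁ * (x₁ - x₂)⁻¹ ^ 2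
  + 1 / 8 * Po.eval x₂ * polar p x₁ x₂ * (x₁ - x₂)⁻¹ ^ 2
  + 1 / 4 * y₂ * polar Pe x₁ x₂ * (x₁ - x₂)⁻¹ ^ 2

theorem R_eq (c one : ℂ) (p Pe Po : ℂ[X]) (x₁ y₁ x₂ y₂ : ℂ) :
    R c one p Pe Po x₁ y₁ x₂ y₂ = R₀ c one p Pe Po x₁ x₂ y₂ + y₁ * R₁ c one p Pe Po x₁ x₂ y₂ := by
  simp only [R, R₀, R₁, polar, polarDeriv, evenPart, oddPart, evalSqrt_expand,
    evalSqrt_derivDivX_expand, evalSqrt_derivative_derivative_expand, div_eq_mul_inv, inv_pow]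
  ring

theorem R_symm (c one : ℂ) (p Pe Po : ℂ[X]) (x₁ y₁ x₂ y₂ : ℂ) :
    R c one p Pe Po x₁ y₁ x₂ y₂ = R c one p Pe Po x₂ y₂ x₁ y₁ := by
  have h : (x₂ - x₁)⁻¹ = -(x₁ - x₂)⁻¹ := by rw [← neg_sub x₁ x₂, inv_neg]
  rw [R_eq, R_eq, R₀, R₁, R₀, R₁, h]
  simp only [polar, polarDeriv, mul_comm x₂ x₁]
  ring

/-- The power sums obey `s (j+2) = (x² + b²) s (j+1) - (xb)² s j`, and `x² + b² = 2xb + (x - b)²`,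
so an expansion in powers of `(x - b)²` propagates. The odd case obeys the same recurrence. -/
theorem power_sum_even (b : ℂ) (j : ℕ) : ∃ V : ℂ → ℂ, Continuous V ∧ ∀ x,
    (x ^ (2 * j) + b ^ (2 * j)) / 2 = (x * b) ^ j
      + (x - b) ^ 2 / 2 * (j ^ 2 * (x * b) ^ (j - 1)) + (x - b) ^ 4 * V x := by
  induction j using Nat.twoStepInduction with
  | zero => exact ⟨0, continuous_zero, fun x => by simp⟩
  | one => exact ⟨0, continuous_zero, fun x => by simp; ring⟩
  | more j h0 h1 =>
    obtain ⟨V, hV, h0⟩ := h0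
    obtain ⟨W, hW, h1⟩ := h1
    refine ⟨fun x => 1 / 2 * (j + 1) ^ 2 * (x * b) ^ j + (x ^ 2 + b ^ 2) * W x
      - (x * b) ^ 2 * V x, by fun_prop, fun x => ?_⟩
    -- At `j = 0` the exponent is truncated, but the coefficient vanishes.
    have e : (j : ℂ) ^ 2 * (x * b) ^ (j - 1) * (x * b) = j ^ 2 * (x * b) ^ j := by
      rcases j with _ | j
      · simp
      · rw [Nat.add_sub_cancel]
        ring
    have h0 := h0 x
    have h1 := h1 x
    rw [Nat.add_sub_cancel] at h1
    rw [show j + 2 - 1 = j + 1 by omega]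
    push_cast at *
    linear_combination (x ^ 2 + b ^ 2) * h1 - (x * b) ^ 2 * h0 - (x - b) ^ 2 / 2 * (x * b) * e

theorem power_sum_odd (b : ℂ) (j : ℕ) : ∃ V : ℂ → ℂ, Continuous V ∧ ∀ x,
    (x ^ (2 * j + 1) + b ^ (2 * j + 1)) / 2 = (x + b) / 2 * ((x * b) ^ j
      + (x - b) ^ 2 / 2 * ((j ^ 2 + j) * (x * b) ^ (j - 1))) + (x - b) ^ 4 * V x := by
  induction j using Nat.twoStepInduction with
  | zero => exact ⟨0, continuous_zero, fun x => by simp⟩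
  | one => exact ⟨0, continuous_zero, fun x => by simp; ring⟩
  | more j h0 h1 =>
    obtain ⟨V, hV, h0⟩ := h0
    obtain ⟨W, hW, h1⟩ := h1
    refine ⟨fun x => (x + b) / 2 * (1 / 2 * (j + 1) * (j + 2) * (x * b) ^ j) + (x ^ 2 + b ^ 2) * W x
      - (x * b) ^ 2 * V x, by fun_prop, fun x => ?_⟩
    have e : ((j : ℂ) ^ 2 + j) * (x * b) ^ (j - 1) * (x * b) = (j ^ 2 + j) * (x * b) ^ j := by
      rcases j with _ | j
      · simp
      · rw [Nat.add_sub_cancel]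
        ring
    have h0 := h0 x
    have h1 := h1 x
    rw [Nat.add_sub_cancel] at h1
    rw [show j + 2 - 1 = j + 1 by omega]
    push_cast at *
    linear_combination (x ^ 2 + b ^ 2) * h1 - (x * b) ^ 2 * h0
      - (x + b) / 2 * ((x - b) ^ 2 / 2) * (x * b) * e

/-- By linearity from the power sums: on `w^j` the operator `4 d/dw + 4 w d²/dw²` gives `4 j²
w^(j-1)`. In the odd case `4 d/dw + 2 w d²/dw²` gives `2 (j² + j) w^(j-1)`. -/
theorem even_polar_expansion (b : ℂ) (a : ℂ[X]) : ∃ V : ℂ → ℂ, Continuous V ∧ ∀ x,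
    (a.eval (x ^ 2) + a.eval (b ^ 2)) / 2 = a.eval (x * b)
      + (x - b) ^ 2 / 8 * (4 * (derivative a).eval (x * b)
        + 4 * (x * b) * (derivative (derivative a)).eval (x * b)) + (x - b) ^ 4 * V x := by
  induction a using Polynomial.induction_on' with
  | add a a' h h' =>
    obtain ⟨V, hV, h⟩ := h
    obtain ⟨V', hV', h'⟩ := h'
    refine ⟨fun x => V x + V' x, hV.add hV', fun x => ?_⟩
    simp only [eval_add, derivative_add]
    linear_combination h x + h' x
  | monomial j k =>
    obtain ⟨V, hV, h⟩ := power_sum_even b j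
    refine ⟨fun x => k * V x, continuous_const.mul hV, fun x => ?_⟩
    have e : (j * (j - 1 : ℕ) : ℂ) * (x * b) ^ (j - 1 - 1) * (x * b)
        = (j ^ 2 - j) * (x * b) ^ (j - 1) := by
      rcases j with _ | _ | j
      · simp
      · simp
      · simp only [Nat.add_sub_cancel]
        push_cast
        ring
    have h := h x
    simp only [derivative_monomial, eval_monomial, ← pow_mul]
    linear_combination k * h + (x - b) ^ 2 / 2 * k * -e

theorem odd_polar_expansion (b : ℂ) (a : ℂ[X]) : ∃ V : ℂ → ℂ, Continuous V ∧ ∀ x,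
    (x * a.eval (x ^ 2) + b * a.eval (b ^ 2)) / 2 = 1 / 2 * (x + b) * a.eval (x * b)
      + (x - b) ^ 2 / 8 * ((x + b) * (4 * (derivative a).eval (x * b)
        + 2 * (x * b) * (derivative (derivative a)).eval (x * b))) + (x - b) ^ 4 * V x := by
  induction a using Polynomial.induction_on' with
  | add a a' h h' =>
    obtain ⟨V, hV, h⟩ := h
    obtain ⟨V', hV', h'⟩ := h'
    refine ⟨fun x => V x + V' x, hV.add hV', fun x => ?_⟩
    simp only [eval_add, derivative_add]
    linear_combination h x + h' x
  | monomial j k =>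
    obtain ⟨V, hV, h⟩ := power_sum_odd b j
    refine ⟨fun x => k * V x, continuous_const.mul hV, fun x => ?_⟩
    have e : (j * (j - 1 : ℕ) : ℂ) * (x * b) ^ (j - 1 - 1) * (x * b)
        = (j ^ 2 - j) * (x * b) ^ (j - 1) := by
      rcases j with _ | _ | j
      · simp
      · simp
      · simp only [Nat.add_sub_cancel]
        push_cast
        ring
    have h := h x
    simp only [derivative_monomial, eval_monomial, ← pow_mul]
    linear_combination k * h + (x - b) ^ 2 / 4 * (x + b) * k * -e

/-- This is why `R` contains these derivative terms: they raise the accuracy of `polar` as a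
substitute for the mean of `p x` and `p b` from second to fourth order, which the pole of order four
requires. -/
theorem polar_expansion (p : ℂ[X]) (b : ℂ) : ∃ V : ℂ → ℂ, Continuous V ∧ ∀ x,
    polar p x b + (x - b) ^ 2 / 8 * polarDeriv p x b =
      (p.eval x + p.eval b) / 2 + (x - b) ^ 4 * V x := by
  obtain ⟨V, hV, h⟩ := even_polar_expansion b (contract 2 p)
  obtain ⟨V', hV', h'⟩ := odd_polar_expansion b (contract 2 p.divX)
  refine ⟨fun x => -V x - V' x, hV.neg.sub hV', fun x => ?_⟩
  rw [eval_eq_contract p, eval_eq_contract p b, polar, polarDeriv]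
  linear_combination -h x - h' x

theorem polar_expansion_first (p : ℂ[X]) (b : ℂ) : ∃ W : ℂ → ℂ, Continuous W ∧ ∀ x,
    polar p x b = (p.eval x + p.eval b) / 2 + (x - b) ^ 2 * W x := by
  obtain ⟨V, hV, h⟩ := polar_expansion p b
  refine ⟨fun x => (x - b) ^ 2 * V x - polarDeriv p x b / 8, ?_, fun x => ?_⟩
  · have : Continuous fun x => polarDeriv p x b := by
      unfold polarDeriv
      fun_prop
    fun_prop
  · linear_combination h x

/-! ### The singular part -/

/-- `b` is the divided difference taken twice at `x₀`. The formula for `deriv f` expresses `p' =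
2yy'` through the same data. -/
theorem exists_second_order_expansion {f : ℂ → ℂ} {x₀ : ℂ} (hf : AnalyticAt ℂ f x₀) :
    ∃ (a : ℂ) (b : ℂ → ℂ), AnalyticAt ℂ b x₀ ∧
      (∀ x, f x = f x₀ + (x - x₀) * a + (x - x₀) ^ 2 * b x) ∧ deriv f x₀ = a ∧
      ∀ᶠ x in 𝓝 x₀, deriv f x = a + 2 * (x - x₀) * b x + (x - x₀) ^ 2 * deriv b x := by
  have hd : ∀ {f : ℂ → ℂ}, AnalyticAt ℂ f x₀ → AnalyticAt ℂ (dslope f x₀) x₀ := by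
    rintro f ⟨q, hq⟩
    exact ⟨_, hq.has_fpower_series_dslope_fslope⟩
  have key : ∀ x, f x = f x₀ + (x - x₀) * deriv f x₀
      + (x - x₀) ^ 2 * dslope (dslope f x₀) x₀ x := by
    intro x
    have h1 := sub_smul_dslope f x₀ x
    have h2 := sub_smul_dslope (dslope f x₀) x₀ x
    rw [dslope_same f] at h2
    simp only [smul_eq_mul] at h1 h2
    linear_combination -h1 - (x - x₀) * h2
  refine ⟨deriv f x₀, dslope (dslope f x₀) x₀, hd (hd hf), key, rfl, ?_⟩
  filter_upwards [(hd (hd hf)).eventually_analyticAt] with x hx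
  have hid : HasDerivAt (fun x => x - x₀) 1 x := (hasDerivAt_id x).sub_const x₀
  have := ((hid.mul_const (deriv f x₀)).const_add (f x₀)).add
    ((hid.pow 2).mul hx.differentiableAt.hasDerivAt)
  refine (this.congr_of_eventuallyEq (Eventually.of_forall key)).deriv.trans ?_
  simp
  ring

theorem exists_eval_eq_add (q : ℂ[X]) (b : ℂ) : ∃ e : ℂ[X], ∀ x,
    q.eval x = q.eval b + (x - b) * e.eval x := by
  obtain ⟨e, he⟩ := X_sub_C_dvd_sub_C_eval (p := q) (a := b)
  refine ⟨e, fun x => ?_⟩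
  have := congrArg (fun f => f.eval x) he
  simp only [eval_sub, eval_C, eval_mul, eval_X] at this
  linear_combination this

/-- The form of `R` obtained from the expansion of the polar forms, with `h = x₁ - x₂`. -/
theorem R_expansion {c one : ℂ} {p Pe Po : ℂ[X]} {x₁ y₁ x₂ y₂ V W W' : ℂ} (hx : x₁ - x₂ ≠ 0)
    (hV : polar p x₁ x₂ + (x₁ - x₂) ^ 2 / 8 * polarDeriv p x₁ x₂ =
      (p.eval x₁ + p.eval x₂) / 2 + (x₁ - x₂) ^ 4 * V)
    (hW : polar p x₁ x₂ = (p.eval x₁ + p.eval x₂) / 2 + (x₁ - x₂) ^ 2 * W)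
    (hW' : polar Pe x₁ x₂ = (Pe.eval x₁ + Pe.eval x₂) / 2 + (x₁ - x₂) ^ 2 * W')
    (h1 : y₁ ^ 2 = p.eval x₁) (h2 : y₂ ^ 2 = p.eval x₂) :
    R c one p Pe Po x₁ y₁ x₂ y₂ =
      c / 8 * one * (y₁ * y₂ * (y₁ + y₂) ^ 2 / (x₁ - x₂) ^ 4)
      + c / 32 * one * ((derivative p).eval x₁ * (derivative p).eval x₂ / (x₁ - x₂) ^ 2)
      + 1 / 8 * (y₁ + y₂) * (y₁ * Pe.eval x₂ + y₂ * Pe.eval x₁) / (x₁ - x₂) ^ 2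
      + 1 / 16 * (y₁ + y₂) ^ 2 * (y₁ * Po.eval x₂ + y₂ * Po.eval x₁) / (x₁ - x₂) ^ 2
      + (c / 4 * one * y₁ * y₂ * V + 1 / 8 * (y₁ * Po.eval x₂ + y₂ * Po.eval x₁) * W
        + 1 / 4 * y₁ * y₂ * W') := by
  -- Solving `hV` for `polarDeriv` leaves the mean of `p` over `h⁴`. The fourth-order terms then
  -- combine by `y₁²y₂² + y₁y₂(y₁² + y₂²)/2 = y₁y₂(y₁ + y₂)²/2`.
  have hBD : polarDeriv p x₁ x₂ = 8 * (x₁ - x₂)⁻¹ ^ 2 *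
      ((p.eval x₁ + p.eval x₂) / 2 + (x₁ - x₂) ^ 4 * V - polar p x₁ x₂) := by
    rw [← hV]
    field_simp
    ring
  rw [R_eq, R₀, R₁, hBD, hW, hW', ← h1, ← h2]
  field_simp
  ring

/-- Here `y₁ + y₂ = -h(a + hb)`. The remaining terms in `c` cancel to second order since `(a + hb)²
- a(a + 2hb + h²b') = h²(b² - ab')`. In the term with `Pe` both factors are divisible by `h`. -/
theorem singular_part_opposite_sheet {c one h a b b' y Pe Po e Po₁ f : ℂ} (hh : h ≠ 0)
    (hf : f = y + h * a + h ^ 2 * b) :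
    c / 8 * one * (-f * y * (-f + y) ^ 2 / h ^ 4)
      + c / 32 * one * (2 * f * (a + 2 * h * b + h ^ 2 * b') * (2 * y * a) / h ^ 2)
      + 1 / 8 * (-f + y) * (-f * Pe + y * (Pe + h * e)) / h ^ 2
      + 1 / 16 * (-f + y) ^ 2 * (-f * Po + y * Po₁) / h ^ 2 =
    c / 8 * one * f * y * (a * b' - b ^ 2) - 1 / 8 * (a + h * b) * (y * e - (a + h * b) * Pe)
      + 1 / 16 * (a + h * b) ^ 2 * (-f * Po + y * Po₁) := by
  subst hf
  field_simp
  ring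

/-- The fourth-order terms leave `(c/2) f²y² - (c/8) f y (f + y)² = -(c/8) f y (f - y)²`. Together
with the second-order ones this is `(c/8) [(f'y - af)² + f y (af' - (a + hb)²)] / h²` times `⟨1⟩`,
and the bracket is `O(h²)`. -/
theorem singular_part_same_sheet {c one h a b b' y Pe Po e Po₁ f f' : ℂ} (hh : h ≠ 0)
    (hf : f = y + h * a + h ^ 2 * b) (hf' : f' = a + 2 * h * b + h ^ 2 * b') (hf0 : f ≠ 0)
    (hy0 : y ≠ 0) :
    f ^ 2 * y ^ 2 * (c / 2 / h ^ 4 * one + 1 / h ^ 2 *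
      ((c / 32 * ((2 * f * f') ^ 2 / f ^ 2) * one + 1 / 4 * ((Pe + h * e) + f * Po₁)) / f ^ 2
        + (c / 32 * ((2 * y * a) ^ 2 / y ^ 2) * one + 1 / 4 * (Pe + y * Po)) / y ^ 2))
    - (c / 8 * one * (f * y * (f + y) ^ 2 / h ^ 4)
      + c / 32 * one * (2 * f * f' * (2 * y * a) / h ^ 2)
      + 1 / 8 * (f + y) * (f * Pe + y * (Pe + h * e)) / h ^ 2
      + 1 / 16 * (f + y) ^ 2 * (f * Po + y * Po₁) / h ^ 2) =
    c / 8 * one * (2 * b * y + h * b' * y - a ^ 2 - h * a * b) ^ 2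
      - c / 8 * one * f * y * (b ^ 2 - a * b') - 1 / 8 * (a + h * b) * (y * e - (a + h * b) * Pe)
      - 1 / 16 * (a + h * b) ^ 2 * (f * Po + y * Po₁) := by
  have e1 : f ^ 2 * y ^ 2 * (c / 2 / h ^ 4 * one + 1 / h ^ 2 *
      ((c / 32 * ((2 * f * f') ^ 2 / f ^ 2) * one + 1 / 4 * ((Pe + h * e) + f * Po₁)) / f ^ 2
        + (c / 32 * ((2 * y * a) ^ 2 / y ^ 2) * one + 1 / 4 * (Pe + y * Po)) / y ^ 2)) =
      c / 2 * one * (f * y) ^ 2 / h ^ 4 + (c / 8 * one * (f' ^ 2 * y ^ 2 + a ^ 2 * f ^ 2)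
        + 1 / 4 * (y ^ 2 * (Pe + h * e + f * Po₁) + f ^ 2 * (Pe + y * Po))) / h ^ 2 := by
    field_simp
    ring
  rw [e1]
  subst hf hf'
  field_simp
  ring

theorem exists_bound_R_opposite_sheet (c one : ℂ) (p Pe Po : ℂ[X]) {x₂ y₂ : ℂ} (h0 : y₂ ≠ 0)
    (h : y₂ ^ 2 = p.eval x₂) :
    ∃ B : ℝ, ∀ᶠ x in 𝓝[≠] x₂, ‖R c one p Pe Po x (-sqrtBranch p y₂ x) x₂ y₂‖ ≤ B := by
  have hf := analyticAt_sqrtBranch h0 h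
  have hself := sqrtBranch_self h0 h
  obtain ⟨a, b, hb, hfb, hda, hdb⟩ := exists_second_order_expansion hf
  obtain ⟨e, he⟩ := exists_eval_eq_add Pe x₂
  obtain ⟨V, hV, hVe⟩ := polar_expansion p x₂
  obtain ⟨W, hW, hWe⟩ := polar_expansion_first p x₂
  obtain ⟨W', hW', hWe'⟩ := polar_expansion_first Pe x₂
  have hQ : ∀ x, (fun t => sqrtBranch p y₂ t ^ 2) =ᶠ[𝓝 x] fun t => p.eval t := fun x =>
    Eventually.of_forall fun t => sqrtBranch_sq p h0 t
  have hd2 := deriv_sqrt hf (hQ x₂)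
  rw [Polynomial.deriv, hself, hda] at hd2
  rw [hself] at hfb
  have k1 := hf.continuousAt
  have k2 := hb.continuousAt
  have k3 := hb.deriv.continuousAt
  obtain ⟨B, hB⟩ := exists_bound_of_continuousAt (x := x₂) (f := fun x =>
      c / 8 * one * sqrtBranch p y₂ x * y₂ * (a * deriv b x - b x ^ 2)
      - 1 / 8 * (a + (x - x₂) * b x) * (y₂ * e.eval x - (a + (x - x₂) * b x) * Pe.eval x₂)
      + 1 / 16 * (a + (x - x₂) * b x) ^ 2 * (-sqrtBranch p y₂ x * Po.eval x₂ + y₂ * Po.eval x)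
      + (c / 4 * one * -sqrtBranch p y₂ x * y₂ * V x
        + 1 / 8 * (-sqrtBranch p y₂ x * Po.eval x₂ + y₂ * Po.eval x) * W x
        + 1 / 4 * -sqrtBranch p y₂ x * y₂ * W' x)) (by
    have k4 := hV.continuousAt (x := x₂)
    have k5 := hW.continuousAt (x := x₂)
    have k6 := hW'.continuousAt (x := x₂)
    have k7 := e.continuous.continuousAt (x := x₂)
    have k8 := Po.continuous.continuousAt (x := x₂)
    fun_prop)
  refine ⟨B, ?_⟩
  filter_upwards [nhdsWithin_le_nhds hB, nhdsWithin_le_nhds hf.eventually_analyticAt,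
    nhdsWithin_le_nhds hdb, self_mem_nhdsWithin] with x hx hfx hdx hne
  have hne : x - x₂ ≠ 0 := sub_ne_zero.2 hne
  have hd1 := deriv_sqrt hfx (hQ x)
  rw [Polynomial.deriv, hdx] at hd1
  rw [R_expansion hne (hVe x) (hWe x) (hWe' x) (by rw [neg_sq]; exact sqrtBranch_sq p h0 x) h,
    hd1, hd2, he x, singular_part_opposite_sheet hne (hfb x)]
  exact hx

namespace VirasoroState

variable {p : ℂ[X]} {g : ℕ} {c : ℂ} (S : VirasoroState p g c)

theorem admissible_xPatch_pair {x₁ y₁ x₂ y₂ : ℂ} (h1 : y₁ ≠ 0) (h2 : y₂ ≠ 0)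
    (hy1 : y₁ ^ 2 = p.eval x₁) (hy2 : y₂ ^ 2 = p.eval x₂) (hne : ¬ (x₁ = x₂ ∧ y₁ = y₂)) :
    Admissible {(xPatch p g y₁, x₁), (xPatch p g y₂, x₂)} :=
  admissible_pair (xPatch_mem g h1 hy1) (xPatch_mem g h2 hy2) (by
    rw [(xPatch_spec p g h1 hy1).2, (xPatch_spec p g h2 hy2).2]
    exact fun h => hne ⟨(Pt.fin.inj h).1, (Pt.fin.inj h).2⟩)

theorem analyticAt_conn {x₀ y₀ x₂ y₂ : ℂ} (h0 : y₀ ≠ 0) (h2 : y₂ ≠ 0)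
    (hy0 : y₀ ^ 2 = p.eval x₀) (hy2 : y₂ ^ 2 = p.eval x₂) (hne : ¬ (x₀ = x₂ ∧ y₀ = y₂)) :
    AnalyticAt ℂ (fun x => S.conn (xPatch p g (sqrtBranch p y₀ x), x) (xPatch p g y₂, x₂)) x₀ :=
  (S.analyticAt_corr_xPatch h0 hy0 (admissible_xPatch_pair h0 h2 hy0 hy2 hne)).sub
    ((analyticAt_const.mul (S.analyticAt_T₁ h0 hy0)).mul analyticAt_const)

/-- The OPE holds in the patch fixed at `y₂`; `corr_xPatch_sqrtBranch` carries it to the patch of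
the moving point, and `hP` expresses `⟨T⟩` in it by `Pe` and `Po`. The disconnected term is
holomorphic and does no harm. -/
theorem exists_bound_conn_sub_R (Pe Po : ℂ[X])
    (hP : ∀ x y : ℂ, y ≠ 0 → y ^ 2 = p.eval x → p.eval x * S.T₁ x y =
      c / 32 * ((derivative p).eval x ^ 2 / p.eval x) * S.one + 1 / 4 * (Pe.eval x + y * Po.eval x))
    {x₂ y₂ : ℂ} (h0 : y₂ ≠ 0) (h : y₂ ^ 2 = p.eval x₂) :
    ∃ B : ℝ, ∀ᶠ x in 𝓝[≠] x₂,
      ‖S.conn (xPatch p g (sqrtBranch p y₂ x), x) (xPatch p g y₂, x₂) * p.eval x * p.eval x₂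
        - R c S.one p Pe Po x (sqrtBranch p y₂ x) x₂ y₂‖ ≤ B := by
  have hf := analyticAt_sqrtBranch h0 h
  have hself := sqrtBranch_self h0 h
  obtain ⟨a, b, hb, hfb, hda, hdb⟩ := exists_second_order_expansion hf
  obtain ⟨e, he⟩ := exists_eval_eq_add Pe x₂
  obtain ⟨V, hV, hVe⟩ := polar_expansion p x₂
  obtain ⟨W, hW, hWe⟩ := polar_expansion_first p x₂
  obtain ⟨W', hW', hWe'⟩ := polar_expansion_first Pe x₂
  obtain ⟨F, hF, hope⟩ := S.ope (xPatch p g y₂) x₂ 0 (admissible_single (xPatch_mem g h0 h))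
  have hQ : ∀ x, (fun t => sqrtBranch p y₂ t ^ 2) =ᶠ[𝓝 x] fun t => p.eval t := fun x =>
    Eventually.of_forall fun t => sqrtBranch_sq p h0 t
  have hd2 := deriv_sqrt hf (hQ x₂)
  rw [Polynomial.deriv, hself, hda] at hd2
  rw [hself] at hfb
  have hp2 : p.eval x₂ ≠ 0 := h ▸ pow_ne_zero 2 h0
  have hT := S.analyticAt_T₁ h0 h
  obtain ⟨B, hB⟩ := exists_bound_of_continuousAt (x := x₂) (f := fun x =>
      (c / 8 * S.one * (2 * b x * y₂ + (x - x₂) * deriv b x * y₂ - a ^ 2 - (x - x₂) * a * b x) ^ 2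
      - c / 8 * S.one * sqrtBranch p y₂ x * y₂ * (b x ^ 2 - a * deriv b x)
      - 1 / 8 * (a + (x - x₂) * b x) * (y₂ * e.eval x - (a + (x - x₂) * b x) * Pe.eval x₂)
      - 1 / 16 * (a + (x - x₂) * b x) ^ 2 * (sqrtBranch p y₂ x * Po.eval x₂ + y₂ * Po.eval x))
      - (c / 4 * S.one * sqrtBranch p y₂ x * y₂ * V x
        + 1 / 8 * (sqrtBranch p y₂ x * Po.eval x₂ + y₂ * Po.eval x) * W x
        + 1 / 4 * sqrtBranch p y₂ x * y₂ * W' x)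
      + p.eval x * p.eval x₂ * F x
      - S.one⁻¹ * S.T₁ x (sqrtBranch p y₂ x) * S.T₁ x₂ y₂ * p.eval x * p.eval x₂) (by
    have k1 := hf.continuousAt
    have k2 := hb.continuousAt
    have k3 := hb.deriv.continuousAt
    have k4 := hV.continuousAt (x := x₂)
    have k5 := hW.continuousAt (x := x₂)
    have k6 := hW'.continuousAt (x := x₂)
    have k7 := e.continuous.continuousAt (x := x₂)
    have k8 := Po.continuous.continuousAt (x := x₂)
    have k9 := p.continuous.continuousAt (x := x₂)
    have k10 := hF.continuousAt
    have k11 := hT.continuousAt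
    fun_prop)
  refine ⟨B, ?_⟩
  filter_upwards [nhdsWithin_le_nhds hB, nhdsWithin_le_nhds hf.eventually_analyticAt,
    nhdsWithin_le_nhds hdb, self_mem_nhdsWithin, hope,
    nhdsWithin_le_nhds ((xPatch p g y₂).isOpen_dom.mem_nhds (xPatch_mem g h0 h)),
    nhdsWithin_le_nhds (p.continuous.continuousAt.eventually_ne hp2)]
    with x hx hfx hdx hne hopex hdom hpx
  have hne' : x - x₂ ≠ 0 := sub_ne_zero.2 hne
  have hd1 := deriv_sqrt hfx (hQ x)
  rw [Polynomial.deriv] at hd1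
  set y := sqrtBranch p y₂ x with hy
  have hy0 : y ≠ 0 := sqrtBranch_ne_zero h0 hpx
  have hyx : y ^ 2 = p.eval x := sqrtBranch_sq p h0 x
  have hadm : Admissible {(xPatch p g y₂, x), (xPatch p g y₂, x₂)} :=
    admissible_pair hdom (xPatch_mem g h0 h) (fun h => hne ((Pt.fin.inj h).1))
  have c1 : S.corr {(xPatch p g y, x), (xPatch p g y₂, x₂)} =
      S.corr {(xPatch p g y₂, x), (xPatch p g y₂, x₂)} := S.corr_xPatch_sqrtBranch hadm h0 hpx
  have c2 : S.T₁ x y = S.corr {(xPatch p g y₂, x)} :=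
    S.corr_xPatch_sqrtBranch (admissible_single hdom) h0 hpx
  have c3 : S.corr {(xPatch p g y₂, x), (xPatch p g y₂, x₂)} = c / 2 / (x - x₂) ^ 4 * S.one
      + 1 / (x - x₂) ^ 2 * (S.T₁ x y + S.T₁ x₂ y₂) + F x := by
    rw [c2]
    exact hopex
  have t1 := hP x y hy0 hyx
  have t2 := hP x₂ y₂ h0 h
  have t1' : S.T₁ x y = (c / 32 * ((derivative p).eval x ^ 2 / p.eval x) * S.one
      + 1 / 4 * (Pe.eval x + y * Po.eval x)) / p.eval x := by
    rw [← t1, mul_div_cancel_left₀ _ hpx]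
  have t2' : S.T₁ x₂ y₂ = (c / 32 * ((derivative p).eval x₂ ^ 2 / p.eval x₂) * S.one
      + 1 / 4 * (Pe.eval x₂ + y₂ * Po.eval x₂)) / p.eval x₂ := by
    rw [← t2, mul_div_cancel_left₀ _ hp2]
  have key := singular_part_same_sheet (c := c) (one := S.one) (Pe := Pe.eval x₂)
    (Po := Po.eval x₂) (e := e.eval x) (Po₁ := Po.eval x) hne' (hfb x) hdx hy0 h0
  have main : S.conn (xPatch p g y, x) (xPatch p g y₂, x₂) =
      c / 2 / (x - x₂) ^ 4 * S.one
      + 1 / (x - x₂) ^ 2 * (S.T₁ x y + S.T₁ x₂ y₂) + F x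
        - S.one⁻¹ * S.T₁ x y * S.T₁ x₂ y₂ := by
    rw [conn, c1, c3]
    rfl
  rw [← hy, ← hd1, ← hd2, hyx, h, ← he x, ← t1', ← t2'] at key
  rw [← key] at hx
  rw [R_expansion hne' (hVe x) (hWe x) (hWe' x) hyx h, main]
  refine le_of_eq_of_le (congrArg _ ?_) hx
  ring

end VirasoroState

/-! ### Orders of growth at infinity -/

/-- `f` is `O(x ^ k)` at infinity. -/
def GrowthLE (f : ℂ → ℂ) (k : ℤ) : Prop := f =O[Bornology.cobounded ℂ] fun x => x ^ k

namespace GrowthLE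

variable {f h : ℂ → ℂ} {k l : ℤ}

theorem add (hf : GrowthLE f k) (hh : GrowthLE h k) : GrowthLE (fun x => f x + h x) k :=
  Asymptotics.IsBigO.add hf hh

theorem sub (hf : GrowthLE f k) (hh : GrowthLE h k) : GrowthLE (fun x => f x - h x) k :=
  Asymptotics.IsBigO.sub hf hh

theorem congr (hf : GrowthLE f k) (he : ∀ᶠ x in Bornology.cobounded ℂ, h x = f x) :
    GrowthLE h k :=
  (Asymptotics.isBigO_congr he EventuallyEq.rfl).2 hf

theorem mono (hf : GrowthLE f k) (hkl : k ≤ l) : GrowthLE f l := by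
  refine hf.trans (Asymptotics.IsBigO.of_bound 1 ?_)
  filter_upwards [eventually_cobounded_le_norm (E := ℂ) 1] with x hx
  rw [norm_zpow, norm_zpow, one_mul]
  exact zpow_le_zpow_right₀ hx hkl

theorem mul' (hf : GrowthLE f k) (hh : GrowthLE h l) : GrowthLE (fun x => f x * h x) (k + l) := by
  refine (Asymptotics.IsBigO.mul hf hh).trans_eventuallyEq ?_
  filter_upwards [eventually_ne_zero_cobounded] with x hx
  rw [zpow_add₀ hx]

theorem mul {m : ℤ} (hf : GrowthLE f k) (hh : GrowthLE h l) (hm : k + l ≤ m) :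
    GrowthLE (fun x => f x * h x) m := (hf.mul' hh).mono hm

theorem const_mul (a : ℂ) (hf : GrowthLE f k) : GrowthLE (fun x => a * f x) k :=
  Asymptotics.IsBigO.const_mul_left hf a

theorem mul_const (a : ℂ) (hf : GrowthLE f k) : GrowthLE (fun x => f x * a) k := by
  simpa only [mul_comm] using hf.const_mul a

theorem pow (n : ℕ) : GrowthLE (fun x => x ^ n) n := by
  simp only [GrowthLE, zpow_natCast]
  exact Asymptotics.isBigO_refl _ _

theorem id : GrowthLE (fun x => x) 1 := by
  simpa using pow 1

theorem inv : GrowthLE (fun x => x⁻¹) (-1) := by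
  simp only [GrowthLE, zpow_neg_one]
  exact Asymptotics.isBigO_refl _ _

theorem const (a : ℂ) : GrowthLE (fun _ => a) 0 := by
  simp only [GrowthLE, zpow_zero]
  exact Asymptotics.isBigO_const_const _ one_ne_zero _

theorem eval_natDegree {q : ℂ[X]} {n : ℕ} (hq : q.natDegree ≤ n) :
    GrowthLE (fun x => q.eval x) n := by
  obtain ⟨B, hB⟩ := exists_bound_eval_cobounded q hq
  refine Asymptotics.IsBigO.of_bound B ?_
  filter_upwards [hB] with x hx
  simpa using hx

theorem eval_degree {q : ℂ[X]} {n : ℕ} (hq : q.degree < n) :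
    GrowthLE (fun x => q.eval x) (n - 1) := by
  rcases eq_or_ne q 0 with rfl | h0
  · simp only [eval_zero]
    exact Asymptotics.isBigO_zero _ _
  · have := (natDegree_lt_iff_degree_lt h0).2 hq
    exact (eval_natDegree (Nat.le_pred_of_lt this)).mono (by simp; omega)

theorem eval_mul_degree {q : ℂ[X]} {n : ℕ} (hq : q.degree < n) (b : ℂ) :
    GrowthLE (fun x => q.eval (x * b)) (n - 1) := by
  have h : ∀ x, q.eval (x * b) = (q.comp (X * C b)).eval x := fun x => by
    rw [eval_comp, eval_mul, eval_X, eval_C]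
  simp only [h]
  refine eval_degree ?_
  rcases eq_or_ne q 0 with rfl | h0
  · simp
  · have h1 := (natDegree_lt_iff_degree_lt h0).2 hq
    refine (degree_le_natDegree).trans_lt ?_
    refine Nat.cast_lt.2 (lt_of_le_of_lt ?_ h1)
    refine natDegree_comp_le.trans ?_
    exact (Nat.mul_le_mul_left _ (natDegree_mul_C_le _ _)).trans (by rw [natDegree_X, mul_one])

theorem eval_mul_natDegree {q : ℂ[X]} {n : ℕ} (hq : q.natDegree ≤ n) (b : ℂ) :
    GrowthLE (fun x => q.eval (x * b)) n := by
  have : q.degree < (n + 1 : ℕ) := degree_le_natDegree.trans_lt (by exact_mod_cast Nat.lt_succ_of_le hq)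
  exact (eval_mul_degree this b).mono (by simp)

theorem inv_sub (b : ℂ) : GrowthLE (fun x => (x - b)⁻¹) (-1) := by
  refine Asymptotics.IsBigO.of_bound 2 ?_
  filter_upwards [eventually_cobounded_le_norm (E := ℂ) (2 * ‖b‖), eventually_ne_zero_cobounded]
    with x hx h0
  have h1 : 0 < ‖x‖ := norm_pos_iff.2 h0
  have h2 : ‖x‖ / 2 ≤ ‖x - b‖ := by
    have := norm_sub_norm_le x b
    linarith
  rw [zpow_neg_one, norm_inv, norm_inv, inv_le_comm₀ (by linarith) (by positivity), mul_inv,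
    inv_inv]
  linarith

theorem inv_sub_sq (b : ℂ) : GrowthLE (fun x => (x - b)⁻¹ ^ 2) (-2) := by
  simp only [sq]
  exact (inv_sub b).mul (inv_sub b) (by norm_num)

theorem inv_sub_pow_four (b : ℂ) : GrowthLE (fun x => (x - b)⁻¹ ^ 4) (-4) := by
  refine ((inv_sub_sq b).mul (inv_sub_sq b) le_rfl).congr (Eventually.of_forall fun x => ?_)
  ring

theorem inv_sub_sq_sub (b : ℂ) : GrowthLE (fun x => (x - b)⁻¹ ^ 2 - x⁻¹ ^ 2) (-3) := by
  refine ((((inv_sub b).mul inv le_rfl).mul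
    ((inv_sub b).add inv) le_rfl).const_mul b).congr ?_
  filter_upwards [eventually_ne_zero_cobounded, eventually_cobounded_le_norm (E := ℂ) (‖b‖ + 1)]
    with x hx hb
  have : x - b ≠ 0 := by
    intro h
    rw [sub_eq_zero.1 h] at hb
    linarith
  field_simp
  ring

/-- Two terms of `(x - b)⁻² = x⁻² + 2b x⁻³ + …` are needed because `polar` may grow like `x^(g+1)`
and the error allowed is `x^(g-3)`. -/
theorem inv_sub_sq_sub_sub (b : ℂ) :
    GrowthLE (fun x => (x - b)⁻¹ ^ 2 - x⁻¹ ^ 2 - 2 * b * x⁻¹ ^ 3) (-4) := by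
  have hi : GrowthLE (fun x => x⁻¹ * x⁻¹) (-2) := inv.mul inv (by norm_num)
  refine (((hi.mul ((inv_sub b).mul (inv_sub b) (by norm_num : _ ≤ (-2 : ℤ))) (by norm_num)).const_mul
    (3 * b ^ 2)).sub ((((hi.mul inv (by norm_num : _ ≤ (-3 : ℤ))).mul
      ((inv_sub b).mul (inv_sub b) (by norm_num : _ ≤ (-2 : ℤ)))
      (by norm_num : _ ≤ (-4 : ℤ))).const_mul (2 * b ^ 3)))).congr ?_
  filter_upwards [eventually_ne_zero_cobounded, eventually_cobounded_le_norm (E := ℂ) (‖b‖ + 1)]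
    with x hx hb
  have : x - b ≠ 0 := by
    intro h
    rw [sub_eq_zero.1 h] at hb
    linarith
  field_simp
  ring

theorem exists_bound {n : ℕ} (hf : GrowthLE f n) :
    ∃ B : ℝ, 0 ≤ B ∧ ∀ᶠ x in Bornology.cobounded ℂ, ‖f x‖ ≤ B * ‖x‖ ^ n := by
  obtain ⟨B, hB, h⟩ := Asymptotics.IsBigO.exists_nonneg hf
  refine ⟨B, hB, ?_⟩
  filter_upwards [h.bound] with x hx
  simpa using hx

end GrowthLE

theorem natDegree_contract_two_le (p : ℂ[X]) : 2 * (contract 2 p).natDegree ≤ p.natDegree := by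
  by_contra! h
  have h0 : (contract 2 p).coeff (contract 2 p).natDegree = 0 := by
    rw [coeff_contract two_ne_zero]
    exact coeff_eq_zero_of_natDegree_lt (by omega)
  rw [coeff_natDegree, leadingCoeff_eq_zero] at h0
  rw [h0] at h
  simp at h

theorem natDegree_contract_divX_le (p : ℂ[X]) :
    2 * (contract 2 p.divX).natDegree ≤ p.natDegree - 1 := by
  have := natDegree_contract_two_le p.divX
  rwa [natDegree_divX_eq_natDegree_tsub_one] at this

theorem growthLE_polar {p : ℂ[X]} {n : ℕ} (hn : p.natDegree ≤ 2 * n + 1) (b : ℂ) :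
    GrowthLE (fun x => polar p x b) (n + 1) := by
  have h1 := natDegree_contract_two_le p
  have h2 := natDegree_contract_divX_le p
  refine GrowthLE.add ((GrowthLE.eval_mul_natDegree (n := n) (by omega) b).mono (by omega)) ?_
  refine GrowthLE.mul (k := 1) (((GrowthLE.id).add ((GrowthLE.const b).mono (by norm_num))).const_mul _)
    (GrowthLE.eval_mul_natDegree (n := n) (by omega) b) (by omega)

theorem growthLE_polarDeriv {p : ℂ[X]} {n : ℕ} (hn : p.natDegree ≤ n) (b : ℂ) :
    GrowthLE (fun x => polarDeriv p x b) (n + 2) := by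
  have h1 := natDegree_contract_two_le p
  have h2 := natDegree_contract_divX_le p
  have d : ∀ {q : ℂ[X]}, q.natDegree ≤ n → (derivative q).natDegree ≤ n := fun {q} h =>
    (natDegree_derivative_le q).trans (by omega)
  have hx : GrowthLE (fun x => x * b) 1 := GrowthLE.id.mul_const b
  have hs : GrowthLE (fun x => x + b) 1 := GrowthLE.id.add ((GrowthLE.const b).mono (by norm_num))
  have k1 : (contract 2 p).natDegree ≤ n := by omega
  have k2 : (contract 2 p.divX).natDegree ≤ n := by omega
  have e : ∀ {q : ℂ[X]}, q.natDegree ≤ n → GrowthLE (fun x => q.eval (x * b)) n := fun h =>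
    GrowthLE.eval_mul_natDegree h b
  refine GrowthLE.add (GrowthLE.add ?_ ?_) ?_
  · exact ((e (d k1)).const_mul _).mono (by omega)
  · exact (hx.const_mul 4).mul (e (d (d k1))) (by omega)
  · refine hs.mul (l := n + 1) (GrowthLE.add ?_ ?_) (by omega)
    · exact ((e (d k2)).const_mul _).mono (by omega)
    · exact (hx.const_mul 2).mul (e (d (d k2))) (by omega)

/-- A crude bound, used only to see that the remainder is polynomial at all. -/
theorem growthLE_R₀ (c one : ℂ) {p Pe Po : ℂ[X]} {n : ℕ} (hp : p.natDegree ≤ n)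
    (hPe : Pe.natDegree ≤ n) (hPo : Po.natDegree ≤ n) (b y : ℂ) :
    GrowthLE (fun x => R₀ c one p Pe Po x b y) (2 * n + 2) := by
  have u2 := GrowthLE.inv_sub_sq b
  have u4 := GrowthLE.inv_sub_pow_four b
  have ep := GrowthLE.eval_natDegree hp
  have ed := GrowthLE.eval_natDegree ((natDegree_derivative_le p).trans (by omega : _ ≤ n))
  refine GrowthLE.add (GrowthLE.add (GrowthLE.add ?_ ?_) ?_) ?_
  · exact ((ep.mul_const _).const_mul _).mul u4 (by omega)
  · exact ((ed.mul_const _).const_mul _).mul u2 (by omega)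
  · exact ((((ep.mul_const _)).add ((GrowthLE.eval_natDegree hPe).const_mul _)).const_mul _).mul u2
      (by omega)
  · exact (((GrowthLE.eval_natDegree hPo).mul (growthLE_polar (n := n) (by omega) b) le_rfl).const_mul
      _).mul u2 (by omega)

theorem growthLE_R₁ (c one : ℂ) {p Pe Po : ℂ[X]} {n : ℕ} (hp : p.natDegree ≤ n)
    (hPe : Pe.natDegree ≤ n) (hPo : Po.natDegree ≤ n) (b y : ℂ) :
    GrowthLE (fun x => R₁ c one p Pe Po x b y) (2 * n + 2) := by
  have u2 := GrowthLE.inv_sub_sq b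
  have u4 := GrowthLE.inv_sub_pow_four b
  have ea := growthLE_polar (p := p) (n := n) (by omega) b
  refine GrowthLE.add (GrowthLE.add (GrowthLE.add (GrowthLE.add ?_ ?_) ?_) ?_) ?_
  · exact (ea.const_mul _).mul u4 (by omega)
  · exact ((growthLE_polarDeriv hp b).const_mul _).mul u2 (by omega)
  · exact ((GrowthLE.eval_natDegree hPo).const_mul _).mul u2 (by omega)
  · exact (ea.const_mul _).mul u2 (by omega)
  · exact ((growthLE_polar (p := Pe) (n := n) (by omega) b).const_mul _).mul u2 (by omega)

/-- `y = O(x^n)` because `deg p ≤ 2n`. In degree `2g + 1` it is used with `n = g + 1`; the half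
order lost still fits `(g + 1) + (g - 3) = 2g - 2`. -/
theorem exists_bound_of_growth_even_odd {p : ℂ[X]} {n m : ℕ} {k : ℤ} (hp : p.natDegree ≤ 2 * n)
    {f h : ℂ → ℂ} (hf : GrowthLE f m) (hh : GrowthLE h k) (hk : n + k ≤ m) :
    ∃ B : ℝ, ∀ᶠ x in Bornology.cobounded ℂ, ∀ y, y ^ 2 = p.eval x →
      ‖f x + y * h x‖ ≤ B * ‖x‖ ^ m := by
  choose r hr using exists_sq_eq_eval p
  have hrg : GrowthLE r n := by
    obtain ⟨B, hB⟩ := exists_bound_eval_cobounded p hp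
    refine Asymptotics.IsBigO.of_bound (√B) ?_
    filter_upwards [hB] with x hx
    rw [zpow_natCast, norm_pow, ← Real.sqrt_sq (norm_nonneg (r x)), ← Real.sqrt_sq (by positivity : 0 ≤ ‖x‖ ^ n),
      ← Real.sqrt_mul' _ (by positivity)]
    refine Real.sqrt_le_sqrt ?_
    rw [← norm_pow, hr, ← pow_mul, mul_comm n]
    exact hx
  obtain ⟨B₁, hB₁, h1⟩ := (hf.add (hrg.mul hh hk)).exists_bound
  obtain ⟨B₂, hB₂, h2⟩ := (hf.sub (hrg.mul hh hk)).exists_bound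
  refine ⟨B₁ + B₂, ?_⟩
  filter_upwards [h1, h2] with x h1 h2 y hy
  rw [add_mul]
  have e1 : 0 ≤ B₁ * ‖x‖ ^ m := by positivity
  have e2 : 0 ≤ B₂ * ‖x‖ ^ m := by positivity
  rcases sq_eq_sq_iff_eq_or_eq_neg.1 (hy.trans (hr x).symm) with rfl | rfl
  · linarith
  · rw [neg_mul, ← sub_eq_add_neg]
    linarith

/-- Sum and difference of the values at the two points over `x` isolate `E` and `y O`, and `(y O)² =
O² p`. -/
theorem natDegree_le_of_growth_even_odd {p E O : ℂ[X]} (hp : p ≠ 0) {k : ℕ} {B : ℝ}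
    (h : ∀ᶠ x in Bornology.cobounded ℂ, ∀ y, y ^ 2 = p.eval x →
      ‖E.eval x + y * O.eval x‖ ≤ B * ‖x‖ ^ k) :
    E.natDegree ≤ k ∧ (O ≠ 0 → 2 * O.natDegree + p.natDegree ≤ 2 * k) := by
  choose r hr using exists_sq_eq_eval p
  have hrn : ∀ x, (-r x) ^ 2 = p.eval x := fun x => by rw [neg_sq, hr]
  constructor
  · refine natDegree_le_of_growth (C := B) ?_
    filter_upwards [h] with x hx
    have h1 := hx _ (hr x)
    have h2 := hx _ (hrn x)
    have := norm_add_le (E.eval x + r x * O.eval x) (E.eval x + -r x * O.eval x)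
    rw [show E.eval x + r x * O.eval x + (E.eval x + -r x * O.eval x) = 2 * E.eval x by ring,
      norm_mul, RCLike.norm_ofNat] at this
    linarith
  · intro hO
    have : (O ^ 2 * p).natDegree ≤ 2 * k := by
      refine natDegree_le_of_growth (C := B ^ 2) ?_
      filter_upwards [h] with x hx
      have h1 := hx _ (hr x)
      have h2 := hx _ (hrn x)
      have := norm_sub_le (E.eval x + r x * O.eval x) (E.eval x + -r x * O.eval x)
      rw [show E.eval x + r x * O.eval x - (E.eval x + -r x * O.eval x) = 2 * (r x * O.eval x) by
        ring, norm_mul, RCLike.norm_ofNat] at this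
      calc ‖(O ^ 2 * p).eval x‖ = ‖r x * O.eval x‖ ^ 2 := by
            rw [eval_mul, eval_pow, ← hr, ← norm_pow]
            congr 1
            ring
        _ ≤ (B * ‖x‖ ^ k) ^ 2 := by
            gcongr
            linarith
        _ = _ := by ring
    rwa [natDegree_mul (pow_ne_zero _ hO) hp, natDegree_pow] at this

/-! ### The two-point function for a fixed second position -/

theorem analyticAt_R₀ (c one : ℂ) (p Pe Po : ℂ[X]) {x₀ x₂ : ℂ} (y₂ : ℂ) (hx : x₀ ≠ x₂) :
    AnalyticAt ℂ (fun x => R₀ c one p Pe Po x x₂ y₂) x₀ := by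
  have hu : AnalyticAt ℂ (fun x => (x - x₂)⁻¹) x₀ :=
    (analyticAt_id.sub analyticAt_const).inv (sub_ne_zero.2 hx)
  have hd : ∀ q : ℂ[X], AnalyticAt ℂ (fun x => q.eval x) x₀ := fun q => analyticAt_eval q x₀
  have hm : ∀ q : ℂ[X], AnalyticAt ℂ (fun x => q.eval (x * x₂)) x₀ := fun q =>
    (analyticAt_eval q _).fun_comp (analyticAt_id.mul analyticAt_const)
  have h1 := hd p
  have h2 := hd (derivative p)
  have h3 := hd Pe
  have h4 := hd Po
  have h5 := hm (contract 2 p)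
  have h6 := hm (contract 2 p.divX)
  unfold R₀ polar
  fun_prop

theorem analyticAt_R₁ (c one : ℂ) (p Pe Po : ℂ[X]) {x₀ x₂ : ℂ} (y₂ : ℂ) (hx : x₀ ≠ x₂) :
    AnalyticAt ℂ (fun x => R₁ c one p Pe Po x x₂ y₂) x₀ := by
  have hu : AnalyticAt ℂ (fun x => (x - x₂)⁻¹) x₀ :=
    (analyticAt_id.sub analyticAt_const).inv (sub_ne_zero.2 hx)
  have hd : ∀ q : ℂ[X], AnalyticAt ℂ (fun x => q.eval x) x₀ := fun q => analyticAt_eval q x₀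
  have hm : ∀ q : ℂ[X], AnalyticAt ℂ (fun x => q.eval (x * x₂)) x₀ := fun q =>
    (analyticAt_eval q _).fun_comp (analyticAt_id.mul analyticAt_const)
  have h4 := hd Po
  have h5 := hm (contract 2 p)
  have h6 := hm (contract 2 p.divX)
  have h7 := hm (derivative (contract 2 p))
  have h8 := hm (derivative (contract 2 p.divX))
  have h9 := hm (derivative (derivative (contract 2 p)))
  have h10 := hm (derivative (derivative (contract 2 p.divX)))
  have h11 := hm (contract 2 Pe)
  have h12 := hm (contract 2 Pe.divX)
  unfold R₁ polar polarDeriv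
  fun_prop

theorem norm_le_one_add_of_sq_eq {p : ℂ[X]} {x y : ℂ} (hy : y ^ 2 = p.eval x) :
    ‖y‖ ≤ 1 + ‖p.eval x‖ := by
  rw [← hy, norm_pow]
  nlinarith [sq_nonneg (‖y‖ - 1), norm_nonneg y]

namespace VirasoroState

variable {p : ℂ[X]} {g : ℕ} {c : ℂ} (S : VirasoroState p g c)

/-- `p x₁ * p x₂` times the connected two-point function, with the singular part `R` removed. -/
noncomputable def reg (Pe Po : ℂ[X]) (x₁ y₁ x₂ y₂ : ℂ) : ℂ :=
  S.conn (xPatch p g y₁, x₁) (xPatch p g y₂, x₂) * p.eval x₁ * p.eval x₂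
    - R c S.one p Pe Po x₁ y₁ x₂ y₂

theorem conn_symm (a b : CoordPatch p g × ℂ) : S.conn a b = S.conn b a := by
  rw [conn, conn, Multiset.pair_comm]
  ring

theorem reg_symm (Pe Po : ℂ[X]) (x₁ y₁ x₂ y₂ : ℂ) :
    S.reg Pe Po x₁ y₁ x₂ y₂ = S.reg Pe Po x₂ y₂ x₁ y₁ := by
  rw [reg, reg, conn_symm, R_symm]
  ring

theorem exists_polynomials_reg (hp : Squarefree p) (hn : 0 < p.natDegree) (hS : S.one ≠ 0)
    (Pe Po : ℂ[X])
    (hP : ∀ x y : ℂ, y ≠ 0 → y ^ 2 = p.eval x → p.eval x * S.T₁ x y =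
      c / 32 * ((derivative p).eval x ^ 2 / p.eval x) * S.one + 1 / 4 * (Pe.eval x + y * Po.eval x))
    {x₂ y₂ : ℂ} (h0 : y₂ ≠ 0) (h : y₂ ^ 2 = p.eval x₂) {k : ℕ} (hpk : p.natDegree ≤ k)
    (hPek : Pe.natDegree ≤ k) (hPok : Po.natDegree ≤ k)
    (hg : ∃ B : ℝ, ∀ᶠ x in Bornology.cobounded ℂ, ∀ y, y ^ 2 = p.eval x →
      ‖S.conn (xPatch p g y, x) (xPatch p g y₂, x₂) * p.eval x‖ ≤ B * ‖x‖ ^ k) :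
    ∃ E O : ℂ[X], E.natDegree ≤ 3 * k + 2 ∧ O.natDegree ≤ 3 * k + 2 ∧
      ∀ x y, y ≠ 0 → y ^ 2 = p.eval x → x ≠ x₂ →
        S.reg Pe Po x y x₂ y₂ = E.eval x + y * O.eval x := by
  classical
  have hp0 := ne_zero_of_natDegree_pos hn
  have hp2 : p.eval x₂ ≠ 0 := h ▸ pow_ne_zero 2 h0
  have hmem : ∀ x, x ∈ insert x₂ p.roots.toFinset ↔ x = x₂ ∨ p.eval x = 0 := fun x => by simp [hp0]
  obtain ⟨B₁, hB₁⟩ := hg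
  -- `3k + 2` is the bound `2k + 2` for `R₁` plus the bound `k` for `y`.
  obtain ⟨B₂, hB₂⟩ := exists_bound_of_growth_even_odd (p := p) (n := k) (m := 3 * k + 2) (by omega)
    ((growthLE_R₀ c S.one hpk hPek hPok x₂ y₂).mono (by push_cast; omega))
    (growthLE_R₁ c S.one hpk hPek hPok x₂ y₂) (by push_cast; omega)
  obtain ⟨E, O, hE, hO, hEO⟩ := exists_polynomials_of_growth hp hn (insert x₂ p.roots.toFinset)
    (fun x hx => (hmem x).2 (Or.inr hx)) (fun x y => S.reg Pe Po x y x₂ y₂)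
    (fun x₀ y₀ hx₀ hy₀ => by
      rw [hmem, not_or] at hx₀
      have hy0 : y₀ ≠ 0 := by
        rintro rfl
        exact hx₀.2 (by rw [← hy₀]; simp)
      have k1 := S.analyticAt_conn hy0 h0 hy₀ h (fun hh => hx₀.1 hh.1)
      simp only [reg, R_eq]
      exact ((k1.mul (analyticAt_eval p x₀)).mul analyticAt_const).sub
        ((analyticAt_R₀ c S.one p Pe Po y₂ hx₀.1).add ((analyticAt_sqrtBranch hy0 hy₀).mul
          (analyticAt_R₁ c S.one p Pe Po y₂ hx₀.1))))
    (fun s hs => by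
      rcases eq_or_ne s x₂ with rfl | hne
      -- Two points lie over `x₂`. On the sheet of `y₂` the poles cancel; on the other sheet the
      -- connected function and `R` are bounded separately.
      · obtain ⟨C₁, hC₁⟩ := S.exists_bound_conn_sub_R Pe Po hP h0 h
        obtain ⟨C₂, hC₂⟩ := exists_bound_R_opposite_sheet c S.one p Pe Po h0 h
        have hneg : (-y₂) ^ 2 = p.eval s := by rw [neg_sq, h]
        have han := S.analyticAt_conn (neg_ne_zero.2 h0) h0 hneg h (fun hh => by
          have := hh.2
          rw [neg_eq_iff_add_eq_zero, ← two_mul] at this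
          exact h0 ((mul_eq_zero.1 this).resolve_left two_ne_zero))
        obtain ⟨C₃, hC₃⟩ := exists_bound_of_continuousAt
          ((han.mul (analyticAt_eval p s)).mul (analyticAt_const (v := p.eval s))).continuousAt
        refine ⟨max C₁ (C₃ + C₂), ?_⟩
        filter_upwards [hC₁, hC₂, nhdsWithin_le_nhds hC₃] with x h1 h2 h3 y hy
        rcases eq_or_eq_neg_sqrtBranch h0 hy with rfl | rfl
        · exact h1.trans (le_max_left _ _)
        · refine (norm_sub_le _ _).trans ((add_le_add ?_ h2).trans (le_max_right _ _))
          rw [← sqrtBranch_neg]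
          exact h3
      · have hs0 : p.eval s = 0 := ((hmem s).1 hs).resolve_left hne
        obtain ⟨C₁, hC₁⟩ := S.exists_bound_conn_root hp hp0 hS hs0 h0 h
        obtain ⟨C₂, hC₂⟩ := exists_bound_of_continuousAt
          (analyticAt_R₀ c S.one p Pe Po y₂ hne).continuousAt
        obtain ⟨C₃, hC₃⟩ := exists_bound_of_continuousAt
          (analyticAt_R₁ c S.one p Pe Po y₂ hne).continuousAt
        obtain ⟨C₄, hC₄⟩ := exists_bound_of_continuousAt (p.continuous.continuousAt (x := s))
        refine ⟨C₁ * ‖p.eval x₂‖ + (C₂ + (1 + C₄) * C₃), ?_⟩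
        filter_upwards [hC₁, nhdsWithin_le_nhds hC₂, nhdsWithin_le_nhds hC₃,
          nhdsWithin_le_nhds hC₄] with x h1 h2 h3 h4 y hy
        rw [reg, R_eq]
        refine (norm_sub_le _ _).trans (add_le_add ?_ ((norm_add_le _ _).trans (add_le_add h2 ?_)))
        · rw [norm_mul]
          gcongr
          exact h1 y hy
        · have h5 := norm_le_one_add_of_sq_eq hy
          rw [norm_mul]
          exact mul_le_mul (h5.trans (by gcongr)) h3 (norm_nonneg _)
            ((norm_nonneg _).trans (h5.trans (by gcongr))))
    (k := 3 * k + 2) (C := |B₁| * ‖p.eval x₂‖ + B₂) (by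
      filter_upwards [hB₁, hB₂, eventually_cobounded_le_norm (E := ℂ) 1] with x h1 h2 hx y hy
      rw [reg, R_eq, add_mul]
      refine (norm_sub_le _ _).trans (add_le_add ?_ (h2 y hy))
      rw [norm_mul, mul_right_comm]
      gcongr
      refine (h1 y hy).trans (mul_le_mul (le_abs_self _) (pow_le_pow_right₀ hx (by omega))
        (by positivity) (abs_nonneg _)))
  refine ⟨E, O, hE, ?_, fun x y hy0 hy hx => hEO x y ?_ hy⟩
  · rcases eq_or_ne O 0 with rfl | hO0
    · simp
    · have := hO hO0
      omega
  · rw [hmem, not_or]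
    exact ⟨hx, hy ▸ pow_ne_zero 2 hy0⟩

end VirasoroState

/-! ### Asymptotics of `R` and of the correction terms, for odd degree -/

theorem degree_lt_of_coeff {q : ℂ[X]} {n : ℕ} (h : ∀ j, n ≤ j → q.coeff j = 0) :
    q.degree < (n : ℕ) := (degree_lt_iff_coeff_zero q n).2 h

/-- Source of the fractions in the correction. The leading term `½ a₀ b^g x^(g+1)` of `polar` meets
`x⁻² + 2b x⁻³`, and the next one contains `½ a₀ b^(g+1) x^g`; so `a₀` enters at order `x^(g-2)` with
`1 + ½ = 3/2`. The factor `1/8` in `R` turns `1, ½, 3/2, ½` into `1/8, 1/16, 3/16, 1/16`. -/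
theorem growthLE_polar_mul_inv_sq {p : ℂ[X]} {g : ℕ} (hg : 1 ≤ g)
    (hdeg : p.natDegree = 2 * g + 1) (b : ℂ) :
    GrowthLE (fun x => polar p x b * (x - b)⁻¹ ^ 2 -
      (x ^ g * x⁻¹ ^ 2 * (p.coeff (2 * g) * b ^ g + 3 / 2 * p.coeff (2 * g + 1) * b ^ (g + 1)
        + 1 / 2 * p.coeff (2 * g - 1) * b ^ (g - 1))
      + x ^ g * x⁻¹ * (1 / 2 * p.coeff (2 * g + 1) * b ^ g))) (g - 3) := by
  obtain ⟨m, rfl⟩ : ∃ m, g = m + 1 := ⟨g - 1, by omega⟩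
  rw [show 2 * (m + 1) - 1 = 2 * m + 1 by omega]
  simp only [Nat.add_sub_cancel]
  set a₀ := p.coeff (2 * (m + 1) + 1) with ha₀
  set a₁ := p.coeff (2 * (m + 1)) with ha₁
  set a₂ := p.coeff (2 * m + 1) with ha₂
  set σ := contract 2 p - C a₁ * X ^ (m + 1) with hσ
  set ρ := contract 2 p.divX - C a₀ * X ^ (m + 1) - C a₂ * X ^ m with hρ
  have dσ : σ.degree < (m + 1 : ℕ) := degree_lt_of_coeff fun j hj => by
    rw [hσ, coeff_sub, coeff_contract two_ne_zero, coeff_C_mul, coeff_X_pow]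
    rcases hj.eq_or_lt with rfl | hj
    · rw [if_pos rfl, ha₁, mul_comm (m + 1)]
      ring
    · rw [if_neg (by omega), coeff_eq_zero_of_natDegree_lt (by omega)]
      ring
  have dρ : ρ.degree < (m : ℕ) := degree_lt_of_coeff fun j hj => by
    rw [hρ, coeff_sub, coeff_sub, coeff_contract two_ne_zero, coeff_C_mul, coeff_X_pow, coeff_C_mul,
      coeff_X_pow, coeff_divX]
    rcases hj.eq_or_lt with rfl | hj
    · rw [if_pos rfl, if_neg (by omega), ha₂, mul_comm m]
      ring
    · rcases (Nat.succ_le_of_lt hj).eq_or_lt with rfl | hj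
      · rw [if_pos rfl, if_neg (by omega), ha₀, mul_comm (m.succ)]
        simp
      · rw [if_neg (by omega), if_neg (by omega), coeff_eq_zero_of_natDegree_lt (by omega)]
        ring
  have eσ := GrowthLE.eval_mul_degree dσ b
  have eρ := GrowthLE.eval_mul_degree dρ b
  have g1 := ((GrowthLE.pow (m + 2)).mul (GrowthLE.inv_sub_sq_sub_sub b)
    (by push_cast; omega : _ ≤ ((m + 1 : ℕ) - 3 : ℤ))).const_mul (1 / 2 * a₀ * b ^ (m + 1))
  have g2 := ((GrowthLE.pow (m + 1)).mul (GrowthLE.inv_sub_sq_sub b)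
    (by push_cast; omega : _ ≤ ((m + 1 : ℕ) - 3 : ℤ))).const_mul
      (a₁ * b ^ (m + 1) + 1 / 2 * a₀ * b ^ (m + 2) + 1 / 2 * a₂ * b ^ m)
  have g3 := ((((eσ.mono (by push_cast; omega : _ ≤ (m : ℤ))).add
    ((GrowthLE.id.mul eρ (by omega : _ ≤ (m : ℤ))).const_mul (1 / 2))).add
    ((GrowthLE.pow m).const_mul (1 / 2 * b * a₂ * b ^ m))).add
    ((eρ.const_mul (1 / 2 * b)).mono (by omega : _ ≤ (m : ℤ)))).mul (GrowthLE.inv_sub_sq b)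
    (by push_cast; omega : _ ≤ ((m + 1 : ℕ) - 3 : ℤ))
  refine ((g1.add g2).add g3).congr ?_
  filter_upwards [eventually_ne_zero_cobounded] with x hx
  have e1 : (contract 2 p).eval (x * b) = a₁ * (x * b) ^ (m + 1) + σ.eval (x * b) := by
    rw [hσ]
    simp
  have e2 : (contract 2 p.divX).eval (x * b) =
      a₀ * (x * b) ^ (m + 1) + a₂ * (x * b) ^ m + ρ.eval (x * b) := by
    rw [hρ]
    simp
  rw [polar, e1, e2]
  generalize (x - b)⁻¹ = u
  field_simp
  ring

/-- The naive order is `x^g`, one too many. The top coefficient `(c/32)(4g + 2g(g-1)) a₀ = (c/16)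
g(g+1) a₀` cancels, up to the common factor `⟨1⟩`, against `1/8` of the top coefficient `-(c/2)
g(g+1) a₀` of `Pe`. -/
theorem growthLE_polarDeriv_add_polar {p E : ℂ[X]} {g : ℕ} (hg : 1 ≤ g)
    (hdeg : p.natDegree = 2 * g + 1) (hE : E.natDegree ≤ 2 * g - 2) (c one b : ℂ) {Pe : ℂ[X]}
    (hPe : Pe = E - C (c / 8 * one * (2 * g * (2 * g + 2)) * p.coeff (2 * g + 1)) * X ^ (2 * g - 1)) :
    GrowthLE (fun x => c / 32 * one * polarDeriv p x b + 1 / 4 * polar Pe x b) (g - 1) := by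
  obtain ⟨m, rfl⟩ : ∃ m, g = m + 1 := ⟨g - 1, by omega⟩
  have hPec : ∀ j, 2 * m + 1 < j → Pe.coeff j = 0 := fun j hj => by
    rw [hPe, coeff_sub, coeff_C_mul, coeff_X_pow, if_neg (by omega),
      coeff_eq_zero_of_natDegree_lt (by omega)]
    ring
  have hPet : Pe.coeff (2 * m + 1) =
      -(c / 8 * one * (2 * (m + 1) * (2 * (m + 1) + 2)) * p.coeff (2 * m + 3)) := by
    rw [hPe, coeff_sub, coeff_C_mul, coeff_X_pow, if_pos (by omega),
      coeff_eq_zero_of_natDegree_lt (by omega)]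
    push_cast
    ring_nf
  set A := C (c / 32 * one) * (4 * derivative (contract 2 p)
    + 4 * (X * derivative (derivative (contract 2 p)))) + C (1 / 4) * contract 2 Pe with hA
  set D := C (c / 32 * one) * (4 * derivative (contract 2 p.divX)
    + 2 * (X * derivative (derivative (contract 2 p.divX)))) + C (1 / 8) * contract 2 Pe.divX with hD
  have hXd : ∀ (q : ℂ[X]) j, (X * derivative q).coeff j = j * q.coeff j := fun q j => by
    rcases j with _ | j
    · simp
    · rw [coeff_X_mul, coeff_derivative]
      push_cast
      ring
  have h4 : ∀ (q : ℂ[X]) j, ((4 : ℂ[X]) * q).coeff j = 4 * q.coeff j := fun q j => by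
    rw [← C_ofNat, coeff_C_mul]
  have h2 : ∀ (q : ℂ[X]) j, ((2 : ℂ[X]) * q).coeff j = 2 * q.coeff j := fun q j => by
    rw [← C_ofNat, coeff_C_mul]
  have dA : A.degree < (m + 1 : ℕ) := degree_lt_of_coeff fun j hj => by
    rw [hA, coeff_add, coeff_C_mul, coeff_C_mul, coeff_add, h4, h4, hXd, coeff_derivative,
      coeff_contract two_ne_zero, coeff_contract two_ne_zero,
      coeff_eq_zero_of_natDegree_lt (p := p) (by omega), hPec _ (by omega)]
    ring
  have dD : D.degree < (m : ℕ) := degree_lt_of_coeff fun j hj => by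
    rw [hD, coeff_add, coeff_C_mul, coeff_C_mul, coeff_add, h4, h2, hXd, coeff_derivative,
      coeff_contract two_ne_zero, coeff_contract two_ne_zero, coeff_divX, coeff_divX]
    rcases hj.eq_or_lt with rfl | hj
    · rw [show (m + 1) * 2 + 1 = 2 * m + 3 by ring, show m * 2 + 1 = 2 * m + 1 by ring, hPet]
      ring
    · rw [coeff_eq_zero_of_natDegree_lt (p := p) (by omega), hPec _ (by omega)]
      ring
  have eA := GrowthLE.eval_mul_degree dA b
  have eD := GrowthLE.eval_mul_degree dD b
  refine ((eA.mono (by push_cast; omega)).add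
    ((GrowthLE.id.add ((GrowthLE.const b).mono (by norm_num))).mul eD
      (by push_cast; omega))).congr (Eventually.of_forall fun x => ?_)
  rw [hA, hD, polarDeriv, polar]
  simp only [eval_add, eval_mul, eval_C, eval_X, eval_ofNat]
  ring

/-- The part of the correction terms that is even in `y₁`, as a polynomial in `x₁`. -/
noncomputable def correction₀ (g : ℕ) (c one : ℂ) (p Pe Po : ℂ[X]) (b y : ℂ) : ℂ[X] :=
  C (-(1 / 8) * p.coeff (2 * g + 1)) * (C (Pe.eval b + y * Po.eval b) * X ^ (2 * g - 1)
      + C (b ^ (2 * g - 1)) * Pe)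
    - C (c / 64 * one * ((2 * g + 1) ^ 2 - 1) * p.coeff (2 * g + 1) ^ 2 * b ^ (2 * g - 1))
      * X ^ (2 * g - 1)
    - (C (1 / 8 * y * p.coeff (2 * g) * b ^ (g - 2)) * X ^ g
      + C (1 / 16 * y * p.coeff (2 * g + 1) * b ^ (g - 1)) * X ^ g
      + C (3 / 16 * y * p.coeff (2 * g + 1) * b ^ (g - 2)) * X ^ (g + 1)
      + C (1 / 16 * y * p.coeff (2 * g - 1) * b ^ (g - 2)) * X ^ (g - 1)) * Po

/-- The coefficient of `y₁` in the correction terms, as a polynomial in `x₁`. -/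
noncomputable def correction₁ (g : ℕ) (p Po : ℂ[X]) (b : ℂ) : ℂ[X] :=
  -(C (1 / 8 * p.coeff (2 * g + 1) * b ^ (2 * g - 1)) * Po)
    - C (1 / 8 * Po.eval b) * (X ^ (g - 2) * C (p.coeff (2 * g) * b ^ g
        + 3 / 2 * p.coeff (2 * g + 1) * b ^ (g + 1) + 1 / 2 * p.coeff (2 * g - 1) * b ^ (g - 1))
      + X ^ (g - 1) * C (1 / 2 * p.coeff (2 * g + 1) * b ^ g))

/-- The integer exponent `g - 2` is negative for `g = 1`, where natural subtraction would differ;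
there `Po = 0` removes the terms concerned. -/
theorem correction_eq {g : ℕ} (hg : 1 ≤ g) (c one : ℂ) {p : ℂ[X]} (Pe : ℂ[X]) {Po : ℂ[X]}
    (hdeg : p.natDegree = 2 * g + 1) (hPo : Po = 0 ∨ 2 ≤ g) (x y b w : ℂ) :
    correction g c one p Pe Po x y b w =
      (correction₀ g c one p Pe Po b w).eval x + y * (correction₁ g p Po b).eval x := by
  have d0 : descCoeff p 0 = p.coeff (2 * g + 1) := by rw [descCoeff, hdeg, Nat.sub_zero]
  have d1 : descCoeff p 1 = p.coeff (2 * g) := by rw [descCoeff, hdeg, Nat.add_sub_cancel]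
  have d2 : descCoeff p 2 = p.coeff (2 * g - 1) := by
    rw [descCoeff, hdeg, show 2 * g + 1 - 2 = 2 * g - 1 by omega]
  have dn : p.natDegree - 2 = 2 * g - 1 := by omega
  have dc : (p.natDegree : ℂ) = 2 * g + 1 := by
    rw [hdeg]
    push_cast
    ring
  rw [correction, d0, d1, d2, dn, dc, correction₀, correction₁]
  rcases hPo with rfl | h2
  · simp only [eval_zero, mul_zero, eval_sub, eval_mul, eval_add, eval_neg, eval_C, eval_X,
      eval_pow]
    ring
  · obtain ⟨m, rfl⟩ : ∃ m, g = m + 2 := ⟨g - 2, by omega⟩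
    have e1 : ((m + 2 : ℕ) : ℤ) - 2 = (m : ℕ) := by push_cast; ring
    have e2 : ((m + 2 : ℕ) : ℤ) - 1 = (m + 1 : ℕ) := by push_cast; ring
    have e3 : ((m + 2 : ℕ) : ℤ) + 1 = (m + 3 : ℕ) := by push_cast; ring
    rw [e1, e2, e3]
    simp only [zpow_natCast, show m + 2 - 2 = m by omega, show m + 2 - 1 = m + 1 by omega,
      eval_sub, eval_mul, eval_add, eval_neg, eval_C, eval_X, eval_pow]
    ring

theorem correction_symm (g : ℕ) (c one : ℂ) (p Pe Po : ℂ[X]) (x₁ y₁ x₂ y₂ : ℂ) :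
    correction g c one p Pe Po x₁ y₁ x₂ y₂ = correction g c one p Pe Po x₂ y₂ x₁ y₁ := by
  unfold correction
  ring

/-- Two excess terms of order `x^(n-2)` occur. That of `p₁P₂/h²` is cancelled by `-(1/8) a₀ x₁^(n-2)
P₂`. The mirror term `-(1/8) a₀ x₂^(n-2) P₁` brings in the top coefficient of `Pe`, which the term
with `c/64 = (1/8)(c/8)` removes. The `y₂`-terms, mirror images of the `y₁`-terms, stay within the
bound. -/
theorem growthLE_R₀_add_correction₀ {p E Po : ℂ[X]} {g : ℕ} (hg : 1 ≤ g)
    (hdeg : p.natDegree = 2 * g + 1) (hE : E.natDegree ≤ 2 * g - 2) (c one b y : ℂ) {Pe : ℂ[X]}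
    (hPe : Pe = E - C (c / 8 * one * (2 * g * (2 * g + 2)) * p.coeff (2 * g + 1)) * X ^ (2 * g - 1))
    (hPo : GrowthLE (fun x => Po.eval x) (g - 3)) :
    GrowthLE (fun x => R₀ c one p Pe Po x b y + (correction₀ g c one p Pe Po b y).eval x)
      (2 * g - 2 : ℕ) := by
  have hk : ((2 * g - 2 : ℕ) : ℤ) = 2 * g - 2 := by omega
  have u2 := GrowthLE.inv_sub_sq b
  have u4 := GrowthLE.inv_sub_pow_four b
  have ep : GrowthLE (fun x => p.eval x) (2 * g + 1) :=
    (GrowthLE.eval_natDegree hdeg.le).mono (by push_cast; omega)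
  have ed : GrowthLE (fun x => (derivative p).eval x) (2 * g) :=
    (GrowthLE.eval_natDegree ((natDegree_derivative_le p).trans (by omega : _ ≤ 2 * g))).mono
      (by push_cast; omega)
  have eE : GrowthLE (fun x => E.eval x) (2 * g - 2) := (GrowthLE.eval_natDegree hE).mono (by omega)
  have ePe : GrowthLE (fun x => Pe.eval x) (2 * g - 1) := by
    refine (GrowthLE.eval_natDegree (n := 2 * g - 1) ?_).mono (by omega)
    rw [hPe]
    refine (natDegree_sub_le _ _).trans (max_le (hE.trans (by omega)) (natDegree_C_mul_X_pow_le _ _))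
  have ea : GrowthLE (fun x => polar p x b) (g + 1) := growthLE_polar hdeg.le b
  set a₀ := p.coeff (2 * g + 1) with ha₀
  set r := p - C a₀ * X ^ (2 * g + 1) with hr
  have dr : r.degree < (2 * g + 1 : ℕ) := degree_lt_of_coeff fun j hj => by
    rw [hr, coeff_sub, coeff_C_mul, coeff_X_pow]
    rcases hj.eq_or_lt with rfl | hj
    · rw [if_pos rfl]
      ring
    · rw [if_neg (by omega), coeff_eq_zero_of_natDegree_lt (by omega)]
      ring
  have er := GrowthLE.eval_degree dr
  have g1 := ((ep.mul_const (p.eval b)).const_mul (c / 4 * one)).mul u4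
    (by omega : _ ≤ (2 * g - 2 : ℤ))
  have g2 := ((ed.mul_const ((derivative p).eval b)).const_mul (c / 32 * one)).mul u2
    (by omega : _ ≤ (2 * g - 2 : ℤ))
  have g3 := ((((GrowthLE.pow (2 * g + 1)).mul (GrowthLE.inv_sub_sq_sub b)
    (by push_cast; omega : _ ≤ (2 * g - 2 : ℤ))).const_mul a₀).add (er.mul u2
    (by push_cast; omega : _ ≤ (2 * g - 2 : ℤ)))).const_mul (1 / 8 * (Pe.eval b + y * Po.eval b))
  have g4 := (ePe.const_mul (1 / 8 * p.eval b)).mul u2 (by omega : _ ≤ (2 * g - 2 : ℤ))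
  have g5 := ((hPo.mul ea le_rfl).const_mul (1 / 8 * y)).mul u2 (by omega : _ ≤ (2 * g - 2 : ℤ))
  have g6 := eE.const_mul (-(1 / 8) * a₀ * b ^ (2 * g - 1))
  have g7 := (((((GrowthLE.pow g).const_mul (1 / 8 * y * p.coeff (2 * g) * b ^ (g - 2))).mono
    (by omega : _ ≤ (g + 1 : ℤ))).add (((GrowthLE.pow g).const_mul
      (1 / 16 * y * a₀ * b ^ (g - 1))).mono (by omega : _ ≤ (g + 1 : ℤ)))).add
      (((GrowthLE.pow (g + 1)).const_mul (3 / 16 * y * a₀ * b ^ (g - 2))).mono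
        (by push_cast; omega : _ ≤ (g + 1 : ℤ)))).add (((GrowthLE.pow (g - 1)).const_mul
      (1 / 16 * y * p.coeff (2 * g - 1) * b ^ (g - 2))).mono (by omega : _ ≤ (g + 1 : ℤ)))
  have g8 := g7.mul hPo (by omega : _ ≤ (2 * g - 2 : ℤ))
  rw [hk]
  refine (((((((g1.add g2).add g3).add g4).add g5).add g6).sub g8)).congr ?_
  filter_upwards [eventually_ne_zero_cobounded] with x hx
  have ePx : p.eval x = a₀ * x ^ (2 * g + 1) + r.eval x := by
    rw [hr]
    simp
  have eEx : Pe.eval x = E.eval x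
      - c / 8 * one * (2 * g * (2 * g + 2)) * a₀ * x ^ (2 * g - 1) := by
    rw [hPe]
    simp
  have epow : x ^ (2 * g + 1) * x⁻¹ ^ 2 = x ^ (2 * g - 1) := by
    rw [show 2 * g + 1 = 2 * g - 1 + 2 by omega, pow_add, mul_assoc, ← mul_pow, mul_inv_cancel₀ hx,
      one_pow, mul_one]
  simp only [R₀, correction₀, eval_sub, eval_mul, eval_add, eval_C, eval_X, eval_pow, ← ha₀]
  linear_combination (-(1 / 8) * a₀ * b ^ (2 * g - 1)) * eEx
    + 1 / 8 * (Pe.eval b + y * Po.eval b) * (x - b)⁻¹ ^ 2 * ePx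
    + 1 / 8 * (Pe.eval b + y * Po.eval b) * a₀ * epow

/-- The only excess is in `Po(x₂) polar / h²`, which `correction₁` subtracts. The terms with
`polarDeriv p` and `polar Pe` are admissible only jointly. -/
theorem growthLE_R₁_add_correction₁ {p E Po : ℂ[X]} {g : ℕ} (hg : 1 ≤ g)
    (hdeg : p.natDegree = 2 * g + 1) (hE : E.natDegree ≤ 2 * g - 2) (c one b y : ℂ) {Pe : ℂ[X]}
    (hPe : Pe = E - C (c / 8 * one * (2 * g * (2 * g + 2)) * p.coeff (2 * g + 1)) * X ^ (2 * g - 1))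
    (hPo : GrowthLE (fun x => Po.eval x) (g - 3)) (hPo0 : Po = 0 ∨ 2 ≤ g) :
    GrowthLE (fun x => R₁ c one p Pe Po x b y + (correction₁ g p Po b).eval x) (g - 3) := by
  have u2 := GrowthLE.inv_sub_sq b
  have u4 := GrowthLE.inv_sub_pow_four b
  have ea : GrowthLE (fun x => polar p x b) (g + 1) := growthLE_polar hdeg.le b
  have g1 := (ea.const_mul (c / 4 * one * y)).mul u4 (by omega : _ ≤ (g - 3 : ℤ))
  have g2 := (((growthLE_polarDeriv_add_polar hg hdeg hE c one b hPe).mul u2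
    (by omega : _ ≤ (g - 3 : ℤ)))).const_mul y
  have g3 := (hPo.const_mul (1 / 8 * p.eval b)).mul u2 (by omega : _ ≤ (g - 3 : ℤ))
  have g4 := hPo.const_mul (1 / 8 * p.coeff (2 * g + 1) * b ^ (2 * g - 1))
  have g5 := (growthLE_polar_mul_inv_sq hg hdeg b).const_mul (1 / 8 * Po.eval b)
  refine ((((g1.add g2).add g3).sub g4).add g5).congr ?_
  filter_upwards [eventually_ne_zero_cobounded] with x hx
  simp only [R₁, correction₁, eval_sub, eval_mul, eval_add, eval_neg, eval_C, eval_X, eval_pow]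
  rcases hPo0 with rfl | h2
  · simp only [eval_zero]
    ring
  · have e1 : x ^ g * x⁻¹ ^ 2 = x ^ (g - 2) := by
      rw [show x ^ g = x ^ (g - 2 + 2) by rw [Nat.sub_add_cancel h2], pow_add, mul_assoc, ← mul_pow,
        mul_inv_cancel₀ hx, one_pow, mul_one]
    have e2 : x ^ g * x⁻¹ = x ^ (g - 1) := by
      rw [show x ^ g = x ^ (g - 1 + 1) by rw [Nat.sub_add_cancel hg], pow_succ, mul_assoc,
        mul_inv_cancel₀ hx, mul_one]
    rw [e1, e2]
    ring

/-! ### The two-point function on the whole curve -/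

namespace VirasoroState

variable {p : ℂ[X]} {g : ℕ} {c : ℂ} (S : VirasoroState p g c)

theorem T₂_sub_eq_conn (x₁ y₁ x₂ y₂ : ℂ) :
    S.T₂ x₁ y₁ x₂ y₂ * p.eval x₁ * p.eval x₂
        - S.one⁻¹ * S.T₁ x₁ y₁ * S.T₁ x₂ y₂ * p.eval x₁ * p.eval x₂ =
      S.conn (xPatch p g y₁, x₁) (xPatch p g y₂, x₂) * p.eval x₁ * p.eval x₂ := by
  rw [conn, T₂, T₁, T₁]
  ring

theorem isBigO_T₂c (hg : 1 ≤ g) (hdeg : p.natDegree = 2 * g + 1) (hS : S.one ≠ 0)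
    {x₂ y₂ : ℂ} (h0 : y₂ ≠ 0) (h : y₂ ^ 2 = p.eval x₂) :
    (fun P₁ : ℂ × ℂ => S.T₂c P₁.1 P₁.2 x₂ y₂ * p.eval P₁.1 * p.eval x₂)
      =O[Filter.comap Prod.fst (Bornology.cobounded ℂ) ⊓
          Filter.principal {P₁ : ℂ × ℂ | P₁.2 ^ 2 = p.eval P₁.1}]
    (fun P₁ : ℂ × ℂ => P₁.1 ^ (p.natDegree - 3)) := by
  obtain ⟨B, hB⟩ := S.exists_bound_conn_odd hg hdeg hS h0 h
  refine Asymptotics.IsBigO.of_bound (‖S.one⁻¹‖ * B * ‖p.eval x₂‖) ?_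
  rw [eventually_inf_principal]
  filter_upwards [hB.comap Prod.fst] with P hP hy
  have e : S.T₂c P.1 P.2 x₂ y₂ * p.eval P.1 * p.eval x₂ = S.one⁻¹ *
      (S.conn (xPatch p g P.2, P.1) (xPatch p g y₂, x₂) * p.eval P.1) * p.eval x₂ := by
    rw [T₂c, conn, T₂, T₁, T₁]
    field_simp
  rw [e, norm_mul, norm_mul, norm_pow, show p.natDegree - 3 = 2 * g - 2 by omega]
  calc _ ≤ ‖S.one⁻¹‖ * (B * ‖P.1‖ ^ (2 * g - 2)) * ‖p.eval x₂‖ := by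
        gcongr
        exact hP _ hy
    _ = _ := by ring

/-- The shape of the one-point function if `p` has odd degree. -/
structure OddShape (p : ℂ[X]) (g : ℕ) (c one : ℂ) (Pe Po : ℂ[X]) : Prop where
  exists_even : ∃ E : ℂ[X], E.natDegree ≤ 2 * g - 2 ∧
    Pe = E - C (c / 8 * one * (2 * g * (2 * g + 2)) * p.coeff (2 * g + 1)) * X ^ (2 * g - 1)
  growth_odd : GrowthLE (fun x => Po.eval x) (g - 3)
  eq_zero_or : Po = 0 ∨ 2 ≤ g

theorem exists_one_point_polynomials (hg : 1 ≤ g) (hp : Squarefree p)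
    (hdeg : p.natDegree = 2 * g + 1 ∨ p.natDegree = 2 * g + 2) (hS : S.one ≠ 0) :
    ∃ Pe Po : ℂ[X], (∀ x y : ℂ, y ≠ 0 → y ^ 2 = p.eval x → p.eval x * S.T₁ x y =
        c / 32 * ((derivative p).eval x ^ 2 / p.eval x) * S.one
          + 1 / 4 * (Pe.eval x + y * Po.eval x)) ∧
      (p.natDegree = 2 * g + 1 → OddShape p g c S.one Pe Po) := by
  rcases hdeg with hdeg | hdeg
  · obtain ⟨B, hB⟩ := S.exists_bound_P₁_odd hg hdeg hS
    obtain ⟨E, O, hE, hO, hEO⟩ := S.exists_P_polynomials hp (by omega) hS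
      (C (c / 8 * S.one * (2 * g * (2 * g + 2)) * p.coeff (2 * g + 1)) * X ^ (2 * g - 1))
      (k := 2 * g - 2) (B := B) (by
        filter_upwards [hB] with x hx y hy
        have := hx y hy
        rw [leadingCoeff, hdeg] at this
        simpa using this)
    refine ⟨_, O, fun x y hy0 hy => S.T₁_eq_of_P₁_eq (hEO x y hy0 hy), fun _ =>
      ⟨⟨E, hE, rfl⟩, ?_, ?_⟩⟩
    · rcases eq_or_ne O 0 with rfl | hO0
      · simp only [eval_zero]
        exact Asymptotics.isBigO_zero _ _
      · have := hO hO0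
        exact (GrowthLE.eval_natDegree le_rfl).mono (by omega)
    · rcases eq_or_ne O 0 with hO0 | hO0
      · exact Or.inl hO0
      · have := hO hO0
        exact Or.inr (by omega)
  · obtain ⟨B, hB⟩ := S.exists_bound_P₁_even hdeg hS
    obtain ⟨E, O, -, -, hEO⟩ := S.exists_P_polynomials hp (by omega) hS 0
      (k := 2 * (2 * g + 2)) (B := B) (by simpa using hB)
    exact ⟨_, O, fun x y hy0 hy => S.T₁_eq_of_P₁_eq (hEO x y hy0 hy), fun hh => by omega⟩

theorem exists_bound_conn_inf (hg : 1 ≤ g)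
    (hdeg : p.natDegree = 2 * g + 1 ∨ p.natDegree = 2 * g + 2) (hS : S.one ≠ 0)
    {x₂ y₂ : ℂ} (h0 : y₂ ≠ 0) (h : y₂ ^ 2 = p.eval x₂) {k : ℕ} (hk : p.natDegree ≤ k) :
    ∃ B : ℝ, ∀ᶠ x in Bornology.cobounded ℂ, ∀ y, y ^ 2 = p.eval x →
      ‖S.conn (xPatch p g y, x) (xPatch p g y₂, x₂) * p.eval x‖ ≤ B * ‖x‖ ^ k := by
  obtain ⟨B, m, hm, hB⟩ : ∃ (B : ℝ) (m : ℕ), m ≤ k ∧ ∀ᶠ x in Bornology.cobounded ℂ, ∀ y,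
      y ^ 2 = p.eval x →
        ‖S.conn (xPatch p g y, x) (xPatch p g y₂, x₂) * p.eval x‖ ≤ B * ‖x‖ ^ m := by
    rcases hdeg with hdeg | hdeg
    · obtain ⟨B, hB⟩ := S.exists_bound_conn_odd hg hdeg hS h0 h
      exact ⟨B, _, by omega, hB⟩
    · obtain ⟨B, hB⟩ := S.exists_bound_conn_even hdeg hS h0 h
      exact ⟨B, _, by omega, hB⟩
  refine ⟨|B|, ?_⟩
  filter_upwards [hB, eventually_cobounded_le_norm (E := ℂ) 1] with x hx h1 y hy
  exact (hx y hy).trans (mul_le_mul (le_abs_self _) (pow_le_pow_right₀ h1 hm) (by positivity)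
    (abs_nonneg _))

theorem exists_polynomial_eq_reg (hg : 1 ≤ g) (hp : Squarefree p)
    (hdeg : p.natDegree = 2 * g + 1 ∨ p.natDegree = 2 * g + 2) (hS : S.one ≠ 0) (Pe Po : ℂ[X])
    (hP : ∀ x y : ℂ, y ≠ 0 → y ^ 2 = p.eval x → p.eval x * S.T₁ x y =
      c / 32 * ((derivative p).eval x ^ 2 / p.eval x) * S.one
        + 1 / 4 * (Pe.eval x + y * Po.eval x)) :
    ∃ Q : MvPolynomial (Fin 4) ℂ, ∀ x₁ y₁ x₂ y₂ : ℂ, y₁ ≠ 0 → y₂ ≠ 0 → y₁ ^ 2 = p.eval x₁ →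
      y₂ ^ 2 = p.eval x₂ → x₁ ≠ x₂ →
        S.reg Pe Po x₁ y₁ x₂ y₂ = MvPolynomial.eval ![x₁, x₂, y₁, y₂] Q := by
  set k := p.natDegree + Pe.natDegree + Po.natDegree with hk
  obtain ⟨c₀, c₁, c₂, c₁₂, hc, -⟩ := exists_symmetric_bival_of_symmetric
    (ne_zero_of_natDegree_pos (by omega : 0 < p.natDegree)) (S.reg Pe Po) (3 * k + 3) (3 * k + 3)
    (S.reg_symm Pe Po) (fun x₂ y₂ h0 h => by
      obtain ⟨E, O, hE, hO, hEO⟩ := S.exists_polynomials_reg hp (by omega) hS Pe Po hP h0 h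
        (k := k) (by omega) (by omega) (by omega)
        (S.exists_bound_conn_inf hg hdeg hS h0 h (by omega))
      have d : ∀ q : ℂ[X], q.natDegree ≤ 3 * k + 2 → q.degree < (3 * k + 3 : ℕ) := fun q hq =>
        degree_le_natDegree.trans_lt (by exact_mod_cast Nat.lt_succ_of_le hq)
      exact ⟨E, O, d E hE, d O hO, fun x₁ y₁ hy0 hy hx => hEO x₁ y₁ hy0 hy hx⟩)
  let ι : MvPolynomial (Fin 2) ℂ → MvPolynomial (Fin 4) ℂ := MvPolynomial.rename ![0, 1]
  have hι : ∀ (q : MvPolynomial (Fin 2) ℂ) (x₁ y₁ x₂ y₂ : ℂ),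
      MvPolynomial.eval ![x₁, x₂, y₁, y₂] (ι q) = eval₂v q x₁ x₂ := fun q x₁ y₁ x₂ y₂ => by
    rw [MvPolynomial.eval_rename, eval₂v]
    congr 2
    ext i
    fin_cases i <;> rfl
  refine ⟨ι (bipoly (3 * k + 3) (3 * k + 3) c₀) + MvPolynomial.X 2 * ι (bipoly (3 * k + 3) (3 * k + 3) c₁)
    + MvPolynomial.X 3 * ι (bipoly (3 * k + 3) (3 * k + 3) c₂)
    + MvPolynomial.X 2 * MvPolynomial.X 3 * ι (bipoly (3 * k + 3) (3 * k + 3) c₁₂),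
    fun x₁ y₁ x₂ y₂ h1 h2 h3 h4 h5 => ?_⟩
  rw [hc x₁ y₁ x₂ y₂ h1 h2 h3 h4 h5]
  simp only [map_add, map_mul, hι, eval₂v_bipoly, MvPolynomial.eval_X]
  rfl

/-- The two-point function for odd degree, with `R` and the correction terms removed, as a
polynomial in the first position. -/
theorem exists_polynomials_reg_sub_correction (hg : 1 ≤ g) (hp : Squarefree p)
    (hdeg : p.natDegree = 2 * g + 1) (hS : S.one ≠ 0) (Pe Po : ℂ[X])
    (hP : ∀ x y : ℂ, y ≠ 0 → y ^ 2 = p.eval x → p.eval x * S.T₁ x y =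
      c / 32 * ((derivative p).eval x ^ 2 / p.eval x) * S.one
        + 1 / 4 * (Pe.eval x + y * Po.eval x))
    (hsh : OddShape p g c S.one Pe Po) {x₂ y₂ : ℂ} (h0 : y₂ ≠ 0) (h : y₂ ^ 2 = p.eval x₂) :
    ∃ E O : ℂ[X], E.degree < (2 * g - 1 : ℕ) ∧ O.degree < (g - 2 : ℕ) ∧
      ∀ x y, y ≠ 0 → y ^ 2 = p.eval x → x ≠ x₂ →
        S.reg Pe Po x y x₂ y₂ - correction g c S.one p Pe Po x y x₂ y₂ =
          E.eval x + y * O.eval x := by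
  have hp0 : p ≠ 0 := ne_zero_of_natDegree_pos (by omega)
  obtain ⟨⟨E₁, hE₁, hPe⟩, hPo, hPo0⟩ := hsh
  obtain ⟨E, O, -, -, hEO⟩ := S.exists_polynomials_reg hp (by omega) hS Pe Po hP h0 h
    (k := p.natDegree + Pe.natDegree + Po.natDegree) (by omega) (by omega) (by omega)
    (S.exists_bound_conn_inf hg (Or.inl hdeg) hS h0 h (by omega))
  -- Polynomiality is already known with crude degrees; after subtraction of the correction, the
  -- sharp growth at infinity determines the degrees.
  set E' := E - correction₀ g c S.one p Pe Po x₂ y₂ with hE'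
  set O' := O - correction₁ g p Po x₂ with hO'
  have hEO' : ∀ x y, y ≠ 0 → y ^ 2 = p.eval x → x ≠ x₂ →
      S.reg Pe Po x y x₂ y₂ - correction g c S.one p Pe Po x y x₂ y₂ =
        E'.eval x + y * O'.eval x := fun x y hy0 hy hx => by
    rw [hEO x y hy0 hy hx, correction_eq hg c S.one Pe hdeg hPo0, hE', hO', eval_sub, eval_sub]
    ring
  obtain ⟨B₁, hB₁⟩ := S.exists_bound_conn_odd hg hdeg hS h0 h
  obtain ⟨B₂, hB₂⟩ := exists_bound_of_growth_even_odd (p := p) (n := g + 1) (m := 2 * g - 2)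
    (by omega) (growthLE_R₀_add_correction₀ hg hdeg hE₁ c S.one x₂ y₂ hPe hPo)
    (growthLE_R₁_add_correction₁ hg hdeg hE₁ c S.one x₂ y₂ hPe hPo hPo0) (by push_cast; omega)
  have hlarge : ∀ᶠ x in Bornology.cobounded ℂ, x ≠ x₂ ∧ p.eval x ≠ 0 := by
    have hfin : Bornology.IsBounded (↑(insert x₂ p.roots.toFinset) : Set ℂ) :=
      (Finset.finite_toSet _).isBounded
    filter_upwards [Bornology.isBounded_def.1 hfin] with x hx
    have hx' : x ∉ insert x₂ p.roots.toFinset := fun hh => hx (Finset.mem_coe.2 hh)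
    simpa [hp0] using hx'
  obtain ⟨hE1, hO1⟩ := natDegree_le_of_growth_even_odd (E := E') (O := O') (k := 2 * g - 2)
    (B := B₁ * ‖p.eval x₂‖ + B₂) hp0 (by
      filter_upwards [hB₁, hB₂, hlarge] with x h1 h2 hx y hy
      have hy0 : y ≠ 0 := by
        rintro rfl
        exact hx.2 (by rw [← hy]; simp)
      rw [← hEO' x y hy0 hy hx.1, reg, R_eq, correction_eq hg c S.one Pe hdeg hPo0, sub_sub,
        add_mul, add_add_add_comm, ← mul_add]
      refine (norm_sub_le _ _).trans (add_le_add ?_ (h2 y hy))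
      rw [norm_mul, mul_right_comm]
      gcongr
      exact h1 y hy)
  refine ⟨E', O', degree_le_natDegree.trans_lt (by exact_mod_cast (by omega)), ?_, hEO'⟩
  rcases eq_or_ne O' 0 with hz | hz
  · rw [hz, degree_zero]
    exact WithBot.bot_lt_coe _
  -- `2 deg O' + (2g + 1) ≤ 2 (2g - 2)` forces `deg O' ≤ g - 3`, by parity.
  · have := hO1 hz
    rw [← natDegree_lt_iff_degree_lt hz]
    omega

end VirasoroState

end HyperellipticCFT

/-! ### The theorem -/

theorem theorem2 (g : ℕ) (hg : 1 ≤ g) (p : Polynomial ℂ) (hp : Squarefree p)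
    (hdeg : p.natDegree = 2 * g + 1 ∨ p.natDegree = 2 * g + 2) (c : ℂ)
    (S : HyperellipticCFT.VirasoroState p g c) (hS : S.one ≠ 0) :
    -- growth of the connected two-point function as `x₁ → ∞`, for fixed `(x₂, y₂)`
    (p.natDegree = 2 * g + 1 →
      ∀ x₂ y₂ : ℂ, y₂ ≠ 0 → y₂ ^ 2 = p.eval x₂ →
        (fun P₁ : ℂ × ℂ => S.T₂c P₁.1 P₁.2 x₂ y₂ * p.eval P₁.1 * p.eval x₂)
          =O[Filter.comap Prod.fst (Bornology.cobounded ℂ) ⊓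
              Filter.principal {P₁ : ℂ × ℂ | P₁.2 ^ 2 = p.eval P₁.1}]
        (fun P₁ : ℂ × ℂ => P₁.1 ^ (p.natDegree - 3))) ∧
    -- the polynomial `P(x, y) = Pe x + y * Po x` of the one-point function
    ∃ Pe Po : Polynomial ℂ,
      (∀ x y : ℂ, y ≠ 0 → y ^ 2 = p.eval x →
        p.eval x * S.T₁ x y =
          c / 32 * ((Polynomial.derivative p).eval x ^ 2 / p.eval x) * S.one
            + 1 / 4 * (Pe.eval x + y * Po.eval x)) ∧
      -- the singular part
      (∃ Q : MvPolynomial (Fin 4) ℂ,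
        ∀ x₁ y₁ x₂ y₂ : ℂ, y₁ ≠ 0 → y₂ ≠ 0 → y₁ ^ 2 = p.eval x₁ → y₂ ^ 2 = p.eval x₂ → x₁ ≠ x₂ →
          S.T₂ x₁ y₁ x₂ y₂ * p.eval x₁ * p.eval x₂
              - S.one⁻¹ * S.T₁ x₁ y₁ * S.T₁ x₂ y₂ * p.eval x₁ * p.eval x₂ =
            HyperellipticCFT.R c S.one p Pe Po x₁ y₁ x₂ y₂
              + MvPolynomial.eval ![x₁, x₂, y₁, y₂] Q) ∧
      -- the full function, for odd degree
      (p.natDegree = 2 * g + 1 →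
        ∃ P0 P1 P2 P12 : MvPolynomial (Fin 2) ℂ,
          (∀ x₁ y₁ x₂ y₂ : ℂ, y₁ ≠ 0 → y₂ ≠ 0 → y₁ ^ 2 = p.eval x₁ → y₂ ^ 2 = p.eval x₂ →
            x₁ ≠ x₂ →
            S.T₂ x₁ y₁ x₂ y₂ * p.eval x₁ * p.eval x₂
                - S.one⁻¹ * S.T₁ x₁ y₁ * S.T₁ x₂ y₂ * p.eval x₁ * p.eval x₂ =
              HyperellipticCFT.R c S.one p Pe Po x₁ y₁ x₂ y₂
                + HyperellipticCFT.correction g c S.one p Pe Po x₁ y₁ x₂ y₂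
                + HyperellipticCFT.eval₂v P0 x₁ x₂
                + y₁ * HyperellipticCFT.eval₂v P1 x₁ x₂
                + y₂ * HyperellipticCFT.eval₂v P2 x₁ x₂
                + y₁ * y₂ * HyperellipticCFT.eval₂v P12 x₁ x₂) ∧
          HyperellipticCFT.DegLE P0 0 (p.natDegree - 3) ∧
          HyperellipticCFT.DegLE P0 1 (p.natDegree - 3) ∧
          HyperellipticCFT.DegLE P1 0 ((g : ℤ) - 3) ∧
          HyperellipticCFT.DegLE P1 1 (p.natDegree - 3) ∧
          HyperellipticCFT.DegLE P2 0 (p.natDegree - 3) ∧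
          HyperellipticCFT.DegLE P2 1 ((g : ℤ) - 3) ∧
          HyperellipticCFT.DegLE P12 0 ((g : ℤ) - 3) ∧
          HyperellipticCFT.DegLE P12 1 ((g : ℤ) - 3) ∧
          (∀ x₁ x₂ : ℂ,
            HyperellipticCFT.eval₂v P0 x₁ x₂ = HyperellipticCFT.eval₂v P0 x₂ x₁) ∧
          (∀ x₁ x₂ : ℂ,
            HyperellipticCFT.eval₂v P12 x₁ x₂ = HyperellipticCFT.eval₂v P12 x₂ x₁) ∧
          (∀ x₁ x₂ y₁ y₂ : ℂ,
            y₁ * HyperellipticCFT.eval₂v P1 x₁ x₂ + y₂ * HyperellipticCFT.eval₂v P2 x₁ x₂ =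
              y₂ * HyperellipticCFT.eval₂v P1 x₂ x₁ + y₁ * HyperellipticCFT.eval₂v P2 x₂ x₁)) := by
  have hp0 : p ≠ 0 := HyperellipticCFT.ne_zero_of_natDegree_pos (by omega)
  obtain ⟨Pe, Po, hP, hodd⟩ := S.exists_one_point_polynomials hg hp hdeg hS
  refine ⟨fun hn x₂ y₂ h0 h => S.isBigO_T₂c hg hn hS h0 h, Pe, Po, hP, ?_, fun hn => ?_⟩
  · obtain ⟨Q, hQ⟩ := S.exists_polynomial_eq_reg hg hp hdeg hS Pe Po hP
    refine ⟨Q, fun x₁ y₁ x₂ y₂ h1 h2 h3 h4 h5 => ?_⟩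
    rw [← hQ x₁ y₁ x₂ y₂ h1 h2 h3 h4 h5, S.T₂_sub_eq_conn,
      HyperellipticCFT.VirasoroState.reg]
    ring
  -- `2g - 1` and `g - 2` are strict degree bounds, one above `n - 3` and `g - 3`. For `g ≤ 2` the
  -- second is `0` in `ℕ`, so `P1`, `P2` and `P12` vanish.
  · obtain ⟨c₀, c₁, c₂, c₁₂, hc, hs0, hs12, hs⟩ :=
      HyperellipticCFT.exists_symmetric_bival_of_symmetric hp0
        (fun x₁ y₁ x₂ y₂ => S.reg Pe Po x₁ y₁ x₂ y₂
          - HyperellipticCFT.correction g c S.one p Pe Po x₁ y₁ x₂ y₂) (2 * g - 1) (g - 2)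
        (fun x₁ y₁ x₂ y₂ => by rw [S.reg_symm, HyperellipticCFT.correction_symm])
        (fun x₂ y₂ h0 h => S.exists_polynomials_reg_sub_correction hg hp hn hS Pe Po hP
          (hodd hn) h0 h)
    refine ⟨HyperellipticCFT.bipoly (2 * g - 1) (2 * g - 1) c₀, HyperellipticCFT.bipoly (g - 2) (2 * g - 1) c₁,
      HyperellipticCFT.bipoly (2 * g - 1) (g - 2) c₂, HyperellipticCFT.bipoly (g - 2) (g - 2) c₁₂,
      fun x₁ y₁ x₂ y₂ h1 h2 h3 h4 h5 => ?_,
      HyperellipticCFT.degLE_bipoly_zero (by omega), HyperellipticCFT.degLE_bipoly_one (by omega),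
      HyperellipticCFT.degLE_bipoly_zero (by omega), HyperellipticCFT.degLE_bipoly_one (by omega),
      HyperellipticCFT.degLE_bipoly_zero (by omega), HyperellipticCFT.degLE_bipoly_one (by omega),
      HyperellipticCFT.degLE_bipoly_zero (by omega), HyperellipticCFT.degLE_bipoly_one (by omega),
      ?_, ?_, ?_⟩
    · have := hc x₁ y₁ x₂ y₂ h1 h2 h3 h4 h5
      simp only [HyperellipticCFT.VirasoroState.reg] at this
      simp only [HyperellipticCFT.eval₂v_bipoly, S.T₂_sub_eq_conn]
      linear_combination this
    · simpa only [HyperellipticCFT.eval₂v_bipoly] using hs0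
    · simpa only [HyperellipticCFT.eval₂v_bipoly] using hs12
    · intro x₁ x₂ y₁ y₂
      simp only [HyperellipticCFT.eval₂v_bipoly, hs x₁ x₂, hs x₂ x₁]
      ring
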